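/- Let $X=(M,j)$ be a complex manifold and let $L\to X$ be a holomorphic line bundle. Write $\Gamma(L)$ for the $C^\infty(M,\mathbb C)$-module of smooth sections of $L$, $\mathcal O_X$ for the sheaf of holomorphic functions, $\Gamma_L$ for the sheaf of holomorphic sections of $L$, and $\overline\partial$ for the flat $T^{0,1}X$-connection of $L$. A complex derivation of $L$ is a $\mathbb C$-linear operator $\Delta$ on $\Gamma(L)$ for which there is a complex vector field $\sigma(\Delta)=\xi$ on $M$ (its symbol) with $\Delta(f\lambda)=\xi(f)\lambda+f\Delta(\lambda)$ for $f\in C^\infty(M,\mathbb C)$, $\lambda\in\Gamma(L)$. A holomorphic Jacobi bi-derivation of $L$ is a skew-symmetric $\mathbb C$-bilinear map $J:\Gamma(L)\times\Gamma(L)\to\Gamma(L)$ which in each entry is a complex derivation with symbol in $T^{1,0}X$ (that is, $J\in\Gamma(D^{2,0}L)$), such that 1. $\overline\partial{}^{DL}J=0$, i.e. for every section $\xi$ of $T^{0,1}X$ the $(2,0)$-component of $[\overline\partial_\xi,J]^{SJ}$ vanishes, where $[-,-]^{SJ}$ is the Schouten-Jacobi bracket, a bi-derivation $\Delta$ is viewed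 as the bundle map $\wedge^2\mathfrak J^1_{\mathbb R}L\to L$ given by $\mathfrak j^1_{\mathbb R}\lambda\wedge\mathfrak j^1_{\mathbb R}\mu\mapsto\Delta(\lambda,\mu)$ on first (real) jets, and its $(2,0)$-component is its restriction to $\wedge^2\mathfrak J^1L$, with $\mathfrak J^1L\subset\mathfrak J^1_{\mathbb R}L$ the bundle of first jets annihilated by $\overline\partial$; 2. $[J,J]^{SJ}=0$. A Jacobi module structure over a commutative unital $\mathbb C$-algebra $\mathcal A$ on an $\mathcal A$-module $\mathcal L$ consists of a ($\mathbb C$-bilinear) Lie bracket $\{-,-\}$ on $\mathcal L$ and a ($\mathbb C$-linear) Lie algebra homomorphism $R:\mathcal L\to\operatorname{Der}\mathcal A$ with $\{\lambda_1,a\lambda_2\}=R_{\lambda_1}(a)\lambda_2+a\{\lambda_1,\lambda_2\}$ for all $\lambda_1,\lambda_2\in\mathcal L$, $a\in\mathcal A$. A Jacobi $\mathcal O_X$-module structure on $\Gamma_L$ consists of a Jacobi $\mathcal O_X(U)$-module structure on $\Gamma_L(U)$ for every open $U\subset X$, such that the brackets and the homomorphisms $R$ are compatible with restrictions. Then restriction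 to holomorphic sections is a one-to-one correspondence between the holomorphic Jacobi bi-derivations $J$ of $L$ and the Jacobi $\mathcal O_X$-module structures on $\Gamma_L$. Here the structure corresponding to $J$ is the unique one for which, for all open $U\subset X$, $\lambda,\mu\in\Gamma_L(U)$, $a\in\mathcal O_X(U)$ and $x\in U$, $$\{\lambda,\mu\}(x)=J(\lambda',\mu')(x),\qquad R_\lambda(a)(x)=\sigma\big(J(\lambda',-)\big)(a')(x)$$ whenever $\lambda',\mu'\in\Gamma(L)$ and $a'\in C^\infty(M,\mathbb C)$ agree with $\lambda,\mu$ and $a$ near $x$. -/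

import Mathlib

open scoped Manifold ContDiff Bundle
open TopologicalSpace Bundle

namespace HolJacobi

/-! ### Functions on a complex manifold

A complex manifold is modelled on a finite dimensional complex vector space `E`. A map between
complex manifolds is holomorphic if it is complex differentiable to all orders, i.e. `C^∞` over `ℂ`;
the underlying smooth manifold is the same charted space, considered with the model `𝓘(ℝ, E)`. -/

section Functions

variable {E : Type*} [NormedAddCommGroup E] [NormedSpace ℂ E]
  {X : Type*} [TopologicalSpace X] [ChartedSpace E X]

/-- The smooth manifold underlying a complex manifold. -/
instance realIsManifold [hX : IsManifold 𝓘(ℂ, E) ∞ X] : IsManifold 𝓘(ℝ, E) ∞ X := by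
  apply isManifold_of_contDiffOn
  intro e e' he he'
  have h := (contDiffGroupoid ∞ 𝓘(ℂ, E)).compatible he he'
  have h4 : ContDiffOn ℂ ∞ (𝓘(ℂ, E) ∘ e.symm ≫ₕ e' ∘ 𝓘(ℂ, E).symm)
    (𝓘(ℂ, E).symm ⁻¹' (e.symm ≫ₕ e').source ∩ Set.range 𝓘(ℂ, E)) :=
    (mem_groupoid_of_pregroupoid.1 h).1
  exact h4.restrict_scalars ℝ

theorem contMDiffAt_real {f : X → ℂ} {x : X} (h : ContMDiffAt 𝓘(ℂ, E) 𝓘(ℂ) ∞ f x) :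
    ContMDiffAt 𝓘(ℝ, E) 𝓘(ℝ, ℂ) ∞ f x := by
  rw [contMDiffAt_iff] at h ⊢
  exact ⟨h.1, h.2.restrict_scalars ℝ⟩

theorem contMDiffAt_mul_real {f g : X → ℂ} {x : X} (hf : ContMDiffAt 𝓘(ℝ, E) 𝓘(ℝ, ℂ) ∞ f x)
    (hg : ContMDiffAt 𝓘(ℝ, E) 𝓘(ℝ, ℂ) ∞ g x) :
    ContMDiffAt 𝓘(ℝ, E) 𝓘(ℝ, ℂ) ∞ (fun y => f y * g y) x :=
  (contDiff_mul (𝕜 := ℝ) (𝔸 := ℂ)).contMDiff.contMDiffAt.comp x (hf.prodMk_space hg)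

/-- The complex structure `j` on the (real) tangent spaces of a complex manifold. -/
def tangentJ (x : X) (v : TangentSpace 𝓘(ℝ, E) x) : TangentSpace 𝓘(ℝ, E) x :=
  (Complex.I • (show E from v) : E)

/-- The real differential `d_x f : T_x X → ℂ` of a complex valued function. -/
noncomputable def realDiff (f : X → ℂ) (x : X) : TangentSpace 𝓘(ℝ, E) x →L[ℝ] ℂ :=
  mfderiv 𝓘(ℝ, E) 𝓘(ℝ, ℂ) f x

theorem realDiff_tangentJ {f : X → ℂ} {x : X} (h : ContMDiffAt 𝓘(ℂ, E) 𝓘(ℂ) ∞ f x)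
    (v : TangentSpace 𝓘(ℝ, E) x) :
    realDiff f x (tangentJ x v) = Complex.I * realDiff f x v := by
  have h1 := (h.mdifferentiableAt (by simp)).hasMFDerivAt
  let D : E →L[ℂ] ℂ := mfderiv 𝓘(ℂ, E) 𝓘(ℂ) f x
  have h2 : HasMFDerivAt 𝓘(ℝ, E) 𝓘(ℝ, ℂ) f x (D.restrictScalars ℝ) :=
    ⟨h1.1, HasFDerivWithinAt.restrictScalars ℝ h1.2⟩
  have h3 : realDiff f x = D.restrictScalars ℝ := h2.mfderiv
  rw [h3]
  exact D.map_smul Complex.I v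

theorem realDiff_mul {f g : X → ℂ} {x : X} (hf : ContMDiffAt 𝓘(ℝ, E) 𝓘(ℝ, ℂ) ∞ f x)
    (hg : ContMDiffAt 𝓘(ℝ, E) 𝓘(ℝ, ℂ) ∞ g x) (v : TangentSpace 𝓘(ℝ, E) x) :
    realDiff (fun y => f y * g y) x v = f x * realDiff g x v + g x * realDiff f x v := by
  have h1 := (hf.mdifferentiableAt (by simp)).hasMFDerivAt
  have h2 := (hg.mdifferentiableAt (by simp)).hasMFDerivAt
  have h3 := HasMFDerivAt.mul (p := f) (q := g) h1 h2
  have h4 : realDiff (fun y => f y * g y) x = _ := h3.mfderiv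
  rw [h4]
  rfl

theorem realDiff_congr {f g : X → ℂ} {x : X} (h : f =ᶠ[nhds x] g) :
    (realDiff f x : TangentSpace 𝓘(ℝ, E) x →L[ℝ] ℂ) = realDiff g x :=
  h.mfderiv_eq

variable (E) in
/-- The algebra `𝒪_X(U)` of holomorphic functions on an open subset `U`. -/
def HolFun (U : Opens X) : Subalgebra ℂ (U → ℂ) where
  carrier := {f | ContMDiff 𝓘(ℂ, E) 𝓘(ℂ) ∞ f}
  mul_mem' hf hg := ContMDiff.mul hf hg
  add_mem' hf hg := ContMDiff.add hf hg
  algebraMap_mem' _ := contMDiff_const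

variable (E X) in
/-- The algebra `C^∞(X, ℂ)` of smooth complex valued functions. -/
def SmoothFun : Subalgebra ℂ (X → ℂ) where
  carrier := {f | ContMDiff 𝓘(ℝ, E) 𝓘(ℝ, ℂ) ∞ f}
  mul_mem' hf hg := fun x => contMDiffAt_mul_real (hf x) (hg x)
  add_mem' hf hg := ContMDiff.add hf hg
  algebraMap_mem' _ := contMDiff_const

end Functions

/-! ### Holomorphic line bundles and their sections -/

section Sections

variable {E : Type*} [NormedAddCommGroup E] [NormedSpace ℂ E]
  {X : Type*} [TopologicalSpace X] [ChartedSpace E X]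
  {L : X → Type*} [∀ x, AddCommGroup (L x)] [∀ x, Module ℂ (L x)] [∀ x, TopologicalSpace (L x)]
  [TopologicalSpace (TotalSpace ℂ L)] [FiberBundle ℂ L] [VectorBundle ℂ ℂ L]

/-- The coordinate of a section in the preferred local trivialization at `x₀`. -/
noncomputable def coord (s : ∀ x, L x) (x₀ y : X) : ℂ := (trivializationAt ℂ L x₀ ⟨y, s y⟩).2

variable (E L) in
/-- The `𝒪_X(U)`-module `Γ_L(U)` of holomorphic sections of `L` over an open subset `U`. -/
def HolSec (U : Opens X) : Submodule (HolFun E U) (∀ x : U, L x) where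
  carrier := {s | ContMDiff 𝓘(ℂ, E) (𝓘(ℂ, E).prod 𝓘(ℂ, ℂ)) ∞
    (fun x : U => (⟨x, s x⟩ : TotalSpace ℂ L))}
  zero_mem' := by
    intro x
    exact (contMDiff_zeroSection ℂ L).contMDiffAt.comp x contMDiff_subtype_val.contMDiffAt
  add_mem' := by
    intro s t hs ht x
    have hs := contMDiffAt_totalSpace.1 (hs x)
    have ht := contMDiffAt_totalSpace.1 (ht x)
    refine contMDiffAt_totalSpace.2 ⟨hs.1, (hs.2.add ht.2).congr_of_eventuallyEq ?_⟩
    have hb := (trivializationAt ℂ L x.1).open_baseSet.preimage continuous_subtype_val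
      |>.mem_nhds (x := x) (mem_baseSet_trivializationAt ℂ L x.1)
    filter_upwards [hb] with y hy
    exact ((trivializationAt ℂ L x.1).linear ℂ hy).map_add _ _
  smul_mem' := by
    intro f s hs x
    have hs := contMDiffAt_totalSpace.1 (hs x)
    refine contMDiffAt_totalSpace.2 ⟨hs.1, ((f.2 x).mul hs.2).congr_of_eventuallyEq ?_⟩
    have hb := (trivializationAt ℂ L x.1).open_baseSet.preimage continuous_subtype_val
      |>.mem_nhds (x := x) (mem_baseSet_trivializationAt ℂ L x.1)
    filter_upwards [hb] with y hy
    exact ((trivializationAt ℂ L x.1).linear ℂ hy).map_smul _ _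

variable (E L) in
/-- The `C^∞(X, ℂ)`-module `Γ(L)` of smooth global sections of `L`. -/
def SmoothSec : Submodule (SmoothFun E X) (∀ x, L x) where
  carrier := {s | ContMDiff 𝓘(ℝ, E) (𝓘(ℝ, E).prod 𝓘(ℝ, ℂ)) ∞
    (fun x => (⟨x, s x⟩ : TotalSpace ℂ L))}
  zero_mem' := by
    intro x
    refine (contMDiffAt_section x).2 ((contMDiffAt_const (c := (0 : ℂ))).congr_of_eventuallyEq ?_)
    have hb := (trivializationAt ℂ L x).open_baseSet.mem_nhds (mem_baseSet_trivializationAt ℂ L x)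
    filter_upwards [hb] with y hy
    exact ((trivializationAt ℂ L x).linear ℂ hy).map_zero
  add_mem' := by
    intro s t hs ht x
    have hs := (contMDiffAt_section x).1 (hs x)
    have ht := (contMDiffAt_section x).1 (ht x)
    refine (contMDiffAt_section x).2 ((hs.add ht).congr_of_eventuallyEq ?_)
    have hb := (trivializationAt ℂ L x).open_baseSet.mem_nhds (mem_baseSet_trivializationAt ℂ L x)
    filter_upwards [hb] with y hy
    exact ((trivializationAt ℂ L x).linear ℂ hy).map_add _ _
  smul_mem' := by
    intro f s hs x
    have hs := (contMDiffAt_section x).1 (hs x)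
    refine (contMDiffAt_section x).2
      ((contMDiffAt_mul_real (f.2 x) hs).congr_of_eventuallyEq ?_)
    have hb := (trivializationAt ℂ L x).open_baseSet.mem_nhds (mem_baseSet_trivializationAt ℂ L x)
    filter_upwards [hb] with y hy
    exact ((trivializationAt ℂ L x).linear ℂ hy).map_smul _ _

instance (U : Opens X) : AddCommGroup (HolSec E L U) := Submodule.addCommGroup _
instance (U : Opens X) : Module (HolFun E U) (HolSec E L U) := Submodule.module _
instance (U : Opens X) : Module ℂ (HolSec E L U) := Submodule.module' _
instance (U : Opens X) : IsScalarTower ℂ (HolFun E U) (HolSec E L U) := Submodule.isScalarTower _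
instance : AddCommGroup (SmoothSec E L) := Submodule.addCommGroup _
instance : Module (SmoothFun E X) (SmoothSec E L) := Submodule.module _
instance : Module ℂ (SmoothSec E L) := Submodule.module' _
instance (U : Opens X) : SMul (HolFun E U) (HolSec E L U) := Module.toDistribMulAction.toSMul
instance : SMul (SmoothFun E X) (SmoothSec E L) := Module.toDistribMulAction.toSMul

/-- Restriction of holomorphic functions. -/
def resFun {U V : Opens X} (h : V ≤ U) (f : HolFun E U) : HolFun E V :=
  ⟨fun x => f.1 ⟨x, h x.2⟩, f.2.comp (contMDiff_inclusion h)⟩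

/-- Restriction of holomorphic sections. -/
def resSec {U V : Opens X} (h : V ≤ U) (s : HolSec E L U) : HolSec E L V :=
  ⟨fun x => s.1 ⟨x, h x.2⟩, s.2.comp (contMDiff_inclusion h)⟩

end Sections

/-! ### Complex vector fields -/

section VectorFields

variable (E : Type*) [NormedAddCommGroup E] [NormedSpace ℂ E]
  (X : Type*) [TopologicalSpace X] [ChartedSpace E X] [IsManifold 𝓘(ℂ, E) ∞ X]

/-- Complex vector fields `ξ = re + i im`, i.e. smooth sections of the complexification of the
real tangent bundle. -/
structure ComplexVectorField where
  re : ∀ x : X, TangentSpace 𝓘(ℝ, E) x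
  im : ∀ x : X, TangentSpace 𝓘(ℝ, E) x
  contMDiff_re : ContMDiff 𝓘(ℝ, E) 𝓘(ℝ, E).tangent ∞
    (fun x => (⟨x, re x⟩ : TangentBundle 𝓘(ℝ, E) X))
  contMDiff_im : ContMDiff 𝓘(ℝ, E) 𝓘(ℝ, E).tangent ∞
    (fun x => (⟨x, im x⟩ : TangentBundle 𝓘(ℝ, E) X))

variable {E X}

/-- The derivative `ξ(f)` of a complex valued function along a complex vector field. -/
noncomputable def ComplexVectorField.deriv (ξ : ComplexVectorField E X) (f : X → ℂ) (x : X) : ℂ :=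
  realDiff f x (ξ.re x) + Complex.I * realDiff f x (ξ.im x)

/-- `ξ` is a section of `T^{1,0} X`, the `+i`-eigenbundle of `j`: `ξ = v - i j v`. -/
def ComplexVectorField.IsType10 (ξ : ComplexVectorField E X) : Prop :=
  ∀ x, ξ.im x = -tangentJ x (ξ.re x)

/-- `ξ` is a section of `T^{0,1} X`, the `-i`-eigenbundle of `j`: `ξ = v + i j v`. -/
def ComplexVectorField.IsType01 (ξ : ComplexVectorField E X) : Prop :=
  ∀ x, ξ.im x = tangentJ x (ξ.re x)

end VectorFields

/-! ### The flat `T^{0,1} X`-connection of a holomorphic line bundle -/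

section Dbar

variable {E : Type*} [NormedAddCommGroup E] [NormedSpace ℂ E]
  {X : Type*} [TopologicalSpace X] [ChartedSpace E X]
  {L : X → Type*} [∀ x, AddCommGroup (L x)] [∀ x, Module ℂ (L x)] [∀ x, TopologicalSpace (L x)]
  [TopologicalSpace (TotalSpace ℂ L)] [FiberBundle ℂ L] [VectorBundle ℂ ℂ L]

/-- The value `(∂̄ s)_x(v) ∈ L_x` on a real tangent vector `v`: in a local holomorphic frame `μ`,
`∂̄ (g μ) = (∂̄ g) μ`, where `∂̄ g = (d g + i d g ∘ j) / 2`. -/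
noncomputable def dbar (s : SmoothSec E L) (x : X) (v : TangentSpace 𝓘(ℝ, E) x) : L x :=
  (trivializationAt ℂ L x).symm x
    ((realDiff (coord s.1 x) x v + Complex.I * realDiff (coord s.1 x) x (tangentJ x v)) / 2)

/-- The value `∂̄_ξ s` at `x`, for a complex vector field `ξ`. -/
noncomputable def dbarAlong [IsManifold 𝓘(ℂ, E) ∞ X] (ξ : ComplexVectorField E X)
    (s : SmoothSec E L) (x : X) : L x :=
  dbar s x (ξ.re x) + Complex.I • dbar s x (ξ.im x)

theorem tangentJ_tangentJ (x : X) (v : TangentSpace 𝓘(ℝ, E) x) :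
    tangentJ x (tangentJ x v) = -v := by
  change (Complex.I • Complex.I • (show E from v) : E) = -(show E from v)
  rw [smul_smul, Complex.I_mul_I, neg_one_smul]

theorem coord_real (s : SmoothSec E L) (x : X) :
    ContMDiffAt 𝓘(ℝ, E) 𝓘(ℝ, ℂ) ∞ (coord s.1 x) x :=
  (contMDiffAt_section x).1 (s.2 x)

theorem dbarAlong_eq [IsManifold 𝓘(ℂ, E) ∞ X] {ξ : ComplexVectorField E X} (hξ : ξ.IsType01)
    (s : SmoothSec E L) (x : X) :
    dbarAlong ξ s x = (trivializationAt ℂ L x).symm x (ξ.deriv (coord s.1 x) x) := by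
  have hx := mem_baseSet_trivializationAt ℂ L x
  have hl : ∀ c : ℂ, (trivializationAt ℂ L x).symm x c =
      (trivializationAt ℂ L x).symmₗ ℂ x c := fun c => by
    rw [Trivialization.coe_symmₗ _ hx]
  unfold dbarAlong dbar ComplexVectorField.deriv
  rw [hl, hl, hl, ← map_smul, ← map_add, hξ x, tangentJ_tangentJ, map_neg, smul_eq_mul]
  congr 1
  linear_combination (-realDiff (coord s.1 x) x (ξ.re x) / 2) * Complex.I_mul_I

/-- The transition function from the preferred trivialization at `x` to the one at `x₀`. -/
noncomputable def trans (L : X → Type*) [∀ x, AddCommGroup (L x)] [∀ x, Module ℂ (L x)]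
    [∀ x, TopologicalSpace (L x)] [TopologicalSpace (TotalSpace ℂ L)] [FiberBundle ℂ L]
    [VectorBundle ℂ ℂ L] (x x₀ y : X) : ℂ :=
  (trivializationAt ℂ L x).coordChangeL ℂ (trivializationAt ℂ L x₀) y 1

theorem trans_mul {x x₀ y : X} (h : y ∈ (trivializationAt ℂ L x).baseSet)
    (h₀ : y ∈ (trivializationAt ℂ L x₀).baseSet) (c : ℂ) :
    (trivializationAt ℂ L x₀ ⟨y, (trivializationAt ℂ L x).symm y c⟩).2 = trans L x x₀ y * c := by
  rw [← Trivialization.coordChangeL_apply (R := ℂ) _ _ ⟨h, h₀⟩]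
  unfold trans
  rw [mul_comm, ← smul_eq_mul, ← map_smul, smul_eq_mul, mul_one]

theorem coord_trans (s : ∀ x, L x) {x x₀ y : X} (h : y ∈ (trivializationAt ℂ L x).baseSet)
    (h₀ : y ∈ (trivializationAt ℂ L x₀).baseSet) :
    coord s x₀ y = trans L x x₀ y * coord s x y := by
  rw [← trans_mul h h₀]
  unfold coord
  rw [Trivialization.symm_apply_apply_mk _ h]

theorem coord_eventuallyEq (s : SmoothSec E L) {x x₀ : X}
    (h₀ : x ∈ (trivializationAt ℂ L x₀).baseSet) :
    coord s.1 x₀ =ᶠ[nhds x] fun y => trans L x x₀ y * coord s.1 x y := by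
  filter_upwards [(trivializationAt ℂ L x).open_baseSet.mem_nhds
    (mem_baseSet_trivializationAt ℂ L x),
    (trivializationAt ℂ L x₀).open_baseSet.mem_nhds h₀] with y hy hy₀
  exact coord_trans s.1 hy hy₀

variable [ContMDiffVectorBundle ∞ ℂ L 𝓘(ℂ, E)]

theorem trans_hol {x x₀ y : X} (h : y ∈ (trivializationAt ℂ L x).baseSet)
    (h₀ : y ∈ (trivializationAt ℂ L x₀).baseSet) :
    ContMDiffAt 𝓘(ℂ, E) 𝓘(ℂ) ∞ (trans L x x₀) y :=
  (contMDiffAt_coordChangeL (IB := 𝓘(ℂ, E)) (n := ∞) h h₀).clm_apply contMDiffAt_const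

theorem coord_contMDiffOn (s : SmoothSec E L) (x₀ : X) :
    ContMDiffOn 𝓘(ℝ, E) 𝓘(ℝ, ℂ) ∞ (coord s.1 x₀) (trivializationAt ℂ L x₀).baseSet := by
  intro x hx
  refine ContMDiffAt.contMDiffWithinAt (ContMDiffAt.congr_of_eventuallyEq ?_
    (coord_eventuallyEq s hx))
  exact contMDiffAt_mul_real (contMDiffAt_real (trans_hol (mem_baseSet_trivializationAt ℂ L x) hx))
    (coord_real s x)

variable [IsManifold 𝓘(ℂ, E) ∞ X]

theorem coord_dbarAlong {ξ : ComplexVectorField E X} (hξ : ξ.IsType01) (s : SmoothSec E L)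
    {x x₀ : X} (h₀ : x ∈ (trivializationAt ℂ L x₀).baseSet) :
    coord (dbarAlong ξ s) x₀ x = ξ.deriv (coord s.1 x₀) x := by
  have hx := mem_baseSet_trivializationAt ℂ L x
  have ht := trans_hol (E := E) hx h₀
  unfold coord at *
  rw [dbarAlong_eq hξ, trans_mul hx h₀]
  change _ = ξ.deriv (coord s.1 x₀) x
  unfold ComplexVectorField.deriv
  rw [realDiff_congr (coord_eventuallyEq s h₀),
    realDiff_mul (contMDiffAt_real ht) (coord_real s x),
    realDiff_mul (contMDiffAt_real ht) (coord_real s x), hξ x, realDiff_tangentJ ht]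
  linear_combination (-coord s.1 x x * realDiff (trans L x x₀) x (ξ.re x)) * Complex.I_mul_I

theorem contMDiffAt_realDiff {f : X → ℂ} {U : Set X} (hU : IsOpen U)
    (hf : ContMDiffOn 𝓘(ℝ, E) 𝓘(ℝ, ℂ) ∞ f U) {v : ∀ x : X, TangentSpace 𝓘(ℝ, E) x}
    (hv : ContMDiff 𝓘(ℝ, E) 𝓘(ℝ, E).tangent ∞ (fun x => (⟨x, v x⟩ : TangentBundle 𝓘(ℝ, E) X)))
    {x : X} (hx : x ∈ U) :
    ContMDiffAt 𝓘(ℝ, E) 𝓘(ℝ, ℂ) ∞ (fun y => realDiff f y (v y)) x := by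
  have h1 := hf.contMDiffOn_tangentMapWithin (m := ∞) (by simp) hU.uniqueMDiffOn
  have h2 := h1.contMDiffAt ((hU.preimage (FiberBundle.continuous_proj E
    (TangentSpace 𝓘(ℝ, E) : X → Type _))).mem_nhds (x := ⟨x, v x⟩) hx)
  have h3 := h2.comp x (hv x)
  have h4 := (contMDiff_snd_tangentBundle_modelSpace ℂ 𝓘(ℝ, ℂ) (n := ∞)).contMDiffAt.comp x h3
  refine h4.congr_of_eventuallyEq ?_
  filter_upwards [hU.mem_nhds hx] with y hy
  change mfderiv 𝓘(ℝ, E) 𝓘(ℝ, ℂ) f y (v y) = mfderivWithin 𝓘(ℝ, E) 𝓘(ℝ, ℂ) f U y (v y)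
  rw [mfderivWithin_of_isOpen hU hy]

/-- The operator `∂̄_ξ : Γ(L) → Γ(L)`, for `ξ` a section of `T^{0,1} X`. -/
noncomputable def dbarOp (ξ : ComplexVectorField E X) (hξ : ξ.IsType01) (s : SmoothSec E L) :
    SmoothSec E L :=
  ⟨dbarAlong ξ s, by
    intro x
    refine (contMDiffAt_section x).2 ?_
    have hx := mem_baseSet_trivializationAt ℂ L x
    have hU := (trivializationAt ℂ L x).open_baseSet
    have h1 := contMDiffAt_realDiff hU (coord_contMDiffOn s x) ξ.contMDiff_re hx
    have h2 := contMDiffAt_realDiff hU (coord_contMDiffOn s x) ξ.contMDiff_im hx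
    refine ContMDiffAt.congr_of_eventuallyEq
      (h1.add (contMDiffAt_mul_real (contMDiffAt_const (c := Complex.I)) h2)) ?_
    filter_upwards [hU.mem_nhds hx] with y hy
    exact coord_dbarAlong hξ s hy⟩

end Dbar

/-! ### Multiderivations and the Schouten-Jacobi bracket -/

section Bracket

variable {V : Type*} [AddCommGroup V]

/-- `(p, q)`-unshuffles. -/
def unshuffles (p q : ℕ) : Finset (Equiv.Perm (Fin (p + q))) :=
  {τ | (∀ i j, i < j → τ (Fin.castAdd q i) < τ (Fin.castAdd q j)) ∧
    (∀ i j, i < j → τ (Fin.natAdd p i) < τ (Fin.natAdd p j))}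

/-- The Gerstenhaber product `Δ₁ ∘ Δ₂` of a `(k₁ + 1)`-ary and a `(k₂ + 1)`-ary operation. -/
def gerstenhaber (k₁ k₂ : ℕ) (Δ₁ : (Fin (k₁ + 1) → V) → V) (Δ₂ : (Fin (k₂ + 1) → V) → V)
    (l : Fin (k₁ + k₂ + 1) → V) : V :=
  ∑ τ ∈ unshuffles (k₂ + 1) k₁, (Equiv.Perm.sign τ : ℤ) •
    Δ₁ (Fin.cons (Δ₂ fun i => l (Fin.cast (by omega) (τ (Fin.castAdd k₁ i))))
      fun j => l (Fin.cast (by omega) (τ (Fin.natAdd (k₂ + 1) j))))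

/-- The Schouten-Jacobi bracket `(-1)^{k₁ k₂} Δ₁ ∘ Δ₂ - Δ₂ ∘ Δ₁`. -/
def schoutenJacobi (k₁ k₂ : ℕ) (Δ₁ : (Fin (k₁ + 1) → V) → V) (Δ₂ : (Fin (k₂ + 1) → V) → V)
    (l : Fin (k₁ + k₂ + 1) → V) : V :=
  (-1 : ℤ) ^ (k₁ * k₂) • gerstenhaber k₁ k₂ Δ₁ Δ₂ l -
    gerstenhaber k₂ k₁ Δ₂ Δ₁ fun i => l (Fin.cast (by omega) i)

end Bracket

section Jacobi

variable {E : Type*} [NormedAddCommGroup E] [NormedSpace ℂ E]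
  {X : Type*} [TopologicalSpace X] [ChartedSpace E X] [IsManifold 𝓘(ℂ, E) ∞ X]
  {L : X → Type*} [∀ x, AddCommGroup (L x)] [∀ x, Module ℂ (L x)] [∀ x, TopologicalSpace (L x)]
  [TopologicalSpace (TotalSpace ℂ L)] [FiberBundle ℂ L] [VectorBundle ℂ ℂ L]

/-- `ξ` is the symbol of the operator `Δ` on `Γ(L)`: `Δ(f s) = ξ(f) s + f Δ(s)`. A complex
derivation of `L` is a `ℂ`-linear operator which has a symbol. -/
def HasSymbol (Δ : SmoothSec E L → SmoothSec E L) (ξ : ComplexVectorField E X) : Prop :=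
  ∀ (f : SmoothFun E X) (s : SmoothSec E L) (x : X),
    (Δ (f • s)).1 x = ξ.deriv f.1 x • s.1 x + f.1 x • (Δ s).1 x

/-- Sections of `D^{k,0} L`: skew-symmetric `ℂ`-multilinear operators which are, in each entry, a
complex derivation with symbol in `T^{1,0} X`, i.e. a section of `D^{1,0} L = σ⁻¹(T^{1,0} X)`. -/
def IsMultiderivation10 {k : ℕ} (Δ : SmoothSec E L [⋀^Fin k]→ₗ[ℂ] SmoothSec E L) : Prop :=
  ∀ (i : Fin k) (l : Fin k → SmoothSec E L),
    ∃ ξ : ComplexVectorField E X, ξ.IsType10 ∧ HasSymbol (fun s => Δ (Function.update l i s)) ξ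

/-- The first jet of `s` at `x` lies in the bundle `𝔍¹L = ker ∂̄` of first holomorphic jets. -/
def IsHolJet (s : SmoothSec E L) (x : X) : Prop := ∀ v, dbar s x v = 0

/-- The `(k,0)`-component of a multiderivation `Δ` vanishes. As a section of
`Hom(⋀^k 𝔍¹_ℝ L, L)`, the multiderivation `Δ` sends `j¹s₁ ∧ ⋯ ∧ j¹s_k` to `Δ(s₁, …, s_k)`; its
`(k,0)`-component is its restriction to `⋀^k 𝔍¹L`. -/
def ComponentVanishes {k : ℕ} (Δ : (Fin k → SmoothSec E L) → SmoothSec E L) : Prop :=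
  ∀ (x : X) (l : Fin k → SmoothSec E L), (∀ i, IsHolJet (l i) x) → (Δ l).1 x = 0

variable [ContMDiffVectorBundle ∞ ℂ L 𝓘(ℂ, E)]

/-- `∂̄^{DL} Δ = 0`, where `∂̄^{DL}_ξ Δ` is the `(k,0)`-component of `[∂̄_ξ, Δ]^{SJ}`. -/
def IsDbarClosed {k : ℕ} (Δ : (Fin (k + 1) → SmoothSec E L) → SmoothSec E L) : Prop :=
  ∀ (ξ : ComplexVectorField E X) (hξ : ξ.IsType01),
    ComponentVanishes (schoutenJacobi 0 k (fun l => dbarOp ξ hξ (l 0)) Δ)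

variable (E L) in
/-- Holomorphic Jacobi bi-derivations of a holomorphic line bundle `L`. -/
structure HolomorphicJacobi where
  J : SmoothSec E L [⋀^Fin 2]→ₗ[ℂ] SmoothSec E L
  isMultiderivation : IsMultiderivation10 J
  isDbarClosed : IsDbarClosed (k := 1) J
  isJacobi : ∀ l, schoutenJacobi 1 1 J J l = 0

end Jacobi

/-! ### Jacobi modules -/

/-- The structure of a Jacobi `A`-module on an `A`-module `M`, where `A` is a commutative algebra
with unit over `ℂ`. -/
structure JacobiModule (A M : Type*) [CommRing A] [Algebra ℂ A] [AddCommGroup M] [Module ℂ M]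
    [Module A M] [IsScalarTower ℂ A M] where
  bracket : M →ₗ[ℂ] M →ₗ[ℂ] M
  bracket_self : ∀ s, bracket s s = 0
  jacobi : ∀ s t u, bracket s (bracket t u) = bracket (bracket s t) u + bracket t (bracket s u)
  R : M →ₗ[ℂ] Derivation ℂ A A
  R_bracket : ∀ s t, R (bracket s t) = ⁅R s, R t⁆
  leibniz : ∀ s a t, bracket s (a • t) = R s a • t + a • bracket s t

section Sheaf

variable {E : Type*} [NormedAddCommGroup E] [NormedSpace ℂ E]
  {X : Type*} [TopologicalSpace X] [ChartedSpace E X]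
  {L : X → Type*} [∀ x, AddCommGroup (L x)] [∀ x, Module ℂ (L x)] [∀ x, TopologicalSpace (L x)]
  [TopologicalSpace (TotalSpace ℂ L)] [FiberBundle ℂ L] [VectorBundle ℂ ℂ L]

variable (E L) in
/-- Structures of a Jacobi `𝒪_X`-module on the sheaf `Γ_L` of holomorphic sections of `L`. -/
structure JacobiSheaf where
  on : ∀ U : Opens X, JacobiModule (HolFun E U) (HolSec E L U)
  bracket_res : ∀ (U V : Opens X) (h : V ≤ U) (s t : HolSec E L U),
    resSec h ((on U).bracket s t) = (on V).bracket (resSec h s) (resSec h t)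
  R_res : ∀ (U V : Opens X) (h : V ≤ U) (s : HolSec E L U) (a : HolFun E U),
    resFun h ((on U).R s a) = (on V).R (resSec h s) (resFun h a)

variable [IsManifold 𝓘(ℂ, E) ∞ X]

/-- The Jacobi `𝒪_X`-module structure `S` is the restriction of the bi-derivation `J` to holomorphic
sections: around every point of every open subset, the bracket of `S` is computed by `J` on smooth
extensions of the germs of the sections, and the derivation `R_s` is the symbol of `J(s, -)`. -/
def IsRestriction (J : SmoothSec E L [⋀^Fin 2]→ₗ[ℂ] SmoothSec E L) (S : JacobiSheaf E L) : Prop :=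
  ∀ (U : Opens X) (x : U) (s : HolSec E L U) (s' : SmoothSec E L),
    (∀ᶠ y : U in nhds x, s'.1 y = s.1 y) →
    (∀ (t : HolSec E L U) (t' : SmoothSec E L), (∀ᶠ y : U in nhds x, t'.1 y = t.1 y) →
      ((S.on U).bracket s t).1 x = (J ![s', t']).1 x) ∧
    (∀ (a : HolFun E U) (ξ : ComplexVectorField E X), HasSymbol (fun t => J ![s', t]) ξ →
      ∀ a' : SmoothFun E X, (∀ᶠ y : U in nhds x, a'.1 y = a.1 y) →
        ((S.on U).R s a).1 x = ξ.deriv a'.1 x)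

end Sheaf

end HolJacobi

set_option linter.unusedSectionVars false

/-! A bi-derivation $J$ with symbols in $T^{1,0}X$ cannot see $\overline\partial$ of its arguments:
$J(s,t)(x)$ depends only on the $(1,0)$-jets of $s,t$ at $x$, meaning the value and the complex
linear part of the differential in a holomorphic frame (`alt_congr_jet`). The bracket of a Jacobi
$\mathcal O_X$-module structure has the same dependence. If a holomorphic section has zero jet at
$x$, Hadamard's lemma writes it as $\sum_i a_ig_ie$ with $a_i,g_i$ holomorphic and vanishing at $x$,
and the Leibniz rule kills its bracket with anything (`bracket_eq_zero_of_jetZero`). Every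
$(1,0)$-jet is the jet of a holomorphic section that is affine in a chart (`jetEq_affineSec`). Hence
both kinds of structure amount to a field of skew forms on $(1,0)$-jets, and it remains to match the
regularity and the integrability conditions.

From $J$ to the sheaf: locality allows the bracket to be computed on smooth extensions of germs. For
holomorphic $s,t$ the terms of $[\overline\partial_\xi,J]$ containing $\overline\partial_\xi s$ and
$\overline\partial_\xi t$ vanish, so closedness of $J$ says $\overline\partial_\xi J(s,t)=0$, and
the bracket is holomorphic by Cauchy-Riemann (`holAt_alt`). The properties of $R$ all follow from
the Leibniz rule, tested on a local frame.

From the sheaf to $J$: in a chart, $J(s,t)=\sum_{k,l}c_k(s)c_l(t)B_{kl}$, where $c_k(s)(y)$ are the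
coefficients of the affine approximation of $s$ at $y$ and $B_{kl}$ are the holomorphic brackets of
the basis sections (`jetBracket_eq_sum`). Smoothness and symbol are read off from this. It is
$\overline\partial$-closed because $\overline\partial_\xi$ kills $B_{kl}$ and commutes with $c_k$ on
holomorphic jets (`dbarOp_smoothBracket`). An iterated bracket at $x$ sees only $(2,0)$-jets, which
are realised by holomorphic quadratic polynomials (`exists_holomorphic_two_jet`), so the Jacobi
identity is inherited from the sheaf.

Finally, `IsRestriction` is a relation in which each side determines the other
(`IsRestriction.sheaf_unique`, `IsRestriction.biderivation_unique`), and the two constructions show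
that each side has a partner. -/

namespace HolJacobi

/-! ### Complex linear parts of real differentials -/

section Analysis

variable {E : Type*} [NormedAddCommGroup E] [NormedSpace ℂ E]
  {F : Type*} [NormedAddCommGroup F] [NormedSpace ℂ F]

/-- The complex linear part of a real linear map between complex vector spaces. -/
noncomputable def part10 (A : E →L[ℝ] F) : E →L[ℂ] F where
  toFun u := (2⁻¹ : ℂ) • (A u - Complex.I • A (Complex.I • u))
  map_add' u v := by simp only [smul_add, map_add]; module
  map_smul' c u := by
    have h : ∀ w : E, A (c • w) = (c.re : ℂ) • A w + (c.im : ℂ) • A (Complex.I • w) := fun w => by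
      conv_lhs => rw [← Complex.re_add_im c, add_smul, mul_smul, map_add]
      rw [Complex.coe_smul, Complex.coe_smul, Complex.coe_smul, Complex.coe_smul, map_smul,
        map_smul]
    have h' : A (Complex.I • Complex.I • u) = - A u := by
      rw [smul_smul, Complex.I_mul_I, neg_one_smul, map_neg]
    simp only [RingHom.id_apply]
    rw [smul_comm Complex.I c u, h, h, h']
    conv_rhs => rw [← Complex.re_add_im c]
    have hI : ∀ z : F, Complex.I • Complex.I • z = -z := fun z => by
      rw [smul_smul, Complex.I_mul_I, neg_one_smul]
    match_scalars
    · ring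
    · linear_combination (c.im / 2 : ℂ) * Complex.I_mul_I
  cont := by fun_prop

theorem part10_apply (A : E →L[ℝ] F) (u : E) :
    part10 A u = (2⁻¹ : ℂ) • (A u - Complex.I • A (Complex.I • u)) := rfl

theorem part10_restrictScalars (A : E →L[ℂ] F) : part10 (A.restrictScalars ℝ) = A := by
  ext u
  rw [part10_apply, ContinuousLinearMap.coe_restrictScalars', map_smul, smul_smul,
    Complex.I_mul_I]
  module

variable (E F) in
/-- `part10` as a continuous linear map. -/
noncomputable def part10L : (E →L[ℝ] F) →L[ℝ] (E →L[ℂ] F) :=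
  LinearMap.mkContinuous
    { toFun := part10
      map_add' := fun A B => by
        ext u
        simp only [part10_apply, add_apply]
        module
      map_smul' := fun r A => by
        ext u
        simp only [part10_apply, smul_apply, RingHom.id_apply]
        rw [← Complex.coe_smul, ← Complex.coe_smul, ← Complex.coe_smul]
        module } 1 (fun A => by
      refine ContinuousLinearMap.opNorm_le_bound _ (by positivity) fun u => ?_
      change ‖part10 A u‖ ≤ _
      rw [part10_apply, norm_smul, one_mul]
      have h1 : ‖Complex.I • A (Complex.I • u)‖ ≤ ‖A‖ * ‖u‖ := by
        rw [norm_smul, Complex.norm_I, one_mul]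
        refine (A.le_opNorm _).trans ?_
        rw [norm_smul, Complex.norm_I, one_mul]
      have h2 := norm_sub_le (A u) (Complex.I • A (Complex.I • u))
      have h3 := A.le_opNorm u
      have h4 : ‖(2⁻¹ : ℂ)‖ = 2⁻¹ := by simp
      rw [h4]
      linarith)

theorem part10L_apply (A : E →L[ℝ] F) : part10L E F A = part10 A := rfl

theorem eq_restrictScalars_part10 {A : E →L[ℝ] F} (h : ∀ u, A (Complex.I • u) = Complex.I • A u) :
    (part10 A).restrictScalars ℝ = A := by
  ext u
  rw [ContinuousLinearMap.coe_restrictScalars', part10_apply, h, smul_smul, Complex.I_mul_I]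
  module

theorem hasFDerivAt_complex {f : E → F} {p : E} (hf : DifferentiableAt ℝ f p)
    (h : ∀ u, fderiv ℝ f p (Complex.I • u) = Complex.I • fderiv ℝ f p u) :
    HasFDerivAt f (part10 (fderiv ℝ f p)) p :=
  hasFDerivAt_of_restrictScalars ℝ hf.hasFDerivAt (eq_restrictScalars_part10 h)

theorem fderiv_real_eq {f : E → F} {p : E} (hf : DifferentiableAt ℂ f p) :
    fderiv ℝ f p = (fderiv ℂ f p).restrictScalars ℝ :=
  (hf.hasFDerivAt.restrictScalars ℝ).fderiv

theorem part10_fderiv {f : E → F} {p : E} (hf : DifferentiableAt ℂ f p) :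
    part10 (fderiv ℝ f p) = fderiv ℂ f p := by
  rw [fderiv_real_eq hf, part10_restrictScalars]

end Analysis

/-! ### Real smooth and complex differentiable implies complex smooth -/

section CauchyRiemann

/-- Both hypotheses pass to the derivative, without any integral formula. The complex derivative is
the $(1,0)$-part of the real one, hence real smooth. The real second derivative is symmetric and
complex linear in its second argument, hence complex linear in its first argument too. -/
theorem contDiffOn_fderiv_complex {E : Type*} [NormedAddCommGroup E] [NormedSpace ℂ E]
    {F : Type*} [NormedAddCommGroup F] [NormedSpace ℂ F] {U : Set E} (hU : IsOpen U) {f : E → F}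
    (hf : ContDiffOn ℝ ∞ f U) (hd : DifferentiableOn ℂ f U) :
    ContDiffOn ℝ ∞ (fderiv ℂ f) U ∧ DifferentiableOn ℂ (fderiv ℂ f) U := by
  have hd' : ∀ p ∈ U, DifferentiableAt ℂ f p := fun p hp => hd.differentiableAt (hU.mem_nhds hp)
  have h1 : ContDiffOn ℝ ∞ (fderiv ℝ f) U :=
    ((contDiffOn_succ_iff_fderiv_of_isOpen (n := ∞) hU).1 hf).2.2
  have h2 : ContDiffOn ℝ ∞ (fderiv ℂ f) U :=
    ((part10L E F).contDiff.comp_contDiffOn h1).congr fun p hp =>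
      (part10_fderiv (hd' p hp)).symm
  refine ⟨h2, fun p hp => ?_⟩
  have hpU := hU.mem_nhds hp
  have h2p : DifferentiableAt ℝ (fderiv ℂ f) p := (h2.contDiffAt hpU).differentiableAt (by simp)
  have h1p : DifferentiableAt ℝ (fderiv ℝ f) p := (h1.contDiffAt hpU).differentiableAt (by simp)
  have key : ∀ u v, fderiv ℝ (fderiv ℂ f) p u v = fderiv ℝ (fderiv ℝ f) p u v := by
    intro u v
    have e1 : (fun q => fderiv ℂ f q v) =ᶠ[nhds p] fun q => fderiv ℝ f q v := by
      filter_upwards [hpU] with q hq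
      rw [fderiv_real_eq (hd' q hq)]
      rfl
    have e2 : fderiv ℝ (fun q => fderiv ℂ f q v) p u = fderiv ℝ (fderiv ℂ f) p u v := by
      have := (((ContinuousLinearMap.apply ℂ F v).restrictScalars ℝ).hasFDerivAt.comp p
        h2p.hasFDerivAt).fderiv
      exact congrArg (fun B => B u) this
    have e3 : fderiv ℝ (fun q => fderiv ℝ f q v) p u = fderiv ℝ (fderiv ℝ f) p u v := by
      have := ((ContinuousLinearMap.apply ℝ F v).hasFDerivAt.comp p
        h1p.hasFDerivAt).fderiv
      exact congrArg (fun B => B u) this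
    rw [← e2, ← e3, e1.fderiv_eq]
  have sym : ∀ u v, fderiv ℝ (fderiv ℝ f) p u v = fderiv ℝ (fderiv ℝ f) p v u :=
    fun u v => (hf.contDiffAt hpU).isSymmSndFDerivAt (by
      rw [minSmoothness_of_isRCLikeNormedField]; exact WithTop.coe_le_coe.2 (le_top : (2 : ℕ∞) ≤ ⊤)) u v
  refine (hasFDerivAt_complex h2p fun u => ?_).differentiableAt.differentiableWithinAt
  ext v
  rw [key, sym, ← key, smul_apply, map_smul, key, key, sym]

universe u v

/-- The target ranges over `Type (max u v)` because the induction replaces `F` by `E →L[ℂ] F`, which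
has to stay in the same universe. -/
theorem contDiffOn_complex_aux {E : Type u} [NormedAddCommGroup E] [NormedSpace ℂ E] {U : Set E}
    (hU : IsOpen U) (n : ℕ) : ∀ {F : Type (max u v)} [NormedAddCommGroup F] [NormedSpace ℂ F]
      {f : E → F}, ContDiffOn ℝ ∞ f U → DifferentiableOn ℂ f U → ContDiffOn ℂ n f U := by
  induction n with
  | zero => exact fun h _ => contDiffOn_zero.2 h.continuousOn
  | succ n ih =>
    intro F _ _ f hf hd
    have h := contDiffOn_fderiv_complex hU hf hd
    push_cast
    exact (contDiffOn_succ_iff_fderiv_of_isOpen hU).2 ⟨hd, by simp, ih h.1 h.2⟩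

/-- A real smooth map which is complex differentiable is complex smooth. -/
theorem contDiffOn_complex {E : Type u} [NormedAddCommGroup E] [NormedSpace ℂ E]
    {F : Type v} [NormedAddCommGroup F] [NormedSpace ℂ F] {U : Set E}
    (hU : IsOpen U) {f : E → F} (hf : ContDiffOn ℝ ∞ f U) (hd : DifferentiableOn ℂ f U) :
    ContDiffOn ℂ ∞ f U := by
  have h := contDiffOn_fderiv_complex hU hf hd
  -- Passing to the derivative moves the target from `Type v` to `Type (max u v)`, where the
  -- induction applies.
  exact (contDiffOn_infty_iff_fderiv_of_isOpen hU).2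
    ⟨hd, contDiffOn_infty.2 fun n => contDiffOn_complex_aux.{u, v} hU n h.1 h.2⟩

end CauchyRiemann

/-! ### Hadamard's lemma with holomorphic coefficients -/

section Hadamard

open MeasureTheory intervalIntegral

theorem segment_mem_ball {E : Type*} [NormedAddCommGroup E] [NormedSpace ℂ E] {x y : E} {r : ℝ}
    {t : ℝ} (ht : t ∈ Set.Icc (0 : ℝ) 1) (hy : y ∈ Metric.ball x r) :
    x + (t : ℂ) • (y - x) ∈ Metric.ball x r := by
  rw [mem_ball_iff_norm] at hy ⊢
  rw [add_sub_cancel_left, norm_smul, Complex.norm_real, Real.norm_of_nonneg ht.1]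
  nlinarith [ht.2, norm_nonneg (y - x)]

/-- The weight $t^k$ makes this family of integrals stable under differentiation in $y$, since the
chain rule produces one more factor $t$. -/
theorem hasFDerivAt_segment_integral {E : Type*} [NormedAddCommGroup E] [NormedSpace ℂ E]
    [FiniteDimensional ℂ E] {F : Type*} [NormedAddCommGroup F] [NormedSpace ℂ F] {x : E} {r : ℝ}
    {h : E → F} (hh : ContDiffOn ℂ ∞ h (Metric.ball x r)) (k : ℕ) {y : E}
    (hy : y ∈ Metric.ball x r) :
    HasFDerivAt (fun y => ∫ t in (0 : ℝ)..1, ((t : ℂ) ^ k) • h (x + (t : ℂ) • (y - x)))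
      (∫ t in (0 : ℝ)..1, ((t : ℂ) ^ (k + 1)) • fderiv ℂ h (x + (t : ℂ) • (y - x))) y := by
  have : ProperSpace E := FiniteDimensional.proper ℂ E
  have hd : ContDiffOn ℂ ∞ (fderiv ℂ h) (Metric.ball x r) :=
    ((contDiffOn_infty_iff_fderiv_of_isOpen Metric.isOpen_ball).1 hh).2
  -- A slightly smaller closed ball is compact, which gives the uniform bound needed to
  -- differentiate under the integral.
  obtain ⟨ρ, hρ, hρr⟩ : ∃ ρ, ‖y - x‖ < ρ ∧ ρ < r := exists_between (mem_ball_iff_norm.1 hy)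
  have hcl : Metric.closedBall x ρ ⊆ Metric.ball x r := Metric.closedBall_subset_ball hρr
  obtain ⟨C, hC⟩ := (isCompact_closedBall x ρ).exists_bound_of_continuousOn
    (hd.continuousOn.mono hcl)
  have hcont : ∀ z ∈ Metric.ball x r, ContinuousOn
      (fun t : ℝ => ((t : ℂ) ^ k) • h (x + (t : ℂ) • (z - x))) (Set.uIcc 0 1) := by
    intro z hz
    rw [Set.uIcc_of_le zero_le_one]
    exact ContinuousOn.smul (by fun_prop) (hh.continuousOn.comp (by fun_prop)
      fun t ht => segment_mem_ball ht hz)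
  have hcont' : ContinuousOn
      (fun t : ℝ => ((t : ℂ) ^ (k + 1)) • fderiv ℂ h (x + (t : ℂ) • (y - x))) (Set.uIcc 0 1) := by
    rw [Set.uIcc_of_le zero_le_one]
    exact ContinuousOn.smul
      (Continuous.continuousOn (f := fun t : ℝ => (t : ℂ) ^ (k + 1)) (by fun_prop)) (hd.continuousOn.comp
      (Continuous.continuousOn (f := fun t : ℝ => x + (t : ℂ) • (y - x)) (by fun_prop))
      fun t ht => segment_mem_ball ht hy)
  have hs : Metric.ball x ρ ∈ nhds y := Metric.isOpen_ball.mem_nhds (mem_ball_iff_norm.2 hρ)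
  refine hasFDerivAt_integral_of_dominated_of_fderiv_le (bound := fun _ => C)
    (F' := fun z t => ((t : ℂ) ^ (k + 1)) • fderiv ℂ h (x + (t : ℂ) • (z - x))) hs ?_ ?_ ?_ ?_ ?_ ?_
  · filter_upwards [hs] with z hz
    exact (hcont z (hcl (Metric.ball_subset_closedBall hz))).intervalIntegrable.aestronglyMeasurable_restrict_uIoc
  · exact (hcont y hy).intervalIntegrable
  · exact hcont'.intervalIntegrable.aestronglyMeasurable_restrict_uIoc
  · refine Filter.Eventually.of_forall fun t ht z hz => ?_
    rw [Set.uIoc_of_le zero_le_one] at ht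
    have ht' : t ∈ Set.Icc (0 : ℝ) 1 := ⟨ht.1.le, ht.2⟩
    have h1 := hC _ (Metric.ball_subset_closedBall (segment_mem_ball ht' hz))
    rw [norm_smul, norm_pow, Complex.norm_real, Real.norm_of_nonneg ht'.1]
    have h2 : t ^ (k + 1) ≤ 1 := pow_le_one₀ ht'.1 ht'.2
    nlinarith [norm_nonneg (fderiv ℂ h (x + (t : ℂ) • (z - x)))]
  · exact intervalIntegrable_const
  · refine Filter.Eventually.of_forall fun t ht z hz => ?_
    rw [Set.uIoc_of_le zero_le_one] at ht
    have ht' : t ∈ Set.Icc (0 : ℝ) 1 := ⟨ht.1.le, ht.2⟩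
    have hm := segment_mem_ball ht' (hcl (Metric.ball_subset_closedBall hz))
    have h1 := ((hh.contDiffAt (Metric.isOpen_ball.mem_nhds hm)).differentiableAt
      (by simp)).hasFDerivAt
    have h2 : HasFDerivAt (fun z : E => x + (t : ℂ) • (z - x))
        ((t : ℂ) • ContinuousLinearMap.id ℂ E) z :=
      (((hasFDerivAt_id z).sub_const x).const_smul (t : ℂ)).const_add x
    have h3 := (h1.comp z h2).const_smul ((t : ℂ) ^ k)
    refine h3.congr_fderiv ?_
    ext u
    simp [pow_succ, mul_smul]

universe u v

/-- All `k` and all targets are treated at once, because the derivative of the integral for `h` and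
`k` is the integral for `fderiv ℂ h` and `k + 1`. -/
theorem contDiffOn_segment_integral_aux {E : Type u} [NormedAddCommGroup E] [NormedSpace ℂ E]
    [FiniteDimensional ℂ E] {x : E} {r : ℝ} (n : ℕ) :
    ∀ {F : Type (max u v)} [NormedAddCommGroup F] [NormedSpace ℂ F] {h : E → F},
    ContDiffOn ℂ ∞ h (Metric.ball x r) → ∀ k : ℕ, ContDiffOn ℂ n
      (fun y => ∫ t in (0 : ℝ)..1, ((t : ℂ) ^ k) • h (x + (t : ℂ) • (y - x)))
      (Metric.ball x r) := by
  induction n with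
  | zero =>
    exact fun hh k => contDiffOn_zero.2 fun y hy =>
      (hasFDerivAt_segment_integral hh k hy).continuousAt.continuousWithinAt
  | succ n ih =>
    intro F _ _ h hh k
    push_cast
    refine (contDiffOn_succ_iff_fderiv_of_isOpen Metric.isOpen_ball).2
      ⟨fun y hy => (hasFDerivAt_segment_integral hh k hy).differentiableAt.differentiableWithinAt,
      by simp, ?_⟩
    exact (ih ((contDiffOn_infty_iff_fderiv_of_isOpen Metric.isOpen_ball).1 hh).2 (k + 1)).congr
      fun y hy => (hasFDerivAt_segment_integral hh k hy).fderiv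

/-- Hadamard's lemma for holomorphic functions on a ball. -/
theorem hadamard {E : Type*} [NormedAddCommGroup E] [NormedSpace ℂ E]
    [FiniteDimensional ℂ E] {x : E} {r : ℝ} {f : E → ℂ}
    (hf : ContDiffOn ℂ ∞ f (Metric.ball x r)) :
    ∃ G : E → E →L[ℂ] ℂ, ContDiffOn ℂ ∞ G (Metric.ball x r) ∧ G x = fderiv ℂ f x ∧
      ∀ y ∈ Metric.ball x r, f y = f x + G y (y - x) := by
  have hd := ((contDiffOn_infty_iff_fderiv_of_isOpen Metric.isOpen_ball).1 hf).2
  -- The coefficient is the mean of the derivative along the segment from $x$ to $y$; the factor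
  -- $t^0$ puts it in the family above.
  refine ⟨fun y => ∫ t in (0 : ℝ)..1, ((t : ℂ) ^ 0) • fderiv ℂ f (x + (t : ℂ) • (y - x)),
    contDiffOn_infty.2 fun n => contDiffOn_segment_integral_aux.{_, 0} n hd 0, by simp, ?_⟩
  intro y hy
  have hcont : ContinuousOn
      (fun t : ℝ => ((t : ℂ) ^ 0) • fderiv ℂ f (x + (t : ℂ) • (y - x))) (Set.uIcc 0 1) := by
    rw [Set.uIcc_of_le zero_le_one]
    exact ContinuousOn.smul
      (Continuous.continuousOn (f := fun t : ℝ => (t : ℂ) ^ 0) (by fun_prop)) (hd.continuousOn.comp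
      (Continuous.continuousOn (f := fun t : ℝ => x + (t : ℂ) • (y - x)) (by fun_prop))
      fun t ht => segment_mem_ball ht hy)
  have h1 := integral_eq_sub_of_hasDerivAt (a := 0) (b := 1)
    (f := fun t : ℝ => f (x + (t : ℂ) • (y - x)))
    (f' := fun t : ℝ => fderiv ℂ f (x + (t : ℂ) • (y - x)) (y - x)) (fun t ht => by
      rw [Set.uIcc_of_le zero_le_one] at ht
      have e1 := ((hf.contDiffAt (Metric.isOpen_ball.mem_nhds
        (segment_mem_ball ht hy))).differentiableAt (by simp)).hasFDerivAt
      have e2 : HasDerivAt (fun t : ℝ => x + (t : ℂ) • (y - x)) (y - x) t := by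
        have := ((Complex.ofRealCLM.hasDerivAt (x := t)).smul_const (y - x)).const_add x
        simpa using this
      exact (e1.restrictScalars ℝ).comp_hasDerivAt t e2)
    (by
      have := (hcont.clm_apply (continuousOn_const (c := y - x))).intervalIntegrable
        (μ := volume)
      simpa using this)
  have h2 := ContinuousLinearMap.intervalIntegral_apply
    (hcont.intervalIntegrable (μ := volume)) (y - x)
  simp only [pow_zero, one_smul] at h2 ⊢
  rw [h2, h1]
  simp

end Hadamard

/-! ### Calculus in a fixed chart: the operator $\partial$, tangent vectors, Cauchy-Riemann -/

section Charts

variable {E : Type*} [NormedAddCommGroup E] [NormedSpace ℂ E]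
  {X : Type*} [TopologicalSpace X] [ChartedSpace E X]

/-- A tangent vector at `y` as a vector of the model space, in the chart at `y`. -/
def tanE {y : X} (v : TangentSpace 𝓘(ℝ, E) y) : E := v

/-- A vector of the model space as a tangent vector at `y`, in the chart at `y`. -/
def ofE (y : X) (u : E) : TangentSpace 𝓘(ℝ, E) y := u

theorem tanE_ofE (y : X) (u : E) : tanE (ofE y u) = u := rfl

theorem contMDiffAt_chart_iff {𝕜 : Type*} [NontriviallyNormedField 𝕜] [NormedSpace 𝕜 E]
    [IsManifold 𝓘(𝕜, E) ∞ X] {F : Type*} [NormedAddCommGroup F] [NormedSpace 𝕜 F] {f : X → F}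
    {x₀ y : X} (hy : y ∈ (chartAt E x₀).source) :
    ContMDiffAt 𝓘(𝕜, E) 𝓘(𝕜, F) ∞ f y ↔
      ContDiffAt 𝕜 ∞ (f ∘ (chartAt E x₀).symm) (chartAt E x₀ y) := by
  rw [contMDiffAt_iff_source_of_mem_source hy]
  simp [contMDiffWithinAt_iff_contDiffWithinAt, ContDiffAt]

theorem contMDiffAt_chartAt {𝕜 : Type*} [NontriviallyNormedField 𝕜] [NormedSpace 𝕜 E]
    [IsManifold 𝓘(𝕜, E) ∞ X] {x₀ y : X} (hy : y ∈ (chartAt E x₀).source) :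
    ContMDiffAt 𝓘(𝕜, E) 𝓘(𝕜, E) ∞ (chartAt E x₀) y :=
  contMDiffOn_chart.contMDiffAt ((chartAt E x₀).open_source.mem_nhds hy)

/-- The derivative at `y` of the transition map from the chart at `x₀` to the chart at `x₁`. -/
noncomputable def chartDeriv (x₀ x₁ y : X) : E →L[ℂ] E :=
  fderiv ℂ (chartAt E x₁ ∘ (chartAt E x₀).symm) (chartAt E x₀ y)

/-- The `(1,0)`-part of the differential of `f` at `y`, in the chart at `x₀`. -/
noncomputable def del (x₀ : X) (f : X → ℂ) (y : X) : E →L[ℂ] ℂ :=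
  part10 (fderiv ℝ (f ∘ (chartAt E x₀).symm) (chartAt E x₀ y))

/-- Differentiability of the function `f` at `y`, in the chart at `y`. -/
def DiffAt (E : Type*) [NormedAddCommGroup E] [NormedSpace ℂ E] [ChartedSpace E X] (f : X → ℂ)
    (x₀ y : X) : Prop :=
  DifferentiableAt ℝ (f ∘ (chartAt E x₀).symm) (chartAt E x₀ y)

theorem chart_symm_eventually {P : X → Prop} {x₀ y : X} (hy : y ∈ (chartAt E x₀).source) :
    (∀ᶠ p in nhds (chartAt E x₀ y), P ((chartAt E x₀).symm p)) ↔ ∀ᶠ z in nhds y, P z := by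
  rw [← (chartAt E x₀).map_nhds_eq hy, Filter.eventually_map]
  refine Filter.eventually_congr ?_
  filter_upwards [(chartAt E x₀).open_source.mem_nhds hy] with z hz
  rw [(chartAt E x₀).left_inv hz]

theorem comp_chart_congr {α : Type*} {f g : X → α} {x₀ y : X} (hy : y ∈ (chartAt E x₀).source)
    (h : f =ᶠ[nhds y] g) :
    f ∘ (chartAt E x₀).symm =ᶠ[nhds (chartAt E x₀ y)] g ∘ (chartAt E x₀).symm :=
  (chart_symm_eventually (P := fun z => f z = g z) hy).2 h

theorem del_congr {f g : X → ℂ} {x₀ y : X} (hy : y ∈ (chartAt E x₀).source)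
    (h : f =ᶠ[nhds y] g) : (del x₀ f y : E →L[ℂ] ℂ) = del x₀ g y := by
  unfold del
  rw [(comp_chart_congr hy h).fderiv_eq]

theorem del_add {f g : X → ℂ} {x₀ y : X} (hf : DiffAt E f x₀ y) (hg : DiffAt E g x₀ y) :
    (del x₀ (fun z => f z + g z) y : E →L[ℂ] ℂ) = del x₀ f y + del x₀ g y := by
  unfold del
  rw [← part10L_apply, ← part10L_apply, ← part10L_apply, ← map_add]
  congr 1
  exact fderiv_add hf hg

theorem del_mul {f g : X → ℂ} {x₀ y : X} (hy : y ∈ (chartAt E x₀).source) (hf : DiffAt E f x₀ y)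
    (hg : DiffAt E g x₀ y) :
    (del x₀ (fun z => f z * g z) y : E →L[ℂ] ℂ) = f y • del x₀ g y + g y • del x₀ f y := by
  unfold del
  have h : fderiv ℝ ((fun z => f z * g z) ∘ (chartAt E x₀).symm) (chartAt E x₀ y) =
      f ((chartAt E x₀).symm (chartAt E x₀ y)) • fderiv ℝ (g ∘ (chartAt E x₀).symm)
        (chartAt E x₀ y) + g ((chartAt E x₀).symm (chartAt E x₀ y)) •
        fderiv ℝ (f ∘ (chartAt E x₀).symm) (chartAt E x₀ y) := fderiv_mul hf hg
  rw [h]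
  ext u
  simp only [part10_apply, add_apply, smul_apply, smul_eq_mul,
    (chartAt E x₀).left_inv hy]
  ring

theorem del_const {c : ℂ} {x₀ y : X} : (del x₀ (fun _ => c) y : E →L[ℂ] ℂ) = 0 := by
  unfold del
  have : fderiv ℝ ((fun _ : X => c) ∘ (chartAt E x₀).symm) (chartAt E x₀ y) = 0 :=
    fderiv_const_apply c
  rw [this, ← part10L_apply, map_zero]

theorem del_const_mul {f : X → ℂ} {x₀ y : X} (hy : y ∈ (chartAt E x₀).source)
    (hf : DiffAt E f x₀ y) (c : ℂ) :
    (del x₀ (fun z => c * f z) y : E →L[ℂ] ℂ) = c • del x₀ f y := by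
  rw [del_mul hy (f := fun _ => c) (differentiableAt_const c) hf, del_const]
  ext u
  simp

variable [IsManifold 𝓘(ℂ, E) ∞ X]

theorem diffAt_of_contMDiffAt {f : X → ℂ} {x₀ y : X} (hy : y ∈ (chartAt E x₀).source)
    (hf : ContMDiffAt 𝓘(ℝ, E) 𝓘(ℝ, ℂ) ∞ f y) : DiffAt E f x₀ y :=
  ((contMDiffAt_chart_iff hy).1 hf).differentiableAt (by simp)

theorem differentiableAt_chart_change {x₀ x₁ y : X} (h₀ : y ∈ (chartAt E x₀).source)
    (h₁ : y ∈ (chartAt E x₁).source) :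
    DifferentiableAt ℂ (chartAt E x₁ ∘ (chartAt E x₀).symm) (chartAt E x₀ y) :=
  ((contMDiffAt_chart_iff h₀).1 (contMDiffAt_chartAt h₁)).differentiableAt (by simp)

theorem comp_chart_change {α : Type*} (f : X → α) {x₀ x₁ y : X} (h₀ : y ∈ (chartAt E x₀).source)
    (h₁ : y ∈ (chartAt E x₁).source) :
    f ∘ (chartAt E x₀).symm =ᶠ[nhds (chartAt E x₀ y)]
      (f ∘ (chartAt E x₁).symm) ∘ (chartAt E x₁ ∘ (chartAt E x₀).symm) := by
  refine (chart_symm_eventually (P := fun z => f z = f ((chartAt E x₁).symm (chartAt E x₁ z)))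
    h₀).2 ?_
  filter_upwards [(chartAt E x₁).open_source.mem_nhds h₁] with z hz
  rw [(chartAt E x₁).left_inv hz]

theorem fderiv_chart_change {F : Type*} [NormedAddCommGroup F] [NormedSpace ℝ F] {f : X → F}
    {x₀ x₁ y : X} (h₀ : y ∈ (chartAt E x₀).source) (h₁ : y ∈ (chartAt E x₁).source)
    (hf : DifferentiableAt ℝ (f ∘ (chartAt E x₁).symm) (chartAt E x₁ y)) (u : E) :
    fderiv ℝ (f ∘ (chartAt E x₀).symm) (chartAt E x₀ y) u =
      fderiv ℝ (f ∘ (chartAt E x₁).symm) (chartAt E x₁ y) (chartDeriv x₀ x₁ y u) := by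
  rw [(comp_chart_change f h₀ h₁).fderiv_eq]
  have h2 := (differentiableAt_chart_change h₀ h₁).hasFDerivAt.restrictScalars ℝ
  have h3 : (chartAt E x₁ ∘ (chartAt E x₀).symm) (chartAt E x₀ y) = chartAt E x₁ y := by
    simp [(chartAt E x₀).left_inv h₀]
  rw [← h3] at hf
  have h4 := (hf.hasFDerivAt.comp _ h2).fderiv
  rw [h4, ← h3]
  rfl

/-- Transition maps are holomorphic, so their derivatives commute with $i$ and the splitting into
types does not depend on the chart. -/
theorem del_chart_change {f : X → ℂ}
    {x₀ x₁ y : X} (h₀ : y ∈ (chartAt E x₀).source) (h₁ : y ∈ (chartAt E x₁).source)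
    (hf : DiffAt E f x₁ y) (u : E) : del x₀ f y u = del x₁ f y (chartDeriv x₀ x₁ y u) := by
  unfold del
  rw [part10_apply, part10_apply, fderiv_chart_change h₀ h₁ hf, fderiv_chart_change h₀ h₁ hf,
    map_smul]

theorem chartDeriv_self {x y : X} (hy : y ∈ (chartAt E x).source) (u : E) :
    chartDeriv x x y u = u := by
  unfold chartDeriv
  have : chartAt E x ∘ (chartAt E x).symm =ᶠ[nhds (chartAt E x y)] id := by
    filter_upwards [(chartAt E x).open_target.mem_nhds ((chartAt E x).map_source hy)] with p hp
    exact (chartAt E x).right_inv hp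
  rw [this.fderiv_eq, fderiv_id]
  rfl

theorem chartDeriv_chartDeriv {x₀ x₁ y : X} (h₀ : y ∈ (chartAt E x₀).source)
    (h₁ : y ∈ (chartAt E x₁).source) (u : E) :
    chartDeriv x₁ x₀ y (chartDeriv x₀ x₁ y u) = u := by
  have h := fderiv_chart_change (f := chartAt E x₀) h₀ h₁
    ((differentiableAt_chart_change h₁ h₀).restrictScalars ℝ) u
  rw [fderiv_real_eq (differentiableAt_chart_change h₁ h₀),
    fderiv_real_eq (differentiableAt_chart_change h₀ h₀)] at h
  refine Eq.trans ?_ (chartDeriv_self h₀ u)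
  exact h.symm

theorem realDiff_eq_self {f : X → ℂ} {y : X} (hf : ContMDiffAt 𝓘(ℝ, E) 𝓘(ℝ, ℂ) ∞ f y)
    (v : TangentSpace 𝓘(ℝ, E) y) :
    realDiff f y v = fderiv ℝ (f ∘ (chartAt E y).symm) (chartAt E y y) (tanE v) := by
  unfold realDiff
  rw [(hf.mdifferentiableAt (by simp)).mfderiv]
  simp only [writtenInExtChartAt, extChartAt, mfld_simps, fderivWithin_univ]
  rfl

theorem realDiff_eq {f : X → ℂ} {x₀ y : X} (hy : y ∈ (chartAt E x₀).source)
    (hf : ContMDiffAt 𝓘(ℝ, E) 𝓘(ℝ, ℂ) ∞ f y) (v : TangentSpace 𝓘(ℝ, E) y) :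
    realDiff f y v = fderiv ℝ (f ∘ (chartAt E x₀).symm) (chartAt E x₀ y)
      (chartDeriv y x₀ y (tanE v)) := by
  rw [realDiff_eq_self hf, fderiv_chart_change (mem_chart_source E y) hy
    (diffAt_of_contMDiffAt hy hf)]

/-- The vector `v y` is stored in the chart at `y`, which changes with `y`; smoothness becomes
visible only after transport to one fixed chart. -/
theorem contMDiffAt_tangent_iff {v : ∀ x : X, TangentSpace 𝓘(ℝ, E) x} {x₀ x : X}
    (hx : x ∈ (chartAt E x₀).source) :
    ContMDiffAt 𝓘(ℝ, E) 𝓘(ℝ, E).tangent ∞ (fun x => (⟨x, v x⟩ : TangentBundle 𝓘(ℝ, E) X)) x ↔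
      ContMDiffAt 𝓘(ℝ, E) 𝓘(ℝ, E) ∞ (fun y => chartDeriv y x₀ y (tanE (v y))) x := by
  have h := (trivializationAt E (TangentSpace 𝓘(ℝ, E)) x₀).contMDiffAt_section_iff
    (IB := 𝓘(ℝ, E)) (n := ∞) (s := v) (x₀ := x) hx
  refine h.trans (Filter.EventuallyEq.contMDiffAt_iff ?_)
  filter_upwards [(chartAt E x₀).open_source.mem_nhds hx] with y hy
  rw [TangentBundle.trivializationAt_apply]
  have h2 := (differentiableAt_chart_change (mem_chart_source E y) hy).hasFDerivAt.restrictScalars ℝ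
  simp only [OpenPartialHomeomorph.extend, mfld_simps, fderivWithin_univ]
  rw [h2.fderiv]
  rfl

theorem chartDeriv_tangentJ {x₀ y : X} (v : TangentSpace 𝓘(ℝ, E) y) :
    chartDeriv y x₀ y (tanE (tangentJ y v)) =
      Complex.I • chartDeriv y x₀ y (tanE v) :=
  (chartDeriv y x₀ y).map_smul Complex.I _

theorem contMDiffAt_del {f : X → ℂ} {x₀ y : X} (hy : y ∈ (chartAt E x₀).source)
    (hf : ContMDiffAt 𝓘(ℝ, E) 𝓘(ℝ, ℂ) ∞ f y) :
    ContMDiffAt 𝓘(ℝ, E) 𝓘(ℝ, E →L[ℂ] ℂ) ∞ (fun z => (del x₀ f z : E →L[ℂ] ℂ)) y := by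
  have h1 := (contMDiffAt_chart_iff hy).1 hf
  have h2 : ContDiffAt ℝ ∞ (fun p => part10 (fderiv ℝ (f ∘ (chartAt E x₀).symm) p))
      (chartAt E x₀ y) :=
    (part10L E ℂ).contDiff.contDiffAt.comp _ (h1.fderiv_right (m := ∞) (by simp))
  have h3 : ContMDiffAt 𝓘(ℝ, E) 𝓘(ℝ, E) ∞ (chartAt E x₀) y := contMDiffAt_chartAt hy
  exact h2.contMDiffAt.comp y h3

theorem del_complex {f : X → ℂ} {x₀ y : X} (hy : y ∈ (chartAt E x₀).source)
    (hf : ContMDiffAt 𝓘(ℂ, E) 𝓘(ℂ) ∞ f y) :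
    del x₀ f y = fderiv ℂ (f ∘ (chartAt E x₀).symm) (chartAt E x₀ y) :=
  part10_fderiv (((contMDiffAt_chart_iff hy).1 hf).differentiableAt (by simp))

theorem contMDiffAt_complex_of_eventually {f : X → ℂ} {x₀ y : X}
    (hy : y ∈ (chartAt E x₀).source) (h : ∀ᶠ z in nhds y, ContMDiffAt 𝓘(ℝ, E) 𝓘(ℝ, ℂ) ∞ f z ∧
      ∀ v : TangentSpace 𝓘(ℝ, E) z, realDiff f z (tangentJ z v) = Complex.I * realDiff f z v) :
    ContMDiffAt 𝓘(ℂ, E) 𝓘(ℂ) ∞ f y := by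
  rw [contMDiffAt_chart_iff hy]
  have h' := h.and ((chartAt E x₀).open_source.mem_nhds hy)
  rw [← chart_symm_eventually hy] at h'
  obtain ⟨U, hU, hUo, hyU⟩ := eventually_nhds_iff.1
    (h'.and ((chartAt E x₀).open_target.mem_nhds ((chartAt E x₀).map_source hy)))
  have hs : ∀ p ∈ U, ContDiffAt ℝ ∞ (f ∘ (chartAt E x₀).symm) p := fun p hp => by
    have := (contMDiffAt_chart_iff (hU p hp).1.2).1 (hU p hp).1.1.1
    rwa [(chartAt E x₀).right_inv (hU p hp).2] at this
  refine (contDiffOn_complex hUo (fun p hp => (hs p hp).contDiffWithinAt)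
    fun p hp => ?_).contDiffAt (hUo.mem_nhds hyU)
  refine (hasFDerivAt_complex ((hs p hp).differentiableAt (by simp))
    fun u => ?_).differentiableAt.differentiableWithinAt
  obtain ⟨⟨⟨h1, h2⟩, h3⟩, h4⟩ := hU p hp
  set z := (chartAt E x₀).symm p
  -- The tangent vector at $z$ that is represented by $u$ in the chart at $x_0$.
  have h5 := h2 (ofE z (chartDeriv x₀ z z u))
  rw [realDiff_eq h3 h1, realDiff_eq h3 h1, chartDeriv_tangentJ,
    tanE_ofE, (chartAt E x₀).right_inv h4] at h5
  have h6 : chartDeriv z x₀ z (chartDeriv x₀ z z u) = u :=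
    chartDeriv_chartDeriv h3 (mem_chart_source E z) u
  erw [h6] at h5
  exact h5

end Charts

/-! ### Bump functions and global extension of germs -/

section Cutoff

variable {E : Type*} [NormedAddCommGroup E] [NormedSpace ℂ E] [FiniteDimensional ℂ E]
  {X : Type*} [TopologicalSpace X] [T2Space X] [ChartedSpace E X] [IsManifold 𝓘(ℂ, E) ∞ X]

/-- The alternative is shaped for gluing: at every point, either the local object is controlled
there or its product with `φ` vanishes nearby. -/
theorem exists_cutoff {x : X} {W : Set X} (hW : W ∈ nhds x) :
    ∃ φ : X → ℝ, ContMDiff 𝓘(ℝ, E) 𝓘(ℝ) ∞ φ ∧ φ =ᶠ[nhds x] 1 ∧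
      ∀ y, y ∈ W ∨ φ =ᶠ[nhds y] 0 := by
  have : FiniteDimensional ℝ E := FiniteDimensional.complexToReal E
  obtain ⟨φ, -, hφ⟩ := (SmoothBumpFunction.nhds_basis_tsupport (I := 𝓘(ℝ, E)) x).mem_iff.1 hW
  refine ⟨φ, φ.contMDiff, φ.eventuallyEq_one, fun y => ?_⟩
  by_cases hy : y ∈ tsupport φ
  · exact Or.inl (hφ hy)
  · exact Or.inr (notMem_tsupport_iff_eventuallyEq.1 hy)

theorem exists_smoothFun {x : X} {f : X → ℂ}
    (hf : ∀ᶠ y in nhds x, ContMDiffAt 𝓘(ℝ, E) 𝓘(ℝ, ℂ) ∞ f y) :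
    ∃ g : SmoothFun E X, g.1 =ᶠ[nhds x] f := by
  obtain ⟨φ, h1, h2, h3⟩ := exists_cutoff (E := E) hf
  have h1' : ∀ y, ContMDiffAt 𝓘(ℝ, E) 𝓘(ℝ, ℂ) ∞ (fun z => (φ z : ℂ)) y := fun y =>
    Complex.ofRealCLM.contDiff.contMDiff.contMDiffAt.comp y (h1 y)
  refine ⟨⟨fun y => φ y * f y, fun y => ?_⟩, ?_⟩
  · rcases h3 y with h | h
    · exact contMDiffAt_mul_real (h1' y) h
    · refine (contMDiffAt_const (c := (0 : ℂ))).congr_of_eventuallyEq ?_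
      filter_upwards [h] with z hz
      simp [hz]
  · filter_upwards [h2] with z hz
    simp [hz]

end Cutoff

/-! ### Sections in local trivializations -/

section LocalSections

variable {E : Type*} [NormedAddCommGroup E] [NormedSpace ℂ E]
  {X : Type*} [TopologicalSpace X] [ChartedSpace E X]
  {L : X → Type*} [∀ x, AddCommGroup (L x)] [∀ x, Module ℂ (L x)] [∀ x, TopologicalSpace (L x)]
  [TopologicalSpace (TotalSpace ℂ L)] [FiberBundle ℂ L] [VectorBundle ℂ ℂ L]

theorem coord_add {s t : ∀ x, L x} {x₀ y : X} (hy : y ∈ (trivializationAt ℂ L x₀).baseSet) :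
    coord (fun z => s z + t z) x₀ y = coord s x₀ y + coord t x₀ y :=
  ((trivializationAt ℂ L x₀).linear ℂ hy).map_add _ _

theorem coord_smul {f : X → ℂ} {s : ∀ x, L x} {x₀ y : X}
    (hy : y ∈ (trivializationAt ℂ L x₀).baseSet) :
    coord (fun z => f z • s z) x₀ y = f y * coord s x₀ y :=
  ((trivializationAt ℂ L x₀).linear ℂ hy).map_smul _ _

theorem coord_zero {x₀ y : X} (hy : y ∈ (trivializationAt ℂ L x₀).baseSet) :
    coord (fun z => (0 : L z)) x₀ y = 0 :=
  ((trivializationAt ℂ L x₀).linear ℂ hy).map_zero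

theorem coord_congr {s t : ∀ x, L x} {x₀ y : X} (h : s y = t y) : coord s x₀ y = coord t x₀ y := by
  unfold coord
  rw [h]

theorem eq_of_coord_eq {s t : ∀ x, L x} {x₀ y : X} (hy : y ∈ (trivializationAt ℂ L x₀).baseSet)
    (h : coord s x₀ y = coord t x₀ y) : s y = t y := by
  have e : ∀ v : L y, (trivializationAt ℂ L x₀).symm y ((trivializationAt ℂ L x₀ ⟨y, v⟩).2) = v :=
    fun v => Trivialization.symm_apply_apply_mk _ hy v
  rw [← e (s y), ← e (t y)]
  exact congrArg _ h

theorem baseSet_mem_nhds {x₀ y : X} (hy : y ∈ (trivializationAt ℂ L x₀).baseSet) :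
    ∀ᶠ z in nhds y, z ∈ (trivializationAt ℂ L x₀).baseSet :=
  (trivializationAt ℂ L x₀).open_baseSet.mem_nhds hy

variable (E) in
/-- Smoothness of a section at a point. -/
def SmoothAt (s : ∀ x, L x) (y : X) : Prop := ContMDiffAt 𝓘(ℝ, E) 𝓘(ℝ, ℂ) ∞ (coord s y) y

variable (E) in
/-- Holomorphy of a section at a point. -/
def HolAt (s : ∀ x, L x) (y : X) : Prop := ContMDiffAt 𝓘(ℂ, E) 𝓘(ℂ) ∞ (coord s y) y

theorem HolAt.smoothAt {s : ∀ x, L x} {y : X} (h : HolAt E s y) : SmoothAt E s y :=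
  contMDiffAt_real h

theorem mem_smoothSec {s : ∀ x, L x} : s ∈ SmoothSec E L ↔ ∀ y, SmoothAt E s y :=
  forall_congr' fun y => contMDiffAt_section y

theorem smoothAt_sec (s : SmoothSec E L) (y : X) : SmoothAt E s.1 y := coord_real s y

theorem coord_eventually_congr {s t : ∀ x, L x} {x₀ y : X} (h : ∀ᶠ z in nhds y, s z = t z) :
    coord s x₀ =ᶠ[nhds y] coord t x₀ := by
  filter_upwards [h] with z hz
  exact coord_congr hz

theorem SmoothAt.congr {s t : ∀ x, L x} {y : X} (hs : SmoothAt E s y)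
    (h : ∀ᶠ z in nhds y, t z = s z) : SmoothAt E t y :=
  ContMDiffAt.congr_of_eventuallyEq hs (coord_eventually_congr h)

theorem HolAt.congr {s t : ∀ x, L x} {y : X} (hs : HolAt E s y)
    (h : ∀ᶠ z in nhds y, t z = s z) : HolAt E t y :=
  ContMDiffAt.congr_of_eventuallyEq hs (coord_eventually_congr h)

theorem coord_trans_eventually (s : ∀ x, L x) {x₀ x₁ y : X}
    (h₀ : y ∈ (trivializationAt ℂ L x₀).baseSet) (h₁ : y ∈ (trivializationAt ℂ L x₁).baseSet) :
    coord s x₁ =ᶠ[nhds y] fun z => trans L x₀ x₁ z * coord s x₀ z := by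
  filter_upwards [baseSet_mem_nhds h₀, baseSet_mem_nhds h₁] with z hz₀ hz₁
  exact coord_trans s hz₀ hz₁

variable (L) in
/-- The frame of `L` in the preferred local trivialization at `x₀`. -/
noncomputable def frame (x₀ y : X) : L y := (trivializationAt ℂ L x₀).symm y 1

theorem coord_frame {x₀ y : X} (hy : y ∈ (trivializationAt ℂ L x₀).baseSet) :
    coord (frame L x₀) x₀ y = 1 := by
  unfold coord frame
  rw [Trivialization.apply_mk_symm _ hy]

theorem coord_smul_frame {f : X → ℂ} {x₀ y : X} (hy : y ∈ (trivializationAt ℂ L x₀).baseSet) :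
    coord (fun z => f z • frame L x₀ z) x₀ y = f y := by
  rw [coord_smul hy, coord_frame hy, mul_one]

theorem eq_coord_smul_frame (s : ∀ x, L x) {x₀ y : X}
    (hy : y ∈ (trivializationAt ℂ L x₀).baseSet) :
    s y = coord s x₀ y • frame L x₀ y :=
  eq_of_coord_eq (t := fun z => coord s x₀ z • frame L x₀ z) hy (coord_smul_frame hy).symm

theorem frame_ne_zero {x₀ y : X} (hy : y ∈ (trivializationAt ℂ L x₀).baseSet) :
    frame L x₀ y ≠ 0 := by
  intro h
  have h1 := coord_congr (t := fun z => 0) (x₀ := x₀) h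
  rw [coord_frame hy, coord_zero hy] at h1
  exact one_ne_zero h1

variable [ContMDiffVectorBundle ∞ ℂ L 𝓘(ℂ, E)]

/-- Coordinates in two trivializations differ by a holomorphic transition function, so smoothness
may be tested in any of them; the same holds for holomorphy below. -/
theorem smoothAt_iff {s : ∀ x, L x} {x₀ y : X} (hy : y ∈ (trivializationAt ℂ L x₀).baseSet) :
    SmoothAt E s y ↔ ContMDiffAt 𝓘(ℝ, E) 𝓘(ℝ, ℂ) ∞ (coord s x₀) y := by
  have h := mem_baseSet_trivializationAt ℂ L y
  constructor
  · intro hs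
    exact (contMDiffAt_mul_real (contMDiffAt_real (trans_hol h hy)) hs).congr_of_eventuallyEq
      (coord_trans_eventually s h hy)
  · intro hs
    exact (contMDiffAt_mul_real (contMDiffAt_real (trans_hol hy h)) hs).congr_of_eventuallyEq
      (coord_trans_eventually s hy h)

theorem holAt_iff {s : ∀ x, L x} {x₀ y : X} (hy : y ∈ (trivializationAt ℂ L x₀).baseSet) :
    HolAt E s y ↔ ContMDiffAt 𝓘(ℂ, E) 𝓘(ℂ) ∞ (coord s x₀) y := by
  have h := mem_baseSet_trivializationAt ℂ L y
  constructor
  · intro hs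
    exact ((trans_hol h hy).mul hs).congr_of_eventuallyEq (coord_trans_eventually s h hy)
  · intro hs
    exact ((trans_hol hy h).mul hs).congr_of_eventuallyEq (coord_trans_eventually s hy h)

theorem HolAt.smul {f : X → ℂ} {s : ∀ x, L x} {y : X} (hf : ContMDiffAt 𝓘(ℂ, E) 𝓘(ℂ) ∞ f y)
    (hs : HolAt E s y) : HolAt E (fun z => f z • s z) y := by
  refine ContMDiffAt.congr_of_eventuallyEq (ContMDiffAt.mul hf hs) ?_
  filter_upwards [baseSet_mem_nhds (mem_baseSet_trivializationAt ℂ L y)] with z hz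
  exact coord_smul hz

theorem SmoothAt.add {s t : ∀ x, L x} {y : X} (hs : SmoothAt E s y) (ht : SmoothAt E t y) :
    SmoothAt E (fun z => s z + t z) y := by
  refine ContMDiffAt.congr_of_eventuallyEq (ContMDiffAt.add hs ht) ?_
  filter_upwards [baseSet_mem_nhds (mem_baseSet_trivializationAt ℂ L y)] with z hz
  exact coord_add hz

theorem SmoothAt.smul {f : X → ℂ} {s : ∀ x, L x} {y : X}
    (hf : ContMDiffAt 𝓘(ℝ, E) 𝓘(ℝ, ℂ) ∞ f y)
    (hs : SmoothAt E s y) : SmoothAt E (fun z => f z • s z) y := by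
  refine ContMDiffAt.congr_of_eventuallyEq (contMDiffAt_mul_real hf hs) ?_
  filter_upwards [baseSet_mem_nhds (mem_baseSet_trivializationAt ℂ L y)] with z hz
  exact coord_smul hz

theorem smoothAt_zero {y : X} : SmoothAt E (fun z => (0 : L z)) y := by
  refine ContMDiffAt.congr_of_eventuallyEq (contMDiffAt_const (c := (0 : ℂ))) ?_
  filter_upwards [baseSet_mem_nhds (mem_baseSet_trivializationAt ℂ L y)] with z hz
  exact coord_zero hz

theorem holAt_frame {x₀ y : X} (hy : y ∈ (trivializationAt ℂ L x₀).baseSet) :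
    HolAt E (frame L x₀) y := by
  rw [holAt_iff hy]
  refine ContMDiffAt.congr_of_eventuallyEq (contMDiffAt_const (c := (1 : ℂ))) ?_
  filter_upwards [baseSet_mem_nhds hy] with z hz
  exact coord_frame hz

end LocalSections

/-! ### Extension by zero and comparison of germs -/

section Extension

variable {E : Type*} [NormedAddCommGroup E] [NormedSpace ℂ E]
  {X : Type*} [TopologicalSpace X] [ChartedSpace E X]
  {L : X → Type*} [∀ x, AddCommGroup (L x)] [∀ x, Module ℂ (L x)] [∀ x, TopologicalSpace (L x)]
  [TopologicalSpace (TotalSpace ℂ L)] [FiberBundle ℂ L] [VectorBundle ℂ ℂ L]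

open Classical in
/-- Extension by zero of a section over `U`. -/
noncomputable def extS {U : Opens X} (s : ∀ x : U, L x) (x : X) : L x :=
  if h : x ∈ U then s ⟨x, h⟩ else 0

open Classical in
/-- Extension by zero of a function on `U`. -/
noncomputable def extF {U : Opens X} (f : U → ℂ) (x : X) : ℂ :=
  if h : x ∈ U then f ⟨x, h⟩ else 0

theorem extS_apply {U : Opens X} (s : ∀ x : U, L x) {x : X} (h : x ∈ U) :
    extS s x = s ⟨x, h⟩ := dif_pos h

theorem extF_apply {U : Opens X} (f : U → ℂ) {x : X} (h : x ∈ U) : extF f x = f ⟨x, h⟩ := dif_pos h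

theorem extF_contMDiffAt {U : Opens X} (f : HolFun E U) {x : X} (hx : x ∈ U) :
    ContMDiffAt 𝓘(ℂ, E) 𝓘(ℂ) ∞ (extF f.1) x := by
  have h : ContMDiffAt 𝓘(ℂ, E) 𝓘(ℂ) ∞ f.1 (⟨x, hx⟩ : U) := f.2 _
  refine (contMDiffAt_subtype_iff (U := U) (x := ⟨x, hx⟩)).1 ?_
  convert h using 2 with y
  exact extF_apply _ y.2

/-- A function which is holomorphic at the points of `U`, as an element of `𝒪_X(U)`. -/
def mkFun (U : Opens X) (f : X → ℂ) (hf : ∀ x ∈ U, ContMDiffAt 𝓘(ℂ, E) 𝓘(ℂ) ∞ f x) :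
    HolFun E U :=
  ⟨fun x => f x, fun x => (contMDiffAt_subtype_iff (U := U) (x := x)).2 (hf x x.2)⟩

variable [ContMDiffVectorBundle ∞ ℂ L 𝓘(ℂ, E)] [IsManifold 𝓘(ℂ, E) ∞ X]

theorem holAt_iff_total {s : ∀ x, L x} {x : X} : HolAt E s x ↔
    ContMDiffAt 𝓘(ℂ, E) (𝓘(ℂ, E).prod 𝓘(ℂ, ℂ)) ∞ (fun x => (⟨x, s x⟩ : TotalSpace ℂ L)) x :=
  (contMDiffAt_section x).symm

theorem extS_holAt {U : Opens X} (s : HolSec E L U) {x : X} (hx : x ∈ U) :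
    HolAt E (extS s.1) x := by
  have h : ContMDiffAt 𝓘(ℂ, E) (𝓘(ℂ, E).prod 𝓘(ℂ, ℂ)) ∞
    (fun x : U => (⟨x, s.1 x⟩ : TotalSpace ℂ L)) (⟨x, hx⟩ : U) := s.2 _
  refine holAt_iff_total.2 ((contMDiffAt_subtype_iff (U := U) (x := ⟨x, hx⟩)).1 ?_)
  convert h using 2 with y
  exact congrArg _ (extS_apply _ y.2)

/-- A section which is holomorphic at the points of `U`, as an element of `Γ_L(U)`. -/
def mkSec (U : Opens X) (s : ∀ x, L x) (hs : ∀ x ∈ U, HolAt E s x) : HolSec E L U :=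
  ⟨fun x => s x, fun x => (contMDiffAt_subtype_iff (U := U) (x := x)).2
    (holAt_iff_total.1 (hs x x.2))⟩

theorem extS_mkSec {U : Opens X} {s : ∀ x, L x} (hs : ∀ x ∈ U, HolAt E s x) {x : X} (hx : x ∈ U) :
    extS (mkSec U s hs).1 x = s x := extS_apply _ hx

theorem nhds_subtype_iff {U : Opens X} {x : U} {P : X → Prop} :
    (∀ᶠ y : U in nhds x, P y) ↔ ∀ᶠ y in nhds x.1, P y := by
  rw [← U.isOpenEmbedding'.map_nhds_eq, Filter.eventually_map]

/-- Extending by zero turns sections over different open sets into functions on all of $X$. Since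
$U$ is open, the germ at a point of $U$ is unaffected. -/
theorem germ_iff {U : Opens X} {x : U} (s' : ∀ x, L x) (s : ∀ x : U, L x) :
    (∀ᶠ y : U in nhds x, s' y = s y) ↔ ∀ᶠ y in nhds x.1, s' y = extS s y := by
  rw [← nhds_subtype_iff (P := fun y => s' y = extS s y)]
  refine Filter.eventually_congr (Filter.Eventually.of_forall fun y => ?_)
  rw [extS_apply s y.2]

theorem germ_iff_fun {U : Opens X} {x : U} (f' : X → ℂ) (f : U → ℂ) :
    (∀ᶠ y : U in nhds x, f' y = f y) ↔ ∀ᶠ y in nhds x.1, f' y = extF f y := by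
  rw [← nhds_subtype_iff (P := fun y => f' y = extF f y)]
  refine Filter.eventually_congr (Filter.Eventually.of_forall fun y => ?_)
  rw [extF_apply f y.2]

variable [FiniteDimensional ℂ E] [T2Space X]

theorem exists_smoothSec {x : X} {s : ∀ x, L x} (hs : ∀ᶠ y in nhds x, SmoothAt E s y) :
    ∃ t : SmoothSec E L, ∀ᶠ y in nhds x, t.1 y = s y := by
  obtain ⟨φ, h1, h2, h3⟩ := exists_cutoff (E := E) hs
  have h1' : ∀ y, ContMDiffAt 𝓘(ℝ, E) 𝓘(ℝ, ℂ) ∞ (fun z => (φ z : ℂ)) y := fun y =>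
    Complex.ofRealCLM.contDiff.contMDiff.contMDiffAt.comp y (h1 y)
  refine ⟨⟨fun y => (φ y : ℂ) • s y, mem_smoothSec.2 fun y => ?_⟩, ?_⟩
  · rcases h3 y with h | h
    · exact SmoothAt.smul (h1' y) h
    · refine smoothAt_zero.congr ?_
      filter_upwards [h] with z hz
      simp [hz]
  · filter_upwards [h2] with z hz
    simp [hz]

theorem exists_smoothSec_extS {U : Opens X} (s : HolSec E L U) {x : X} (hx : x ∈ U) :
    ∃ t : SmoothSec E L, ∀ᶠ y in nhds x, t.1 y = extS s.1 y :=
  exists_smoothSec (by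
    filter_upwards [U.isOpen.mem_nhds hx] with y hy
    exact (extS_holAt s hy).smoothAt)

theorem exists_smoothFun_extF {U : Opens X} (f : HolFun E U) {x : X} (hx : x ∈ U) :
    ∃ g : SmoothFun E X, ∀ᶠ y in nhds x, g.1 y = extF f.1 y :=
  exists_smoothFun (by
    filter_upwards [U.isOpen.mem_nhds hx] with y hy
    exact contMDiffAt_real (extF_contMDiffAt f hy))

end Extension

/-! ### First $(1,0)$-jets of sections -/

section Jets

variable {E : Type*} [NormedAddCommGroup E] [NormedSpace ℂ E]
  {X : Type*} [TopologicalSpace X] [ChartedSpace E X] [IsManifold 𝓘(ℂ, E) ∞ X]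
  {L : X → Type*} [∀ x, AddCommGroup (L x)] [∀ x, Module ℂ (L x)] [∀ x, TopologicalSpace (L x)]
  [TopologicalSpace (TotalSpace ℂ L)] [FiberBundle ℂ L] [VectorBundle ℂ ℂ L]

variable (E L) in
/-- The common domain of the preferred chart and the preferred trivialization at `x₀`. -/
def dom (x₀ : X) : Opens X :=
  ⟨(chartAt E x₀).source ∩ (trivializationAt ℂ L x₀).baseSet,
    (chartAt E x₀).open_source.inter (trivializationAt ℂ L x₀).open_baseSet⟩

theorem mem_dom_self (x₀ : X) : x₀ ∈ dom E L x₀ :=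
  ⟨mem_chart_source E x₀, mem_baseSet_trivializationAt ℂ L x₀⟩

variable (E) in
/-- The first `(1,0)`-jet of `s` at `y` vanishes. -/
def JetZero (x₀ : X) (s : ∀ x, L x) (y : X) : Prop :=
  coord s x₀ y = 0 ∧ (del x₀ (coord s x₀) y : E →L[ℂ] ℂ) = 0

variable [ContMDiffVectorBundle ∞ ℂ L 𝓘(ℂ, E)]

theorem diffAt_coord {s : ∀ x, L x} {x₀ y : X} (hy : y ∈ dom E L x₀) (hs : SmoothAt E s y) :
    DiffAt E (coord s x₀) x₀ y :=
  diffAt_of_contMDiffAt hy.1 ((smoothAt_iff hy.2).1 hs)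

/-- In the product rule, the derivative of the transition function is multiplied by the value of the
section, which is zero. -/
theorem JetZero.change {s : ∀ x, L x} {x₀ x₁ y : X} (h₀ : y ∈ dom E L x₀) (h₁ : y ∈ dom E L x₁)
    (hs : SmoothAt E s y) (h : JetZero E x₀ s y) : JetZero E x₁ s y := by
  have e := coord_trans_eventually s h₀.2 h₁.2
  have ht := contMDiffAt_real (trans_hol (E := E) h₀.2 h₁.2)
  have hs' := (smoothAt_iff h₀.2).1 hs
  refine ⟨by rw [e.eq_of_nhds, h.1, mul_zero], ?_⟩
  rw [del_congr h₁.1 e, del_mul h₁.1 (diffAt_of_contMDiffAt h₁.1 ht)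
    (diffAt_of_contMDiffAt h₁.1 hs')]
  ext u
  rw [add_apply, smul_apply, smul_apply, h.1,
    del_chart_change h₁.1 h₀.1 (diffAt_of_contMDiffAt h₀.1 hs'), h.2]
  simp

theorem JetZero.sub_iff {s t : ∀ x, L x} {x₀ y : X} (hy : y ∈ dom E L x₀) (hs : SmoothAt E s y)
    (ht : SmoothAt E t y) : JetZero E x₀ (fun z => s z + (-1 : ℂ) • t z) y ↔
      coord s x₀ y = coord t x₀ y ∧ (del x₀ (coord s x₀) y : E →L[ℂ] ℂ) = del x₀ (coord t x₀) y := by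
  have e : coord (fun z => s z + (-1 : ℂ) • t z) x₀ =ᶠ[nhds y]
      fun z => coord s x₀ z + (-1) * coord t x₀ z := by
    filter_upwards [baseSet_mem_nhds hy.2] with z hz
    rw [coord_add hz, coord_smul (f := fun _ => (-1 : ℂ)) hz]
  have hs' := diffAt_coord hy hs
  have ht' := diffAt_coord hy ht
  have hm : DiffAt E (fun z => (-1) * coord t x₀ z) x₀ y := DifferentiableAt.const_mul ht' (-1)
  unfold JetZero
  rw [e.eq_of_nhds, del_congr hy.1 e, del_add hs' hm,
    del_const_mul hy.1 ht']
  constructor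
  · rintro ⟨h1, h2⟩
    exact ⟨by linear_combination h1, by rw [← sub_eq_zero, ← h2]; module⟩
  · rintro ⟨h1, h2⟩
    exact ⟨by rw [h1]; ring, by rw [h2]; module⟩

variable (E) in
/-- The first `(1,0)`-jets of `s` and `t` at `y` agree. -/
def JetEq (x₀ : X) (s t : ∀ x, L x) (y : X) : Prop :=
  coord s x₀ y = coord t x₀ y ∧ (del x₀ (coord s x₀) y : E →L[ℂ] ℂ) = del x₀ (coord t x₀) y

theorem JetEq.symm {s t : ∀ x, L x} {x₀ y : X} (h : JetEq E x₀ s t y) : JetEq E x₀ t s y :=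
  ⟨h.1.symm, h.2.symm⟩

theorem JetEq.trans {s t u : ∀ x, L x} {x₀ y : X} (h : JetEq E x₀ s t y) (h' : JetEq E x₀ t u y) :
    JetEq E x₀ s u y :=
  ⟨h.1.trans h'.1, h.2.trans h'.2⟩

/-- Reduced to the difference of the two sections, because vanishing of a jet is the simpler
invariant. -/
theorem JetEq.change {s t : ∀ x, L x} {x₀ x₁ y : X} (h₀ : y ∈ dom E L x₀) (h₁ : y ∈ dom E L x₁)
    (hs : SmoothAt E s y) (ht : SmoothAt E t y) (h : JetEq E x₀ s t y) : JetEq E x₁ s t y :=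
  (JetZero.sub_iff h₁ hs ht).1 (((JetZero.sub_iff h₀ hs ht).2 h).change h₀ h₁
    (hs.add (SmoothAt.smul contMDiffAt_const ht)))

theorem JetEq.of_eventuallyEq {s t : ∀ x, L x} {x₀ y : X} (hy : y ∈ dom E L x₀)
    (h : ∀ᶠ z in nhds y, s z = t z) : JetEq E x₀ s t y :=
  ⟨coord_congr h.self_of_nhds, del_congr hy.1 (coord_eventually_congr h)⟩

end Jets

/-! ### Algebra of Jacobi modules -/

namespace JacobiModule

variable {A M : Type*} [CommRing A] [Algebra ℂ A] [AddCommGroup M]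
    [Module ℂ M] [Module A M] [IsScalarTower ℂ A M] (S : JacobiModule A M)

theorem bracket_add_left (s s' t : M) :
    S.bracket (s + s') t = S.bracket s t + S.bracket s' t := by
  rw [map_add]; rfl

theorem bracket_add_right (s t t' : M) :
    S.bracket s (t + t') = S.bracket s t + S.bracket s t' := map_add _ _ _

theorem bracket_smul_left (c : ℂ) (s t : M) : S.bracket (c • s) t = c • S.bracket s t := by
  rw [map_smul]; rfl

theorem bracket_smul_right (c : ℂ) (s t : M) : S.bracket s (c • t) = c • S.bracket s t :=
  map_smul _ _ _

theorem bracket_skew (s t : M) : S.bracket s t = -S.bracket t s := by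
  have h := S.bracket_self (s + t)
  rw [bracket_add_left, bracket_add_right, bracket_add_right, S.bracket_self, S.bracket_self,
    zero_add, add_zero] at h
  exact eq_neg_of_add_eq_zero_left h

theorem bracket_sum_right {ι : Type*} (s : M) (I : Finset ι) (t : ι → M) :
    S.bracket s (∑ i ∈ I, t i) = ∑ i ∈ I, S.bracket s (t i) := map_sum _ _ _

theorem bracket_sum_smul {ι : Type*} (I : Finset ι) (c d : ι → ℂ) (e : ι → M) :
    S.bracket (∑ i ∈ I, c i • e i) (∑ j ∈ I, d j • e j) =
      ∑ i ∈ I, ∑ j ∈ I, (c i * d j) • S.bracket (e i) (e j) := by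
  simp only [map_sum, LinearMap.sum_apply, map_smul, LinearMap.smul_apply, mul_smul]
  rw [Finset.sum_comm]
  refine Finset.sum_congr rfl fun i _ => ?_
  rw [Finset.smul_sum]
  exact Finset.sum_congr rfl fun j _ => smul_comm _ _ _

theorem jacobi_cyclic (s t u : M) : S.bracket (S.bracket s t) u + -S.bracket (S.bracket s u) t +
    S.bracket (S.bracket t u) s = 0 := by
  have h := S.jacobi s t u
  rw [S.bracket_skew (S.bracket s u) t, S.bracket_skew (S.bracket t u) s, h]
  abel

end JacobiModule

/-! ### The sheaf bracket depends only on first jets -/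

section SheafBracket

variable {E : Type*} [NormedAddCommGroup E] [NormedSpace ℂ E]
  {X : Type*} [TopologicalSpace X] [ChartedSpace E X] [IsManifold 𝓘(ℂ, E) ∞ X]
  {L : X → Type*} [∀ x, AddCommGroup (L x)] [∀ x, Module ℂ (L x)] [∀ x, TopologicalSpace (L x)]
  [TopologicalSpace (TotalSpace ℂ L)] [FiberBundle ℂ L] [VectorBundle ℂ ℂ L]
  [ContMDiffVectorBundle ∞ ℂ L 𝓘(ℂ, E)]

/-- Both brackets restrict to the same bracket over a common open neighbourhood of $x$ on which the
sections agree. -/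
theorem bracket_germ (S : JacobiSheaf E L) {U V : Opens X} {x : X} (hU : x ∈ U) (hV : x ∈ V)
    {s t : HolSec E L U} {s' t' : HolSec E L V}
    (hs : ∀ᶠ y in nhds x, extS s.1 y = extS s'.1 y)
    (ht : ∀ᶠ y in nhds x, extS t.1 y = extS t'.1 y) :
    extS ((S.on U).bracket s t).1 x = extS ((S.on V).bracket s' t').1 x := by
  obtain ⟨W, hW, hWo, hxW⟩ := eventually_nhds_iff.1 ((hs.and ht).and
    ((show ∀ᶠ y in nhds x, y ∈ U from U.isOpen.mem_nhds hU).and (V.isOpen.mem_nhds hV)))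
  let W' : Opens X := ⟨W, hWo⟩
  have hWU : W' ≤ U := fun y hy => (hW y hy).2.1
  have hWV : W' ≤ V := fun y hy => (hW y hy).2.2
  have e1 : resSec hWU s = resSec hWV s' := by
    refine Subtype.ext (funext fun y => ?_)
    have := (hW y y.2).1.1
    rwa [extS_apply _ (hWU y.2), extS_apply _ (hWV y.2)] at this
  have e2 : resSec hWU t = resSec hWV t' := by
    refine Subtype.ext (funext fun y => ?_)
    have := (hW y y.2).1.2
    rwa [extS_apply _ (hWU y.2), extS_apply _ (hWV y.2)] at this
  have h1 := congrArg (fun u => u.1 ⟨x, hxW⟩) (S.bracket_res U W' hWU s t)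
  have h2 := congrArg (fun u => u.1 ⟨x, hxW⟩) (S.bracket_res V W' hWV s' t')
  rw [e1, e2] at h1
  rw [extS_apply _ hU, extS_apply _ hV]
  exact h1.trans h2.symm

theorem extS_resSec {U V : Opens X} (h : V ≤ U) (s : HolSec E L U) {x : X} (hx : x ∈ V) :
    ∀ᶠ y in nhds x, extS s.1 y = extS (resSec h s).1 y := by
  filter_upwards [V.isOpen.mem_nhds hx] with y hy
  rw [extS_apply _ (h hy), extS_apply _ hy]
  rfl

variable [FiniteDimensional ℂ E]

/-- By Hadamard the section is locally $\sum_i a_ig_ie$, where $a_i$ are chart coordinates centred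
at $x$ and $g_i(x)$ are the partial derivatives at $x$. Both factors vanish at $x$, and a bracket
differentiates only one of them. -/
theorem bracket_eq_zero_of_jetZero (S : JacobiSheaf E L) {U : Opens X} (t s : HolSec E L U)
    {x₀ x : X} (hx : x ∈ dom E L x₀) (hU : x ∈ U) (h : JetZero E x₀ (extS s.1) x) :
    extS ((S.on U).bracket t s).1 x = 0 := by
  set φ := chartAt E x₀
  have hev : ∀ᶠ z in nhds x, z ∈ U ⊓ dom E L x₀ :=
    (U ⊓ dom E L x₀).isOpen.mem_nhds ⟨hU, hx⟩
  have hev2 := ((chart_symm_eventually hx.1).2 hev).and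
    (φ.open_target.mem_nhds (φ.map_source hx.1))
  obtain ⟨r, hr, hball⟩ := Metric.eventually_nhds_iff_ball.1 hev2
  have hf : ContDiffOn ℂ ∞ (coord (extS s.1) x₀ ∘ φ.symm) (Metric.ball (φ x) r) := by
    intro p hp
    obtain ⟨⟨h1, h2⟩, h3⟩ := hball p hp
    have := (contMDiffAt_chart_iff h2.1).1 ((holAt_iff h2.2).1 (extS_holAt s h1))
    rw [φ.right_inv h3] at this
    exact this.contDiffWithinAt
  obtain ⟨G, hG, hG0, hGf⟩ := hadamard hf
  -- The part of the manifold that the chart maps into the ball on which Hadamard's lemma holds.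
  let V : Opens X := ⟨φ.source ∩ φ ⁻¹' Metric.ball (φ x) r,
    φ.isOpen_inter_preimage Metric.isOpen_ball⟩
  have hxV : x ∈ V := ⟨hx.1, Metric.mem_ball_self hr⟩
  have hV : ∀ z ∈ V, z ∈ U ⊓ dom E L x₀ := fun z hz => by
    have := (hball _ hz.2).1
    rwa [φ.left_inv hz.1] at this
  have hVU : V ≤ U := fun z hz => (hV z hz).1
  have hφ : ∀ z ∈ V, ContMDiffAt 𝓘(ℂ, E) 𝓘(ℂ, E) ∞ φ z := fun z hz => contMDiffAt_chartAt hz.1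
  let b := Module.finBasis ℂ E
  let a : ∀ i, HolFun E V := fun i => mkFun V (fun z => b.repr (φ z - φ x) i) fun z hz => by
    have h1 : ContDiff ℂ ∞ (fun p : E => LinearMap.toContinuousLinearMap (b.coord i) (p - φ x)) :=
      (LinearMap.toContinuousLinearMap (b.coord i)).contDiff.comp (contDiff_id.sub contDiff_const)
    exact h1.contMDiff.contMDiffAt.comp z (hφ z hz)
  let g : ∀ i, HolFun E V := fun i => mkFun V (fun z => G (φ z) (b i)) fun z hz => by
    have h1 : ContDiffAt ℂ ∞ (fun p : E => G p (b i)) (φ z) :=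
      (hG.contDiffAt (Metric.isOpen_ball.mem_nhds hz.2)).clm_apply contDiffAt_const
    exact h1.contMDiffAt.comp z (hφ z hz)
  let e : HolSec E L V := mkSec V (frame L x₀) fun z hz => holAt_frame (hV z hz).2.2
  have key : resSec hVU s = ∑ i, (a i * g i) • e := by
    refine Subtype.ext (funext fun z => ?_)
    have h1 : (∑ i, (a i * g i) • e).1 z = ∑ i, ((a i).1 z * (g i).1 z) • e.1 z := by
      rw [Submodule.coe_sum, Finset.sum_apply]
      rfl
    rw [h1, ← Finset.sum_smul]
    have h2 := hGf (φ z) z.2.2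
    have h3 : (coord (extS s.1) x₀ ∘ φ.symm) (φ z) = coord (extS s.1) x₀ z := by
      simp [φ.left_inv z.2.1]
    have h4 : (coord (extS s.1) x₀ ∘ φ.symm) (φ x) = 0 := by
      simp [φ.left_inv hx.1, h.1]
    have h5 : G (φ z) (φ z - φ x) = ∑ i, (a i).1 z * (g i).1 z := by
      conv_lhs => rw [← b.sum_repr (φ z - φ x), map_sum]
      exact Finset.sum_congr rfl fun i _ => by rw [map_smul]; rfl
    rw [h3, h4, h5, zero_add] at h2
    rw [← h2]
    change s.1 ⟨z, hVU z.2⟩ = coord (extS s.1) x₀ z • frame L x₀ z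
    rw [← eq_coord_smul_frame _ (hV z z.2).2.2, extS_apply]
  have ha : ∀ i, (a i).1 ⟨x, hxV⟩ = 0 := fun i => by
    change b.repr (φ x - φ x) i = 0
    simp
  have hg : ∀ i, (g i).1 ⟨x, hxV⟩ = 0 := fun i => by
    change G (φ x) (b i) = 0
    rw [hG0, ← del_complex hx.1 ((holAt_iff hx.2).1 (extS_holAt s hU)), h.2]
    rfl
  rw [bracket_germ S hU hxV (extS_resSec hVU t hxV) (extS_resSec hVU s hxV), extS_apply _ hxV, key,
    JacobiModule.bracket_sum_right, Submodule.coe_sum, Finset.sum_apply]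
  refine Finset.sum_eq_zero fun i _ => ?_
  -- Here $\{t,age\}=(aR_t(g)+gR_t(a))e+ag\{t,e\}$, and $a$ and $g$ vanish at $x$.
  rw [(S.on V).leibniz, Derivation.leibniz]
  change ((a i).1 ⟨x, hxV⟩ * _ + (g i).1 ⟨x, hxV⟩ * _) • e.1 ⟨x, hxV⟩ +
    ((a i).1 ⟨x, hxV⟩ * _) • _ = _
  rw [ha, hg]
  simp

theorem extS_add {U : Opens X} (s t : HolSec E L U) (z : X) :
    extS (s + t).1 z = extS s.1 z + extS t.1 z := by
  by_cases h : z ∈ U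
  · rw [extS_apply _ h, extS_apply _ h, extS_apply _ h]; rfl
  · simp [extS, h]

theorem extS_smul {U : Opens X} (c : ℂ) (s : HolSec E L U) (z : X) :
    extS (c • s).1 z = c • extS s.1 z := by
  by_cases h : z ∈ U
  · rw [extS_apply _ h, extS_apply _ h]; rfl
  · simp [extS, h]

theorem extS_neg {U : Opens X} (s : HolSec E L U) (z : X) : extS (-s).1 z = -extS s.1 z := by
  by_cases h : z ∈ U
  · rw [extS_apply _ h, extS_apply _ h]; rfl
  · simp [extS, h]

theorem extS_sum {U : Opens X} {ι : Type*} (I : Finset ι) (s : ι → HolSec E L U) (z : X) :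
    extS (∑ i ∈ I, s i).1 z = ∑ i ∈ I, extS (s i).1 z := by
  by_cases h : z ∈ U
  · rw [extS_apply _ h, Submodule.coe_sum, Finset.sum_apply]
    exact Finset.sum_congr rfl fun i _ => (extS_apply _ h).symm
  · simp [extS, h]

theorem bracket_congr_right (S : JacobiSheaf E L) {U : Opens X} (t : HolSec E L U)
    {s s' : HolSec E L U} {x₀ x : X} (hx : x ∈ dom E L x₀) (hU : x ∈ U)
    (h : JetEq E x₀ (extS s.1) (extS s'.1) x) :
    extS ((S.on U).bracket t s).1 x = extS ((S.on U).bracket t s').1 x := by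
  have h1 := bracket_eq_zero_of_jetZero S t (s + (-1 : ℂ) • s') hx hU (by
    have := (JetZero.sub_iff hx (extS_holAt s hU).smoothAt (extS_holAt s' hU).smoothAt).2 h
    have e : (extS (s + (-1 : ℂ) • s').1 : ∀ x, L x) =
        fun z => extS s.1 z + (-1 : ℂ) • extS s'.1 z :=
      funext fun z => by rw [extS_add, extS_smul]
    rwa [e])
  rw [JacobiModule.bracket_add_right, JacobiModule.bracket_smul_right, extS_add, extS_smul, neg_one_smul, ← sub_eq_add_neg, sub_eq_zero] at h1
  exact h1

theorem bracket_congr_jet (S : JacobiSheaf E L) {U : Opens X}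
    {s s' t t' : HolSec E L U} {x₀ x : X} (hx : x ∈ dom E L x₀) (hU : x ∈ U)
    (hs : JetEq E x₀ (extS s.1) (extS s'.1) x) (ht : JetEq E x₀ (extS t.1) (extS t'.1) x) :
    extS ((S.on U).bracket s t).1 x = extS ((S.on U).bracket s' t').1 x := by
  rw [bracket_congr_right S s hx hU ht, (S.on U).bracket_skew, (S.on U).bracket_skew s' t',
    extS_neg, extS_neg, bracket_congr_right S t' hx hU hs]

theorem bracket_congr_jet' (S : JacobiSheaf E L) {U V : Opens X}
    {s t : HolSec E L U} {s' t' : HolSec E L V} {x₀ x : X} (hx : x ∈ dom E L x₀) (hU : x ∈ U)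
    (hV : x ∈ V)
    (hs : JetEq E x₀ (extS s.1) (extS s'.1) x) (ht : JetEq E x₀ (extS t.1) (extS t'.1) x) :
    extS ((S.on U).bracket s t).1 x = extS ((S.on V).bracket s' t').1 x := by
  have hW : x ∈ U ⊓ V := ⟨hU, hV⟩
  have hWU : U ⊓ V ≤ U := inf_le_left
  have hWV : U ⊓ V ≤ V := inf_le_right
  rw [bracket_germ S hU hW (extS_resSec hWU s hW) (extS_resSec hWU t hW),
    bracket_germ S hV hW (extS_resSec hWV s' hW) (extS_resSec hWV t' hW)]
  refine bracket_congr_jet S hx hW ?_ ?_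
  · exact ((JetEq.of_eventuallyEq hx (extS_resSec hWU s hW)).symm.trans hs).trans
      (JetEq.of_eventuallyEq hx (extS_resSec hWV s' hW))
  · exact ((JetEq.of_eventuallyEq hx (extS_resSec hWU t hW)).symm.trans ht).trans
      (JetEq.of_eventuallyEq hx (extS_resSec hWV t' hW))

end SheafBracket

/-- The alternating map given by a skew-symmetric bilinear map. -/
def altOfSkew {V W : Type*} [AddCommGroup V] [Module ℂ V] [AddCommGroup W] [Module ℂ W]
    (B : V → V → W) (hadd : ∀ a b c, B (a + b) c = B a c + B b c)
    (hsmul : ∀ (r : ℂ) a c, B (r • a) c = r • B a c) (hskew : ∀ a b, B a b = -B b a) :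
    V [⋀^Fin 2]→ₗ[ℂ] W where
  toFun v := B (v 0) (v 1)
  map_update_add' v i x y := by
    fin_cases i
    · simpa using hadd x y (v 1)
    · simp only [Fin.mk_one, Fin.isValue, ne_eq, zero_ne_one, not_false_eq_true,
        Function.update_of_ne, Function.update_self]
      rw [hskew, hadd, hskew (v 0) x, hskew (v 0) y]
      abel
  map_update_smul' v i c x := by
    fin_cases i
    · simpa using hsmul c x (v 1)
    · simp only [Fin.mk_one, Fin.isValue, ne_eq, zero_ne_one, not_false_eq_true,
        Function.update_of_ne, Function.update_self]
      rw [hskew, hsmul, hskew (v 0) x, smul_neg]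
  map_eq_zero_of_eq' v i j h hij := by
    have h2 : v 0 = v 1 := by
      fin_cases i <;> fin_cases j
      exacts [absurd rfl hij, h, h.symm, absurd rfl hij]
    have h3 : (2 : ℂ) • B (v 0) (v 1) = 0 := by
      rw [two_smul]
      nth_rewrite 2 [hskew]
      rw [h2, add_neg_cancel]
    exact (smul_eq_zero.1 h3).resolve_left two_ne_zero

/-! ### Affine approximations and the induced bracket of smooth sections -/

section Affine

variable {E : Type*} [NormedAddCommGroup E] [NormedSpace ℂ E] [FiniteDimensional ℂ E]
  {X : Type*} [TopologicalSpace X] [ChartedSpace E X] [IsManifold 𝓘(ℂ, E) ∞ X]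
  {L : X → Type*} [∀ x, AddCommGroup (L x)] [∀ x, Module ℂ (L x)] [∀ x, TopologicalSpace (L x)]
  [TopologicalSpace (TotalSpace ℂ L)] [FiberBundle ℂ L] [VectorBundle ℂ ℂ L]

variable (E) in
/-- The affine coordinate functions of the chart at `x₀`: the constant function `1` and the
coordinates with respect to a basis. -/
noncomputable def affineFun (x₀ : X) (k : Option (Fin (Module.finrank ℂ E))) (z : X) : ℂ :=
  k.elim 1 fun i => (Module.finBasis ℂ E).repr (chartAt E x₀ z) i

variable (E) in
/-- The coefficients of the affine function with the same `(1,0)`-jet as `s` at `y`. -/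
noncomputable def coeff (x₀ : X) (s : ∀ x, L x) (k : Option (Fin (Module.finrank ℂ E))) (y : X) :
    ℂ :=
  k.elim (coord s x₀ y - del x₀ (coord s x₀) y (chartAt E x₀ y)) fun i =>
    del x₀ (coord s x₀) y (Module.finBasis ℂ E i)

theorem coeff_congr {x₀ y : X} {s t : ∀ x, L x} (h : JetEq E x₀ s t y)
    (k : Option (Fin (Module.finrank ℂ E))) : coeff E x₀ s k y = coeff E x₀ t k y := by
  unfold coeff
  rw [h.1, h.2]

/-- The coefficients refer to absolute chart coordinates rather than to coordinates centred at `y`,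
so that the basis functions do not move with `y`. This is why the constant coefficient subtracts the
differential applied to the chart value of `y`. -/
theorem sum_coeff_affineFun (x₀ : X) (s : ∀ x, L x) (y z : X) :
    ∑ k, coeff E x₀ s k y * affineFun E x₀ k z =
      coord s x₀ y + del x₀ (coord s x₀) y (chartAt E x₀ z - chartAt E x₀ y) := by
  rw [Fintype.sum_option, map_sub]
  have h : del x₀ (coord s x₀) y (chartAt E x₀ z) = ∑ i, (Module.finBasis ℂ E).repr
      (chartAt E x₀ z) i * del x₀ (coord s x₀) y (Module.finBasis ℂ E i) := by
    conv_lhs => rw [← (Module.finBasis ℂ E).sum_repr (chartAt E x₀ z), map_sum]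
    exact Finset.sum_congr rfl fun i _ => map_smul _ _ _
  rw [h]
  simp only [coeff, affineFun, Option.elim, mul_one]
  rw [Finset.sum_congr rfl fun i _ => mul_comm _ _]
  ring

theorem contMDiffAt_affineFun {x₀ z : X} (hz : z ∈ (chartAt E x₀).source)
    (k : Option (Fin (Module.finrank ℂ E))) :
    ContMDiffAt 𝓘(ℂ, E) 𝓘(ℂ) ∞ (affineFun E x₀ k) z := by
  cases k with
  | none => exact contMDiffAt_const
  | some i =>
    have h1 : ContDiff ℂ ∞
        (LinearMap.toContinuousLinearMap ((Module.finBasis ℂ E).coord i) : E → ℂ) :=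
      (LinearMap.toContinuousLinearMap ((Module.finBasis ℂ E).coord i)).contDiff
    exact h1.contMDiff.contMDiffAt.comp z (contMDiffAt_chartAt hz)

variable [ContMDiffVectorBundle ∞ ℂ L 𝓘(ℂ, E)]

theorem coeff_add {x₀ y : X} (hy : y ∈ dom E L x₀) {s t : ∀ x, L x} (hs : SmoothAt E s y)
    (ht : SmoothAt E t y) (k : Option (Fin (Module.finrank ℂ E))) :
    coeff E x₀ (fun z => s z + t z) k y = coeff E x₀ s k y + coeff E x₀ t k y := by
  have e : coord (fun z => s z + t z) x₀ =ᶠ[nhds y] fun z => coord s x₀ z + coord t x₀ z := by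
    filter_upwards [baseSet_mem_nhds hy.2] with z hz
    exact coord_add hz
  have h := del_congr hy.1 e
  rw [del_add (diffAt_coord hy hs) (diffAt_coord hy ht)] at h
  unfold coeff
  rw [h, e.eq_of_nhds]
  cases k <;> simp [Option.elim]
  ring

theorem del_coord_smul {x₀ y : X} (hy : y ∈ dom E L x₀) {f : X → ℂ} {s : ∀ x, L x}
    (hf : ContMDiffAt 𝓘(ℝ, E) 𝓘(ℝ, ℂ) ∞ f y) (hs : SmoothAt E s y) :
    (del x₀ (coord (fun z => f z • s z) x₀) y : E →L[ℂ] ℂ) =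
      f y • del x₀ (coord s x₀) y + coord s x₀ y • del x₀ f y := by
  have e : coord (fun z => f z • s z) x₀ =ᶠ[nhds y] fun z => f z * coord s x₀ z := by
    filter_upwards [baseSet_mem_nhds hy.2] with z hz
    exact coord_smul hz
  rw [del_congr hy.1 e, del_mul hy.1 (diffAt_of_contMDiffAt hy.1 hf) (diffAt_coord hy hs)]

theorem coeff_smul {x₀ y : X} (hy : y ∈ dom E L x₀) {f : X → ℂ} {s : ∀ x, L x}
    (hf : ContMDiffAt 𝓘(ℝ, E) 𝓘(ℝ, ℂ) ∞ f y) (hs : SmoothAt E s y)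
    (k : Option (Fin (Module.finrank ℂ E))) :
    coeff E x₀ (fun z => f z • s z) k y = f y * coeff E x₀ s k y + coord s x₀ y *
      k.elim (-del x₀ f y (chartAt E x₀ y)) fun i => del x₀ f y (Module.finBasis ℂ E i) := by
  unfold coeff
  rw [del_coord_smul hy hf hs, coord_smul hy.2]
  cases k <;> simp [Option.elim]
  ring

theorem contMDiffAt_coeff {x₀ y : X} (hy : y ∈ dom E L x₀) {s : ∀ x, L x} (hs : SmoothAt E s y)
    (k : Option (Fin (Module.finrank ℂ E))) :
    ContMDiffAt 𝓘(ℝ, E) 𝓘(ℝ, ℂ) ∞ (coeff E x₀ s k) y := by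
  have h1 := (smoothAt_iff hy.2).1 hs
  have h2 := contMDiffAt_del hy.1 h1
  have hφ : ContMDiffAt 𝓘(ℝ, E) 𝓘(ℝ, E) ∞ (chartAt E x₀) y := contMDiffAt_chartAt hy.1
  have hev : ∀ {v : X → E}, ContMDiffAt 𝓘(ℝ, E) 𝓘(ℝ, E) ∞ v y →
      ContMDiffAt 𝓘(ℝ, E) 𝓘(ℝ, ℂ) ∞ (fun z => del x₀ (coord s x₀) z (v z)) y := fun {v} hv => by
    have h3 := (ContinuousLinearMap.restrictScalarsL ℂ E ℂ ℝ ℝ).contDiff.contMDiff.contMDiffAt.comp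
      y h2
    exact h3.clm_apply hv
  cases k with
  | none => exact h1.sub (hev hφ)
  | some i => exact hev contMDiffAt_const

variable (L) in
/-- The local holomorphic sections given by the affine coordinate functions. -/
noncomputable def basisSec (x₀ : X) (k : Option (Fin (Module.finrank ℂ E))) :
    HolSec E L (dom E L x₀) :=
  mkSec _ (fun z => affineFun E x₀ k z • frame L x₀ z) fun _ hz =>
    HolAt.smul (contMDiffAt_affineFun hz.1 k) (holAt_frame hz.2)

variable (E) in
/-- The local holomorphic section which is affine in the chart and the trivialization at `x₀` and
has the same `(1,0)`-jet as `s` at `y`. -/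
noncomputable def affineSec (x₀ : X) (s : ∀ x, L x) (y : X) : HolSec E L (dom E L x₀) :=
  ∑ k, coeff E x₀ s k y • basisSec L x₀ k

theorem extS_affineSec {x₀ z : X} (hz : z ∈ dom E L x₀) (s : ∀ x, L x) (y : X) :
    extS (affineSec E x₀ s y).1 z = (coord s x₀ y +
      del x₀ (coord s x₀) y (chartAt E x₀ z - chartAt E x₀ y)) • frame L x₀ z := by
  rw [← sum_coeff_affineFun, Finset.sum_smul]
  unfold affineSec
  rw [extS_sum]
  refine Finset.sum_congr rfl fun k _ => ?_
  rw [extS_smul, basisSec, extS_mkSec _ hz, smul_smul]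

theorem jetEq_of_coord_eq {x₀ y : X} (hy : y ∈ dom E L x₀) {s t : ∀ x, L x} {c : ℂ} {A : E →L[ℂ] ℂ}
    (hc : coord s x₀ y = c) (hA : del x₀ (coord s x₀) y = A)
    (ht : ∀ᶠ z in nhds y, t z = (c + A (chartAt E x₀ z - chartAt E x₀ y)) • frame L x₀ z) :
    JetEq E x₀ t s y := by
  have e : coord t x₀ =ᶠ[nhds y] fun z => c + A (chartAt E x₀ z - chartAt E x₀ y) := by
    filter_upwards [ht, baseSet_mem_nhds hy.2] with z hz hz'
    rw [coord_congr (t := fun z => (c + A (chartAt E x₀ z - chartAt E x₀ y)) • frame L x₀ z) hz,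
      coord_smul_frame hz']
  refine ⟨by rw [e.eq_of_nhds, hc]; simp, ?_⟩
  have h1 : HasFDerivAt (fun p : E => c + A (p - chartAt E x₀ y)) A (chartAt E x₀ y) := by
    have := (A.hasFDerivAt.comp (chartAt E x₀ y)
      ((hasFDerivAt_id (chartAt E x₀ y)).sub_const (chartAt E x₀ y))).const_add c
    simpa using this
  have h2 : (fun z => c + A (chartAt E x₀ z - chartAt E x₀ y)) ∘ (chartAt E x₀).symm
      =ᶠ[nhds (chartAt E x₀ y)] fun p : E => c + A (p - chartAt E x₀ y) := by
    filter_upwards [(chartAt E x₀).open_target.mem_nhds ((chartAt E x₀).map_source hy.1)] with p hp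
    simp [(chartAt E x₀).right_inv hp]
  rw [del_congr hy.1 e, hA]
  unfold del
  rw [h2.fderiv_eq, part10_fderiv h1.differentiableAt, h1.fderiv]

theorem jetEq_affineSec {x₀ y : X} (hy : y ∈ dom E L x₀) (s : ∀ x, L x) :
    JetEq E x₀ (extS (affineSec E x₀ s y).1) s y := by
  refine jetEq_of_coord_eq hy rfl rfl ?_
  filter_upwards [(dom E L x₀).isOpen.mem_nhds hy] with z hz
  exact extS_affineSec hz s y

/-- The value at `y` of the bracket of the affine approximations of `s` and `t` at `y`. -/
noncomputable def jetBracket (S : JacobiSheaf E L) (x₀ : X) (s t : ∀ x, L x) (y : X) : L y :=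
  extS ((S.on (dom E L x₀)).bracket (affineSec E x₀ s y) (affineSec E x₀ t y)).1 y

theorem jetBracket_eq (S : JacobiSheaf E L) {x₀ y : X} (hy : y ∈ dom E L x₀) {s t : ∀ x, L x}
    {U : Opens X} (hU : y ∈ U) {s' t' : HolSec E L U} (hs : JetEq E x₀ (extS s'.1) s y)
    (ht : JetEq E x₀ (extS t'.1) t y) :
    jetBracket S x₀ s t y = extS ((S.on U).bracket s' t').1 y :=
  bracket_congr_jet' S hy hy hU ((jetEq_affineSec hy s).trans hs.symm)
    ((jetEq_affineSec hy t).trans ht.symm)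

/-- Equality of $(1,0)$-jets is intrinsic, so the affine approximation made in one chart is an
admissible representative in the other. -/
theorem jetBracket_change (S : JacobiSheaf E L) {x₀ x₁ y : X} (h₀ : y ∈ dom E L x₀)
    (h₁ : y ∈ dom E L x₁) {s t : ∀ x, L x} (hs : SmoothAt E s y) (ht : SmoothAt E t y) :
    jetBracket S x₀ s t y = jetBracket S x₁ s t y :=
  jetBracket_eq S h₀ h₁
    ((jetEq_affineSec h₁ s).change h₁ h₀ (extS_holAt _ h₁).smoothAt hs)
    ((jetEq_affineSec h₁ t).change h₁ h₀ (extS_holAt _ h₁).smoothAt ht)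

/-- The coordinate of the bracket of two basis sections. -/
noncomputable def structFun (S : JacobiSheaf E L) (x₀ : X)
    (k l : Option (Fin (Module.finrank ℂ E))) : X → ℂ :=
  coord (extS ((S.on (dom E L x₀)).bracket (basisSec L x₀ k) (basisSec L x₀ l)).1) x₀

theorem contMDiffAt_structFun (S : JacobiSheaf E L) {x₀ y : X} (hy : y ∈ dom E L x₀)
    (k l : Option (Fin (Module.finrank ℂ E))) :
    ContMDiffAt 𝓘(ℂ, E) 𝓘(ℂ) ∞ (structFun S x₀ k l) y :=
  (holAt_iff hy.2).1 (extS_holAt _ hy)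

/-- For fixed $y$ the coefficients are constants, so bilinearity over $\mathbb C$ is enough. As $y$
varies, the structure functions stay holomorphic while the coefficients are only smooth. -/
theorem jetBracket_eq_sum (S : JacobiSheaf E L) {x₀ y : X} (hy : y ∈ dom E L x₀) (s t : ∀ x, L x) :
    jetBracket S x₀ s t y = (∑ k, ∑ l, coeff E x₀ s k y * coeff E x₀ t l y *
      structFun S x₀ k l y) • frame L x₀ y := by
  unfold jetBracket affineSec
  rw [JacobiModule.bracket_sum_smul, extS_sum, Finset.sum_smul]
  refine Finset.sum_congr rfl fun k _ => ?_
  rw [extS_sum, Finset.sum_smul]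
  refine Finset.sum_congr rfl fun l _ => ?_
  rw [extS_smul, mul_smul _ (structFun S x₀ k l y), structFun, ← eq_coord_smul_frame _ hy.2]

theorem coord_jetBracket (S : JacobiSheaf E L) {x₀ y : X} (hy : y ∈ dom E L x₀) (s t : ∀ x, L x) :
    coord (jetBracket S x₀ s t) x₀ y = ∑ k, ∑ l, coeff E x₀ s k y * coeff E x₀ t l y *
      structFun S x₀ k l y := by
  rw [coord_congr (t := fun z => (∑ k, ∑ l, coeff E x₀ s k z * coeff E x₀ t l z *
      structFun S x₀ k l z) • frame L x₀ z) (jetBracket_eq_sum S hy s t), coord_smul_frame hy.2]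

theorem smoothAt_jetBracket (S : JacobiSheaf E L) {x₀ y : X} (hy : y ∈ dom E L x₀)
    {s t : ∀ x, L x} (hs : SmoothAt E s y) (ht : SmoothAt E t y) :
    SmoothAt E (jetBracket S x₀ s t) y := by
  rw [smoothAt_iff hy.2]
  refine ContMDiffAt.congr_of_eventuallyEq (f := fun z => ∑ k, ∑ l, coeff E x₀ s k z *
    coeff E x₀ t l z * structFun S x₀ k l z) ?_ ?_
  · refine contMDiffAt_finsetSum fun k _ => contMDiffAt_finsetSum fun l _ => ?_
    exact contMDiffAt_mul_real (contMDiffAt_mul_real (contMDiffAt_coeff hy hs k)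
      (contMDiffAt_coeff hy ht l)) (contMDiffAt_real (contMDiffAt_structFun S hy k l))
  · filter_upwards [(dom E L x₀).isOpen.mem_nhds hy] with z hz
    exact coord_jetBracket S hz s t

theorem affineSec_add {x₀ y : X} (hy : y ∈ dom E L x₀) {s t : ∀ x, L x} (hs : SmoothAt E s y)
    (ht : SmoothAt E t y) :
    affineSec E x₀ (fun z => s z + t z) y = affineSec E x₀ s y + affineSec E x₀ t y := by
  unfold affineSec
  rw [← Finset.sum_add_distrib]
  exact Finset.sum_congr rfl fun k _ => by rw [coeff_add hy hs ht, add_smul]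

theorem affineSec_smul {x₀ y : X} (hy : y ∈ dom E L x₀) (c : ℂ) {s : ∀ x, L x}
    (hs : SmoothAt E s y) :
    affineSec E x₀ (fun z => c • s z) y = c • affineSec E x₀ s y := by
  unfold affineSec
  rw [Finset.smul_sum]
  refine Finset.sum_congr rfl fun k _ => ?_
  rw [coeff_smul (f := fun _ => c) hy contMDiffAt_const hs, del_const, smul_smul]
  cases k <;> simp [Option.elim]

theorem jetBracket_skew (S : JacobiSheaf E L) {x₀ y : X} (s t : ∀ x, L x) :
    jetBracket S x₀ s t y = -jetBracket S x₀ t s y := by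
  unfold jetBracket
  rw [(S.on (dom E L x₀)).bracket_skew, extS_neg]

theorem jetBracket_add (S : JacobiSheaf E L) {x₀ y : X} (hy : y ∈ dom E L x₀) {s t : ∀ x, L x}
    (u : ∀ x, L x) (hs : SmoothAt E s y) (ht : SmoothAt E t y) :
    jetBracket S x₀ (fun z => s z + t z) u y =
      jetBracket S x₀ s u y + jetBracket S x₀ t u y := by
  unfold jetBracket
  rw [affineSec_add hy hs ht, JacobiModule.bracket_add_left, extS_add]

theorem jetBracket_smul (S : JacobiSheaf E L) {x₀ y : X} (hy : y ∈ dom E L x₀) (c : ℂ)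
    {s : ∀ x, L x} (u : ∀ x, L x) (hs : SmoothAt E s y) :
    jetBracket S x₀ (fun z => c • s z) u y = c • jetBracket S x₀ s u y := by
  unfold jetBracket
  rw [affineSec_smul hy c hs, JacobiModule.bracket_smul_left, extS_smul]

/-- Each point uses its own chart here; independence of the chart replaces them all by the chart at
`x` on a neighbourhood. -/
theorem smoothAt_jetBracket_self (S : JacobiSheaf E L) (s t : SmoothSec E L) (x : X) :
    SmoothAt E (fun x => jetBracket S x s.1 t.1 x) x := by
  refine (smoothAt_jetBracket S (mem_dom_self x) (smoothAt_sec s x) (smoothAt_sec t x)).congr ?_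
  filter_upwards [(dom E L x).isOpen.mem_nhds (mem_dom_self x)] with y hy
  exact jetBracket_change S (mem_dom_self y) hy (smoothAt_sec s y) (smoothAt_sec t y)

/-- The bracket of smooth sections induced by the bracket of holomorphic sections. -/
noncomputable def smoothBracket (S : JacobiSheaf E L) (s t : SmoothSec E L) : SmoothSec E L :=
  ⟨fun x => jetBracket S x s.1 t.1 x, mem_smoothSec.2 (smoothAt_jetBracket_self S s t)⟩

theorem smoothBracket_apply (S : JacobiSheaf E L) (s t : SmoothSec E L) {x₀ y : X}
    (hy : y ∈ dom E L x₀) :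
    (smoothBracket S s t).1 y = jetBracket S x₀ s.1 t.1 y :=
  jetBracket_change S (mem_dom_self y) hy (smoothAt_sec s y) (smoothAt_sec t y)

theorem smoothBracket_add (S : JacobiSheaf E L) (a b c : SmoothSec E L) :
    smoothBracket S (a + b) c = smoothBracket S a c + smoothBracket S b c :=
  Subtype.ext (funext fun x =>
    jetBracket_add S (mem_dom_self x) c.1 (smoothAt_sec a x) (smoothAt_sec b x))

theorem smoothBracket_smul (S : JacobiSheaf E L) (r : ℂ) (a c : SmoothSec E L) :
    smoothBracket S (r • a) c = r • smoothBracket S a c :=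
  Subtype.ext (funext fun x => jetBracket_smul S (mem_dom_self x) r c.1 (smoothAt_sec a x))

theorem smoothBracket_skew (S : JacobiSheaf E L) (a b : SmoothSec E L) :
    smoothBracket S a b = -smoothBracket S b a :=
  Subtype.ext (funext fun x => jetBracket_skew S (x₀ := x) (y := x) a.1 b.1)

/-- The bi-derivation of smooth sections induced by the bracket of holomorphic sections. -/
noncomputable def sheafJ (S : JacobiSheaf E L) : SmoothSec E L [⋀^Fin 2]→ₗ[ℂ] SmoothSec E L :=
  altOfSkew (smoothBracket S) (smoothBracket_add S) (smoothBracket_smul S) (smoothBracket_skew S)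

theorem sheafJ_apply (S : JacobiSheaf E L) (v : Fin 2 → SmoothSec E L) :
    sheafJ S v = smoothBracket S (v 0) (v 1) := rfl

theorem smoothBracket_eq_bracket (S : JacobiSheaf E L) (s t : SmoothSec E L) {x₀ y : X}
    (hy : y ∈ dom E L x₀) {U : Opens X} (hU : y ∈ U) {s' t' : HolSec E L U}
    (hs : JetEq E x₀ (extS s'.1) s.1 y) (ht : JetEq E x₀ (extS t'.1) t.1 y) :
    (smoothBracket S s t).1 y = extS ((S.on U).bracket s' t').1 y :=
  (smoothBracket_apply S s t hy).trans (jetBracket_eq S hy hU hs ht)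

end Affine

/-! ### Derivations of germs at a point -/

section PointDerivations

variable {E : Type*} [NormedAddCommGroup E] [NormedSpace ℂ E]
  {X : Type*} [TopologicalSpace X] [ChartedSpace E X]
  {W : Type*} [AddCommGroup W] [Module ℂ W]

variable (E) in
/-- Derivations of germs of smooth functions at a point. -/
structure IsPtDer (y : X) (D : (X → ℂ) → W) : Prop where
  add : ∀ {f g : X → ℂ}, ContMDiffAt 𝓘(ℝ, E) 𝓘(ℝ, ℂ) ∞ f y → ContMDiffAt 𝓘(ℝ, E) 𝓘(ℝ, ℂ) ∞ g y →
    D (fun z => f z + g z) = D f + D g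
  mul : ∀ {f g : X → ℂ}, ContMDiffAt 𝓘(ℝ, E) 𝓘(ℝ, ℂ) ∞ f y → ContMDiffAt 𝓘(ℝ, E) 𝓘(ℝ, ℂ) ∞ g y →
    D (fun z => f z * g z) = f y • D g + g y • D f

variable {y : X} {D : (X → ℂ) → W}

theorem IsPtDer.zero (h : IsPtDer E y D) : D (fun _ => 0) = 0 := by
  have := h.add (f := fun _ => 0) (g := fun _ => 0) contMDiffAt_const contMDiffAt_const
  simpa using this

theorem IsPtDer.sum (h : IsPtDer E y D) {ι : Type*} (I : Finset ι) {f : ι → X → ℂ}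
    (hf : ∀ i, ContMDiffAt 𝓘(ℝ, E) 𝓘(ℝ, ℂ) ∞ (f i) y) :
    D (fun z => ∑ i ∈ I, f i z) = ∑ i ∈ I, D (f i) := by
  classical
  induction I using Finset.induction_on with
  | empty => simpa using h.zero
  | insert a I ha ih =>
    rw [Finset.sum_insert ha, ← ih, ← h.add (hf a) (contMDiffAt_finsetSum fun i _ => hf i)]
    simp only [Finset.sum_insert ha]

/-- The product rule for the coordinate formula of the bracket. It is applied both to $\partial$ and
to the derivative along a $(0,1)$-field, whence the general target `W`. -/
theorem IsPtDer.sum_mul_mul (h : IsPtDer E y D) {ι : Type*} [Fintype ι] {c d : ι → X → ℂ}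
    {B : ι → ι → X → ℂ} (hc : ∀ i, ContMDiffAt 𝓘(ℝ, E) 𝓘(ℝ, ℂ) ∞ (c i) y)
    (hd : ∀ i, ContMDiffAt 𝓘(ℝ, E) 𝓘(ℝ, ℂ) ∞ (d i) y)
    (hB : ∀ i j, ContMDiffAt 𝓘(ℝ, E) 𝓘(ℝ, ℂ) ∞ (B i j) y) :
    D (fun z => ∑ i, ∑ j, c i z * d j z * B i j z) =
      ∑ i, ∑ j, ((c i y * d j y) • D (B i j) + B i j y • (c i y • D (d j) + d j y • D (c i))) := by
  have hcd : ∀ i j, ContMDiffAt 𝓘(ℝ, E) 𝓘(ℝ, ℂ) ∞ (fun z => c i z * d j z) y := fun i j =>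
    contMDiffAt_mul_real (hc i) (hd j)
  have hm : ∀ i j, ContMDiffAt 𝓘(ℝ, E) 𝓘(ℝ, ℂ) ∞ (fun z => c i z * d j z * B i j z) y :=
    fun i j => contMDiffAt_mul_real (hcd i j) (hB i j)
  rw [h.sum (f := fun i z => ∑ j, c i z * d j z * B i j z) _
    fun i => contMDiffAt_finsetSum fun j _ => hm i j]
  refine Finset.sum_congr rfl fun i _ => ?_
  rw [h.sum (f := fun j z => c i z * d j z * B i j z) _ fun j => hm i j]
  refine Finset.sum_congr rfl fun j _ => ?_
  rw [h.mul (hcd i j) (hB i j), h.mul (hc i) (hd j)]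

variable [IsManifold 𝓘(ℂ, E) ∞ X]

theorem isPtDer_del {x₀ : X} (hy : y ∈ (chartAt E x₀).source) :
    IsPtDer E y (fun f => (del x₀ f y : E →L[ℂ] ℂ)) where
  add hf hg := del_add (diffAt_of_contMDiffAt hy hf) (diffAt_of_contMDiffAt hy hg)
  mul hf hg := del_mul hy (diffAt_of_contMDiffAt hy hf) (diffAt_of_contMDiffAt hy hg)

theorem isPtDer_deriv (ξ : ComplexVectorField E X) (y : X) :
    IsPtDer E y (fun f => ξ.deriv f y) where
  add {f g} hf hg := by
    have h : (realDiff (fun z => f z + g z) y : TangentSpace 𝓘(ℝ, E) y →L[ℝ] ℂ) =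
        realDiff f y + realDiff g y :=
      mfderiv_add (hf.mdifferentiableAt (by simp)) (hg.mdifferentiableAt (by simp))
    unfold ComplexVectorField.deriv
    rw [h]
    simp only [add_apply]
    ring
  mul hf hg := by
    unfold ComplexVectorField.deriv
    rw [realDiff_mul hf hg, realDiff_mul hf hg, smul_eq_mul, smul_eq_mul]
    ring

theorem ComplexVectorField.deriv_congr (ξ : ComplexVectorField E X) {f g : X → ℂ}
    (h : f =ᶠ[nhds y] g) : ξ.deriv f y = ξ.deriv g y := by
  unfold ComplexVectorField.deriv
  rw [realDiff_congr h]

theorem ComplexVectorField.deriv_holomorphic {ξ : ComplexVectorField E X} (hξ : ξ.IsType01)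
    {f : X → ℂ} (hf : ContMDiffAt 𝓘(ℂ, E) 𝓘(ℂ) ∞ f y) : ξ.deriv f y = 0 := by
  unfold ComplexVectorField.deriv
  rw [hξ y, realDiff_tangentJ hf]
  linear_combination (realDiff f y (ξ.re y)) * Complex.I_mul_I

/-- For $\xi=v-ijv$ one has $\xi(f)=df(v)-i\,df(jv)$, which is twice the $(1,0)$-part of $df$ at
$v$. -/
theorem ComplexVectorField.deriv_of_isType10 {ξ : ComplexVectorField E X} (hξ : ξ.IsType10)
    {f : X → ℂ} (hf : ContMDiffAt 𝓘(ℝ, E) 𝓘(ℝ, ℂ) ∞ f y) {x₀ : X}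
    (hy : y ∈ (chartAt E x₀).source) :
    ξ.deriv f y = del x₀ f y ((2 : ℂ) • chartDeriv y x₀ y (tanE (ξ.re y))) := by
  unfold ComplexVectorField.deriv
  rw [hξ y, map_neg, realDiff_eq hy hf, realDiff_eq hy hf, chartDeriv_tangentJ,
    map_smul (del x₀ f y), del, part10_apply]
  simp only [smul_eq_mul]
  ring

end PointDerivations

/-! ### The symbol of the induced bi-derivation -/

section Symbol

variable {E : Type*} [NormedAddCommGroup E] [NormedSpace ℂ E] [FiniteDimensional ℂ E]
  {X : Type*} [TopologicalSpace X] [ChartedSpace E X] [IsManifold 𝓘(ℂ, E) ∞ X]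
  {L : X → Type*} [∀ x, AddCommGroup (L x)] [∀ x, Module ℂ (L x)] [∀ x, TopologicalSpace (L x)]
  [TopologicalSpace (TotalSpace ℂ L)] [FiberBundle ℂ L] [VectorBundle ℂ ℂ L]
  [ContMDiffVectorBundle ∞ ℂ L 𝓘(ℂ, E)]

/-- The coefficients of the first order differential operator `t ↦ J(s, t)`. -/
noncomputable def operCoeff (S : JacobiSheaf E L) (x₀ : X) (s : ∀ x, L x)
    (l : Option (Fin (Module.finrank ℂ E))) (y : X) : ℂ :=
  ∑ k, coeff E x₀ s k y * structFun S x₀ k l y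

/-- The symbol of `t ↦ J(s, t)` at `y`, in the chart at `x₀`. -/
noncomputable def symbolE (S : JacobiSheaf E L) (x₀ : X) (s : ∀ x, L x) (y : X) : E :=
  ∑ i, (operCoeff S x₀ s (some i) y - affineFun E x₀ (some i) y * operCoeff S x₀ s none y) •
    Module.finBasis ℂ E i

theorem jetBracket_eq_operCoeff (S : JacobiSheaf E L) {x₀ y : X} (hy : y ∈ dom E L x₀)
    (s t : ∀ x, L x) : jetBracket S x₀ s t y =
      (∑ l, coeff E x₀ t l y * operCoeff S x₀ s l y) • frame L x₀ y := by
  rw [jetBracket_eq_sum S hy, Finset.sum_comm]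
  congr 1
  refine Finset.sum_congr rfl fun l _ => ?_
  unfold operCoeff
  rw [Finset.mul_sum]
  exact Finset.sum_congr rfl fun k _ => by ring

theorem sum_repr_affineFun (x₀ y : X) :
    chartAt E x₀ y = ∑ i, affineFun E x₀ (some i) y • Module.finBasis ℂ E i :=
  ((Module.finBasis ℂ E).sum_repr (chartAt E x₀ y)).symm

/-- The bracket is $\sum_l c_l(t)P_l$. The part of $c_l(ft)$ containing $\partial f$ is
$\partial_if$ for $l=i$ and $-\sum_iz_i\,\partial_if$ for the constant coefficient, each times $t$.
Collecting $\partial_if$ gives the component $P_i-z_iP_{\mathrm{none}}$ of `symbolE`. -/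
theorem jetBracket_leibniz (S : JacobiSheaf E L) {x₀ y : X} (hy : y ∈ dom E L x₀)
    (s : ∀ x, L x) {t : ∀ x, L x} (ht : SmoothAt E t y) {f : X → ℂ}
    (hf : ContMDiffAt 𝓘(ℝ, E) 𝓘(ℝ, ℂ) ∞ f y) :
    jetBracket S x₀ s (fun z => f z • t z) y =
      del x₀ f y (symbolE S x₀ s y) • t y + f y • jetBracket S x₀ s t y := by
  rw [jetBracket_eq_operCoeff S hy, jetBracket_eq_operCoeff S hy, smul_smul,
    eq_coord_smul_frame t hy.2, smul_smul, ← add_smul]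
  congr 1
  simp only [coeff_smul hy hf ht, add_mul, Finset.sum_add_distrib, Finset.mul_sum, mul_assoc]
  rw [add_comm]
  congr 1
  unfold symbolE
  rw [Fintype.sum_option]
  simp only [Option.elim]
  rw [sum_repr_affineFun x₀ y, map_sum, map_sum, Finset.sum_mul]
  simp only [map_smul, smul_eq_mul, neg_mul, Finset.sum_mul, mul_neg, Finset.mul_sum]
  rw [← Finset.sum_neg_distrib, ← Finset.sum_add_distrib]
  exact Finset.sum_congr rfl fun i _ => by ring

theorem del_clm (A : E →L[ℂ] ℂ) {x₀ y : X} (hy : y ∈ (chartAt E x₀).source) :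
    del x₀ (fun z => A (chartAt E x₀ z)) y = A := by
  have h2 : (fun z => A (chartAt E x₀ z)) ∘ (chartAt E x₀).symm =ᶠ[nhds (chartAt E x₀ y)] A := by
    filter_upwards [(chartAt E x₀).open_target.mem_nhds ((chartAt E x₀).map_source hy)] with p hp
    simp [(chartAt E x₀).right_inv hp]
  unfold del
  rw [h2.fderiv_eq, part10_fderiv A.differentiableAt, A.fderiv]

/-- The bracket does not depend on the chart, so the Leibniz rules of the two charts can be
compared. Applied to a coordinate function times the frame, which does not vanish, they identify the
components one by one. -/
theorem symbolE_change (S : JacobiSheaf E L) {x₀ x₁ y : X} (h₀ : y ∈ dom E L x₀)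
    (h₁ : y ∈ dom E L x₁) {s : ∀ x, L x} (hs : SmoothAt E s y) :
    chartDeriv x₁ x₀ y (symbolE S x₁ s y) = symbolE S x₀ s y := by
  refine (Module.finBasis ℂ E).ext_elem fun i => ?_
  let A : E →L[ℂ] ℂ := LinearMap.toContinuousLinearMap ((Module.finBasis ℂ E).coord i)
  have hf : ContMDiffAt 𝓘(ℝ, E) 𝓘(ℝ, ℂ) ∞ (fun z => A (chartAt E x₀ z)) y :=
    contMDiffAt_real (A.contDiff.contMDiff.contMDiffAt.comp y (contMDiffAt_chartAt h₀.1))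
  have ht : SmoothAt E (frame L x₀) y := (holAt_frame h₀.2).smoothAt
  have h := jetBracket_change S h₁ h₀ hs (ht.smul hf)
  rw [jetBracket_leibniz S h₁ s ht hf, jetBracket_leibniz S h₀ s ht hf,
    jetBracket_change S h₁ h₀ hs ht] at h
  have h3 := smul_left_injective ℂ (frame_ne_zero h₀.2) (add_right_cancel h)
  rw [del_chart_change h₁.1 h₀.1 (diffAt_of_contMDiffAt h₀.1 hf), del_clm A h₀.1] at h3
  exact h3

theorem contMDiffAt_symbolE (S : JacobiSheaf E L) {x₀ y : X} (hy : y ∈ dom E L x₀) {s : ∀ x, L x}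
    (hs : SmoothAt E s y) : ContMDiffAt 𝓘(ℝ, E) 𝓘(ℝ, E) ∞ (symbolE S x₀ s) y := by
  have h1 : ∀ l, ContMDiffAt 𝓘(ℝ, E) 𝓘(ℝ, ℂ) ∞ (operCoeff S x₀ s l) y := fun l =>
    contMDiffAt_finsetSum fun k _ => contMDiffAt_mul_real (contMDiffAt_coeff hy hs k)
      (contMDiffAt_real (contMDiffAt_structFun S hy k l))
  refine contMDiffAt_finsetSum fun i _ => ?_
  have h2 : ContMDiffAt 𝓘(ℝ, E) 𝓘(ℝ, ℂ) ∞ (fun z => operCoeff S x₀ s (some i) z -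
      affineFun E x₀ (some i) z * operCoeff S x₀ s none z) y :=
    (h1 _).sub (contMDiffAt_mul_real (contMDiffAt_real (contMDiffAt_affineFun hy.1 _)) (h1 _))
  exact ((ContinuousLinearMap.id ℝ ℂ).smulRight
    (Module.finBasis ℂ E i)).contDiff.contMDiff.contMDiffAt.comp y h2

/-- The symbol of `t ↦ J(s, t)`. -/
noncomputable def symbolField (S : JacobiSheaf E L) (s : SmoothSec E L) :
    ComplexVectorField E X :=
  have h : ∀ x, (fun y => chartDeriv y x y (tanE (ofE y ((2⁻¹ : ℂ) • symbolE S y s.1 y))))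
      =ᶠ[nhds x] fun y => (2⁻¹ : ℂ) • symbolE S x s.1 y := fun x => by
    filter_upwards [(dom E L x).isOpen.mem_nhds (mem_dom_self x)] with y hy
    rw [tanE_ofE, map_smul, symbolE_change S hy (mem_dom_self y) (smoothAt_sec s y)]
  have hc : ∀ (x : X) (c : ℂ), ContMDiffAt 𝓘(ℝ, E) 𝓘(ℝ, E) ∞ (fun y => c • symbolE S x s.1 y) x :=
    fun x c => (c • ContinuousLinearMap.id ℝ E).contDiff.contMDiff.contMDiffAt.comp x
      (contMDiffAt_symbolE S (mem_dom_self x) (smoothAt_sec s x))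
  -- Half of `symbolE`, since a $(1,0)$-field with real part $v$ differentiates as $\partial f(2v)$.
  { re := fun y => ofE y ((2⁻¹ : ℂ) • symbolE S y s.1 y)
    im := fun y => -tangentJ y (ofE y ((2⁻¹ : ℂ) • symbolE S y s.1 y))
    contMDiff_re := fun x => (contMDiffAt_tangent_iff (mem_chart_source E x)).2 ((hc x _).congr_of_eventuallyEq (h x))
    contMDiff_im := fun x => by
      refine (contMDiffAt_tangent_iff (mem_chart_source E x)).2 ((hc x (-Complex.I * 2⁻¹)).congr_of_eventuallyEq ?_)
      filter_upwards [h x] with y hy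
      have e : tanE (-tangentJ y (ofE y ((2⁻¹ : ℂ) • symbolE S y s.1 y))) =
          -(Complex.I • tanE (ofE y ((2⁻¹ : ℂ) • symbolE S y s.1 y))) := rfl
      rw [e, map_neg, map_smul, hy, smul_smul, ← neg_smul, neg_mul] }

theorem symbolField_isType10 (S : JacobiSheaf E L) (s : SmoothSec E L) :
    (symbolField S s).IsType10 := fun _ => rfl

theorem symbolField_hasSymbol (S : JacobiSheaf E L) (s : SmoothSec E L) :
    HasSymbol (smoothBracket S s) (symbolField S s) := by
  intro f t y
  have hy := mem_dom_self (E := E) (L := L) y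
  rw [ComplexVectorField.deriv_of_isType10 (symbolField_isType10 S s) (f.2 y) hy.1,
    chartDeriv_self hy.1]
  have e : tanE ((symbolField S s).re y) = (2⁻¹ : ℂ) • symbolE S y s.1 y := rfl
  rw [e, smul_smul, mul_inv_cancel₀ two_ne_zero, one_smul]
  exact jetBracket_leibniz S hy s.1 (smoothAt_sec t y) (f.2 y)

theorem sheafJ_isMultiderivation10 (S : JacobiSheaf E L) : IsMultiderivation10 (sheafJ S) := by
  intro i l
  fin_cases i
  -- By skew-symmetry the first slot, with `l 1` in the second, is the second slot with `-l 1` in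
  -- the first.
  · refine ⟨symbolField S ((-1 : ℂ) • l 1), symbolField_isType10 S _, ?_⟩
    convert symbolField_hasSymbol S ((-1 : ℂ) • l 1) using 2 with t
    rw [smoothBracket_smul, smoothBracket_skew S (l 1), smul_neg, neg_one_smul, neg_neg,
      sheafJ_apply]
    simp
  · refine ⟨symbolField S (l 0), symbolField_isType10 S _, ?_⟩
    convert symbolField_hasSymbol S (l 0) using 2 with t
    rw [sheafJ_apply]
    simp

end Symbol

/-! ### Explicit Schouten-Jacobi brackets in low degree -/

section Unshuffles

variable {V : Type*} [AddCommGroup V]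

theorem unshuffles_two_one : unshuffles (1 + 1) 1 = {1, Equiv.swap 1 2, finRotate 3} := by
  decide

theorem unshuffles_one_one : unshuffles (0 + 1) 1 = {1, Equiv.swap 0 1} := by
  decide

theorem unshuffles_two_zero : unshuffles (1 + 1) 0 = {1} := by
  decide

/-- The three $(2,1)$-unshuffles have signs $+,-,+$. Both Gerstenhaber products are the same
Jacobiator, and the sign $(-1)^{1\cdot1}$ makes them add up instead of cancelling. -/
theorem schoutenJacobi_one_one (J : (Fin 2 → V) → V) (l : Fin 3 → V) :
    schoutenJacobi 1 1 J J l = (-2 : ℤ) • (J ![J ![l 0, l 1], l 2] - J ![J ![l 0, l 2], l 1] +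
      J ![J ![l 1, l 2], l 0]) := by
  have h : gerstenhaber 1 1 J J l = J ![J ![l 0, l 1], l 2] + (-J ![J ![l 0, l 2], l 1] +
      J ![J ![l 1, l 2], l 0]) := by
    unfold gerstenhaber
    rw [unshuffles_two_one, Finset.sum_insert (by decide), Finset.sum_insert (by decide),
      Finset.sum_singleton]
    have e1 : (Equiv.Perm.sign (1 : Equiv.Perm (Fin (1 + 1 + 1))) : ℤ) = 1 := by decide
    have e2 : (Equiv.Perm.sign (Equiv.swap 1 2 : Equiv.Perm (Fin (1 + 1 + 1))) : ℤ) = -1 := by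
      decide
    have e3 : (Equiv.Perm.sign (finRotate 3 : Equiv.Perm (Fin (1 + 1 + 1))) : ℤ) = 1 := by decide
    rw [e1, e2, e3, one_smul, one_smul, neg_one_smul]
    congr 1
    · congr 1
      ext i; fin_cases i
      · refine congrArg J ?_
        ext i; fin_cases i <;> rfl
      · rfl
    congr 1
    · refine congrArg (fun x => -J x) ?_
      ext i; fin_cases i
      · refine congrArg J ?_
        ext i; fin_cases i <;> rfl
      · rfl
    · congr 1
      ext i; fin_cases i
      · refine congrArg J ?_
        ext i; fin_cases i <;> rfl
      · rfl
  unfold schoutenJacobi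
  have h' : (fun i => l (Fin.cast (by omega) i)) = l := rfl
  rw [h', h]
  norm_num
  abel

theorem schoutenJacobi_zero_one (D : V → V) (J : (Fin 2 → V) → V) (l : Fin 2 → V) :
    schoutenJacobi 0 1 (fun l => D (l 0)) J l =
      D (J l) - (J ![D (l 0), l 1] - J ![D (l 1), l 0]) := by
  unfold schoutenJacobi gerstenhaber
  rw [unshuffles_two_zero, unshuffles_one_one, Finset.sum_insert (by decide),
      Finset.sum_singleton, Finset.sum_singleton]
  have e1 : (Equiv.Perm.sign (1 : Equiv.Perm (Fin (1 + 1 + 0))) : ℤ) = 1 := by decide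
  have e3 : (Equiv.Perm.sign (Equiv.swap 0 1 : Equiv.Perm (Fin (0 + 1 + 1))) : ℤ) = -1 := by
    decide
  rw [e1, e3, one_smul, one_smul, neg_one_smul, sub_eq_add_neg (J _)]
  congr 1
  · simp only [zero_mul, pow_zero, one_smul]
    refine congrArg (fun x => D (J x)) ?_
    ext i; fin_cases i <;> rfl
  congr 1
  · refine congrArg J ?_
    ext i; fin_cases i <;> rfl
  · refine congrArg (fun x => -J x) ?_
    ext i; fin_cases i <;> rfl

end Unshuffles

/-! ### Commuting $\partial$ with $\overline\partial_\xi$ on holomorphic jets -/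

section Dbar

variable {E : Type*} [NormedAddCommGroup E] [NormedSpace ℂ E]
  {X : Type*} [TopologicalSpace X] [ChartedSpace E X] [IsManifold 𝓘(ℂ, E) ∞ X]
  {L : X → Type*} [∀ x, AddCommGroup (L x)] [∀ x, Module ℂ (L x)] [∀ x, TopologicalSpace (L x)]
  [TopologicalSpace (TotalSpace ℂ L)] [FiberBundle ℂ L] [VectorBundle ℂ ℂ L]

theorem dbar_eq_zero_iff (s : SmoothSec E L) (x : X) (v : TangentSpace 𝓘(ℝ, E) x) :
    dbar s x v = 0 ↔ realDiff (coord s.1 x) x (tangentJ x v) =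
      Complex.I * realDiff (coord s.1 x) x v := by
  have hx := mem_baseSet_trivializationAt ℂ L x
  have h0 : (trivializationAt ℂ L x).symm x (0 : ℂ) = 0 := by
    rw [← Trivialization.coe_symmₗ (R := ℂ) _ hx, map_zero]
  have h1 : dbar s x v = 0 ↔ (realDiff (coord s.1 x) x v +
      Complex.I * realDiff (coord s.1 x) x (tangentJ x v)) / 2 = 0 := by
    constructor
    · intro h
      have h2 := Trivialization.apply_mk_symm (trivializationAt ℂ L x) hx
        ((realDiff (coord s.1 x) x v + Complex.I * realDiff (coord s.1 x) x (tangentJ x v)) / 2)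
      have h3 := Trivialization.apply_mk_symm (trivializationAt ℂ L x) hx (0 : ℂ)
      unfold dbar at h
      rw [h, ← h0, h3] at h2
      exact (Prod.ext_iff.1 h2).2.symm
    · intro h
      unfold dbar
      rw [h, h0]
  rw [h1]
  constructor
  · intro h
    linear_combination (-2 * Complex.I) * h + realDiff (coord s.1 x) x (tangentJ x v) *
      Complex.I_mul_I
  · intro h
    linear_combination (Complex.I / 2) * h + realDiff (coord s.1 x) x v / 2 * Complex.I_mul_I

theorem IsHolJet.fderiv_I {s : SmoothSec E L} {x : X} (h : IsHolJet s x) (u : E) :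
    fderiv ℝ (coord s.1 x ∘ (chartAt E x).symm) (chartAt E x x) (Complex.I • u) =
      Complex.I * fderiv ℝ (coord s.1 x ∘ (chartAt E x).symm) (chartAt E x x) u := by
  have h1 := (dbar_eq_zero_iff s x (ofE x u)).1 (h (ofE x u))
  rw [realDiff_eq_self (smoothAt_sec s x), realDiff_eq_self (smoothAt_sec s x)] at h1
  exact h1

theorem ComplexVectorField.deriv_of_isType01 {ξ : ComplexVectorField E X} (hξ : ξ.IsType01)
    {f : X → ℂ} {x₀ y : X} (hf : ContMDiffAt 𝓘(ℝ, E) 𝓘(ℝ, ℂ) ∞ f y)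
    (hy : y ∈ (chartAt E x₀).source) :
    ξ.deriv f y = fderiv ℝ (f ∘ (chartAt E x₀).symm) (chartAt E x₀ y)
        (chartDeriv y x₀ y (tanE (ξ.re y))) +
      Complex.I * fderiv ℝ (f ∘ (chartAt E x₀).symm) (chartAt E x₀ y)
        (Complex.I • chartDeriv y x₀ y (tanE (ξ.re y))) := by
  unfold ComplexVectorField.deriv
  rw [hξ y, realDiff_eq hy hf, realDiff_eq hy hf, chartDeriv_tangentJ]

theorem hasFDerivAt_part10_apply {G : E → E →L[ℝ] ℂ} {G' : E →L[ℝ] E →L[ℝ] ℂ} {p : E}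
    (h : HasFDerivAt G G' p) (u w : E) :
    fderiv ℝ (fun q => part10 (G q) u) p w = part10 (G' w) u := by
  have h1 := (part10L E ℂ).hasFDerivAt.comp p h
  have h2 := (((ContinuousLinearMap.apply ℂ ℂ u).restrictScalars ℝ).hasFDerivAt.comp p h1).fderiv
  exact congrArg (fun B => B w) h2

variable [ContMDiffVectorBundle ∞ ℂ L 𝓘(ℂ, E)]

/-- The field $\xi$ is only smooth. Differentiating its coefficients produces a term in which they
are paired with $\overline\partial s(x)=0$; what remains is the symmetry of the second derivative.
-/
theorem del_deriv_comm {ξ : ComplexVectorField E X} (hξ : ξ.IsType01) {s : SmoothSec E L} {x : X}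
    (hs : IsHolJet s x) (u : E) :
    del x (fun y => ξ.deriv (coord s.1 x) y) x u =
      ξ.deriv (fun y => del x (coord s.1 x) y u) x := by
  set φ := chartAt E x
  set F := coord s.1 x ∘ φ.symm
  have hx := mem_dom_self (E := E) (L := L) x
  have hF : ContDiffAt ℝ ∞ F (φ x) := (contMDiffAt_chart_iff hx.1).1 (smoothAt_sec s x)
  have hv := (contMDiffAt_tangent_iff (mem_chart_source E x)).1 (ξ.contMDiff_re x)
  have hV := ((contMDiffAt_chart_iff hx.1).1 hv).differentiableAt (by simp)
  set V := (fun y => chartDeriv y x y (tanE (ξ.re y))) ∘ φ.symm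
  have hVx : V (φ x) = chartDeriv x x x (tanE (ξ.re x)) :=
    congrArg (fun y => chartDeriv y x y (tanE (ξ.re y))) (φ.left_inv hx.1)
  have hD2 : DifferentiableAt ℝ (fderiv ℝ F) (φ x) :=
    (hF.fderiv_right (m := ∞) (by simp)).differentiableAt (by simp)
  have hsym : ∀ u v, fderiv ℝ (fderiv ℝ F) (φ x) u v = fderiv ℝ (fderiv ℝ F) (φ x) v u :=
    fun u v => hF.isSymmSndFDerivAt (by
      rw [minSmoothness_of_isRCLikeNormedField]; exact WithTop.coe_le_coe.2 (le_top : (2 : ℕ∞) ≤ ⊤))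
      u v
  have hev : ∀ᶠ p in nhds (φ x), p ∈ φ.target ∧ φ.symm p ∈ dom E L x :=
    (show ∀ᶠ p in nhds (φ x), p ∈ φ.target from
      φ.open_target.mem_nhds (φ.map_source hx.1)).and
      ((chart_symm_eventually hx.1).2 ((dom E L x).isOpen.mem_nhds hx))
  have e1 : (fun y => ξ.deriv (coord s.1 x) y) ∘ φ.symm =ᶠ[nhds (φ x)]
      fun p => fderiv ℝ F p (V p) + Complex.I * fderiv ℝ F p (Complex.I • V p) := by
    filter_upwards [hev] with p hp
    have h1 : ContMDiffAt 𝓘(ℝ, E) 𝓘(ℝ, ℂ) ∞ (coord s.1 x) (φ.symm p) :=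
      (smoothAt_iff hp.2.2).1 (smoothAt_sec s _)
    have h2 := ComplexVectorField.deriv_of_isType01 hξ h1 hp.2.1
    have h3 : chartAt E x (φ.symm p) = p := φ.right_inv hp.1
    rw [h3] at h2
    exact h2
  have e2 : (fun y => del x (coord s.1 x) y u) ∘ φ.symm =ᶠ[nhds (φ x)]
      fun p => part10 (fderiv ℝ F p) u := by
    filter_upwards [hev] with p hp
    have h3 : chartAt E x (φ.symm p) = p := φ.right_inv hp.1
    change part10 (fderiv ℝ F (chartAt E x (φ.symm p))) u = _
    rw [h3]
  have hd : ContMDiffAt 𝓘(ℝ, E) 𝓘(ℝ, ℂ) ∞ (fun y => del x (coord s.1 x) y u) x := by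
    have h1 := contMDiffAt_del (x₀ := x) hx.1 (smoothAt_sec s x)
    exact ((ContinuousLinearMap.apply ℂ ℂ u).restrictScalars ℝ).contDiff.contMDiff.contMDiffAt.comp
      x h1
  -- The two terms containing the derivative of $V$ form $2\,\overline\partial F$ applied to
  -- $V'(w)$, which vanishes at `x` by `hs`.
  have hH : ∀ w, fderiv ℝ (fun p => fderiv ℝ F p (V p) + Complex.I * fderiv ℝ F p (Complex.I • V p))
      (φ x) w = fderiv ℝ F (φ x) (fderiv ℝ V (φ x) w) + fderiv ℝ (fderiv ℝ F) (φ x) w (V (φ x)) +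
        Complex.I * (fderiv ℝ F (φ x) (Complex.I • fderiv ℝ V (φ x) w) +
          fderiv ℝ (fderiv ℝ F) (φ x) w (Complex.I • V (φ x))) := by
    intro w
    have h1 := hD2.hasFDerivAt.clm_apply hV.hasFDerivAt
    have h2 := hD2.hasFDerivAt.clm_apply (hV.hasFDerivAt.const_smul Complex.I)
    have h3 := h1.add (h2.const_mul Complex.I)
    exact congrArg (fun B => B w) h3.fderiv
  rw [ComplexVectorField.deriv_of_isType01 hξ hd hx.1, ← hVx]
  change part10 (fderiv ℝ ((fun y => ξ.deriv (coord s.1 x) y) ∘ φ.symm) (φ x)) u =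
    fderiv ℝ ((fun y => del x (coord s.1 x) y u) ∘ φ.symm) (φ x) _ + Complex.I *
    fderiv ℝ ((fun y => del x (coord s.1 x) y u) ∘ φ.symm) (φ x) _
  rw [e1.fderiv_eq, e2.fderiv_eq, hasFDerivAt_part10_apply hD2.hasFDerivAt,
    hasFDerivAt_part10_apply hD2.hasFDerivAt, part10_apply, part10_apply, part10_apply, hH, hH,
    hs.fderiv_I, hs.fderiv_I, hsym u, hsym u, hsym (Complex.I • u), hsym (Complex.I • u)]
  simp only [smul_eq_mul]
  linear_combination (2⁻¹ * (fderiv ℝ F (φ x) (fderiv ℝ V (φ x) u) -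
    Complex.I * fderiv ℝ F (φ x) (fderiv ℝ V (φ x) (Complex.I • u)))) * Complex.I_mul_I

end Dbar

/-! ### The induced bi-derivation is $\overline\partial$-closed and satisfies Jacobi -/

section SheafJacobi

variable {E : Type*} [NormedAddCommGroup E] [NormedSpace ℂ E] [FiniteDimensional ℂ E]
  {X : Type*} [TopologicalSpace X] [ChartedSpace E X] [IsManifold 𝓘(ℂ, E) ∞ X]
  {L : X → Type*} [∀ x, AddCommGroup (L x)] [∀ x, Module ℂ (L x)] [∀ x, TopologicalSpace (L x)]
  [TopologicalSpace (TotalSpace ℂ L)] [FiberBundle ℂ L] [VectorBundle ℂ ℂ L]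
  [ContMDiffVectorBundle ∞ ℂ L 𝓘(ℂ, E)]
  {W : Type*} [AddCommGroup W] [Module ℂ W]

theorem coord_eq_sum (s : ∀ x, L x) (x₀ : X) :
    coord s x₀ = fun y => coeff E x₀ s none y +
      ∑ i, coeff E x₀ s (some i) y * affineFun E x₀ (some i) y := by
  funext y
  have h := sum_coeff_affineFun (E := E) x₀ s y y
  rw [sub_self, map_zero, add_zero, Fintype.sum_option] at h
  rw [← h]
  simp [affineFun]

/-- This gives the derivative of the constant coefficient from those of the section and of the
linear coefficients, so that claims about derivatives of coefficients need direct proof only for the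
linear ones. -/
theorem IsPtDer.coord {y : X} {D : (X → ℂ) → W} (h : IsPtDer E y D) {x₀ : X} (hy : y ∈ dom E L x₀)
    {s : ∀ x, L x} (hs : SmoothAt E s y) :
    D (coord s x₀) = D (coeff E x₀ s none) + ∑ i, (coeff E x₀ s (some i) y •
      D (affineFun E x₀ (some i)) + affineFun E x₀ (some i) y • D (coeff E x₀ s (some i))) := by
  have h1 := contMDiffAt_coeff hy hs
  have h2 : ∀ k, ContMDiffAt 𝓘(ℝ, E) 𝓘(ℝ, ℂ) ∞ (affineFun E x₀ k) y := fun k =>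
    contMDiffAt_real (contMDiffAt_affineFun hy.1 k)
  have h3 : ∀ i, ContMDiffAt 𝓘(ℝ, E) 𝓘(ℝ, ℂ) ∞
      (fun z => coeff E x₀ s (some i) z * affineFun E x₀ (some i) z) y := fun i =>
    contMDiffAt_mul_real (h1 _) (h2 _)
  conv_lhs => rw [coord_eq_sum (E := E) s x₀]
  rw [h.add (h1 _) (contMDiffAt_finsetSum fun i _ => h3 i), h.sum _ h3]
  congr 1
  exact Finset.sum_congr rfl fun i _ => h.mul (h1 _) (h2 _)

theorem coord_dbarOp {ξ : ComplexVectorField E X} (hξ : ξ.IsType01) (s : SmoothSec E L) {x₀ y : X}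
    (hy : y ∈ dom E L x₀) : coord (dbarOp ξ hξ s).1 x₀ y = ξ.deriv (coord s.1 x₀) y :=
  coord_dbarAlong hξ s hy.2

/-- For linear coefficients this is `del_deriv_comm`. The constant one follows by differentiating
$s=c_{\mathrm{none}}+\sum_ic_iz_i$ along $\xi$, which kills the holomorphic $z_i$. -/
theorem coeff_dbarOp {ξ : ComplexVectorField E X} (hξ : ξ.IsType01) {s : SmoothSec E L} {x : X}
    (hs : IsHolJet s x) (k : Option (Fin (Module.finrank ℂ E))) :
    coeff E x (dbarOp ξ hξ s).1 k x = ξ.deriv (coeff E x s.1 k) x := by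
  have hx := mem_dom_self (E := E) (L := L) x
  have hsome : ∀ i, coeff E x (dbarOp ξ hξ s).1 (some i) x = ξ.deriv (coeff E x s.1 (some i)) x := by
    intro i
    refine Eq.trans ?_ (del_deriv_comm hξ hs _)
    change del x (coord (dbarOp ξ hξ s).1 x) x _ = _
    rw [del_congr (g := fun y => ξ.deriv (coord s.1 x) y) hx.1]
    filter_upwards [(dom E L x).isOpen.mem_nhds hx] with y hy
    exact coord_dbarOp hξ s hy
  cases k with
  | some i => exact hsome i
  | none =>
    have h1 := coord_dbarOp hξ s hx
    rw [(isPtDer_deriv ξ x).coord hx (smoothAt_sec s x)] at h1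
    have h2 := congrFun (coord_eq_sum (E := E) (dbarOp ξ hξ s).1 x) x
    rw [h2] at h1
    simp only [ComplexVectorField.deriv_holomorphic hξ (contMDiffAt_affineFun hx.1 _), hsome,
      smul_eq_mul, mul_zero, zero_add] at h1
    rw [Finset.sum_congr rfl fun i _ => mul_comm _ _] at h1
    exact add_right_cancel h1

/-- In $\sum c_k(s)c_l(t)B_{kl}$ the factors $B_{kl}$ are holomorphic, so $\xi$ differentiates only
the coefficients, and there it acts as $\overline\partial_\xi$ on the sections. -/
theorem dbarOp_smoothBracket (S : JacobiSheaf E L) {ξ : ComplexVectorField E X} (hξ : ξ.IsType01)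
    {s t : SmoothSec E L} {x : X} (hs : IsHolJet s x) (ht : IsHolJet t x) :
    (dbarOp ξ hξ (smoothBracket S s t)).1 x =
      (smoothBracket S (dbarOp ξ hξ s) t).1 x + (smoothBracket S s (dbarOp ξ hξ t)).1 x := by
  have hx := mem_dom_self (E := E) (L := L) x
  have hB : ∀ k l, ContMDiffAt 𝓘(ℝ, E) 𝓘(ℝ, ℂ) ∞ (structFun S x k l) x := fun k l =>
    contMDiffAt_real (contMDiffAt_structFun S hx k l)
  have e : coord (smoothBracket S s t).1 x =ᶠ[nhds x] fun z => ∑ k, ∑ l,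
      coeff E x s.1 k z * coeff E x t.1 l z * structFun S x k l z := by
    filter_upwards [(dom E L x).isOpen.mem_nhds hx] with y hy
    rw [← coord_jetBracket S hy]
    exact coord_congr (smoothBracket_apply S s t hy)
  rw [smoothBracket_apply S _ _ hx, smoothBracket_apply S _ _ hx, jetBracket_eq_sum S hx,
    jetBracket_eq_sum S hx, ← add_smul, eq_coord_smul_frame (dbarOp ξ hξ _).1 hx.2,
    coord_dbarOp hξ _ hx, ComplexVectorField.deriv_congr ξ e,
    (isPtDer_deriv ξ x).sum_mul_mul (contMDiffAt_coeff hx (smoothAt_sec s x))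
      (contMDiffAt_coeff hx (smoothAt_sec t x)) hB, ← Finset.sum_add_distrib]
  congr 1
  refine Finset.sum_congr rfl fun k _ => ?_
  rw [← Finset.sum_add_distrib]
  refine Finset.sum_congr rfl fun l _ => ?_
  rw [coeff_dbarOp hξ hs, coeff_dbarOp hξ ht,
    ComplexVectorField.deriv_holomorphic hξ (contMDiffAt_structFun S hx k l)]
  simp only [smul_eq_mul]
  ring

theorem sheafJ_isDbarClosed (S : JacobiSheaf E L) : IsDbarClosed (k := 1) (sheafJ S) := by
  intro ξ hξ x l hl
  rw [schoutenJacobi_zero_one (dbarOp ξ hξ)]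
  change (dbarOp ξ hξ (smoothBracket S (l 0) (l 1))).1 x -
    ((smoothBracket S (dbarOp ξ hξ (l 0)) (l 1)).1 x -
      (smoothBracket S (dbarOp ξ hξ (l 1)) (l 0)).1 x) = 0
  rw [dbarOp_smoothBracket S hξ (hl 0) (hl 1), smoothBracket_skew S (l 0)]
  change _ + -(smoothBracket S (dbarOp ξ hξ (l 1)) (l 0)).1 x - _ = 0
  abel

/-- A quadratic polynomial in the chart with the same value, $\partial$ and $\partial\partial$ as
`s` at `x`. The section `s` need not have a holomorphic jet there, since all its
$\overline\partial$-derivatives are simply discarded. -/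
theorem exists_holomorphic_two_jet (s : SmoothSec E L) (x : X) :
    ∃ t : HolSec E L (dom E L x), JetEq E x (extS t.1) s.1 x ∧
      ∀ k, (del x (coeff E x (extS t.1) k) x : E →L[ℂ] ℂ) = del x (coeff E x s.1 k) x := by
  set φ := chartAt E x with hφ
  set F := coord s.1 x ∘ φ.symm
  have hx := mem_dom_self (E := E) (L := L) x
  have hF : ContDiffAt ℝ ∞ F (φ x) := (contMDiffAt_chart_iff hx.1).1 (smoothAt_sec s x)
  have hD2 : HasFDerivAt (fderiv ℝ F) (fderiv ℝ (fderiv ℝ F) (φ x)) (φ x) :=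
    ((hF.fderiv_right (m := ∞) (by simp)).differentiableAt (by simp)).hasFDerivAt
  have hsym : ∀ u v, fderiv ℝ (fderiv ℝ F) (φ x) u v = fderiv ℝ (fderiv ℝ F) (φ x) v u :=
    fun u v => hF.isSymmSndFDerivAt (by
      rw [minSmoothness_of_isRCLikeNormedField]; exact WithTop.coe_le_coe.2 (le_top : (2 : ℕ∞) ≤ ⊤))
      u v
  let A : E →L[ℂ] ℂ := part10 (fderiv ℝ F (φ x))
  -- The $(2,0)$-part of the real Hessian, obtained by taking the complex linear part in each
  -- argument.
  let Q : E →L[ℂ] E →L[ℂ] ℂ := part10 ((part10L E ℂ).comp (fderiv ℝ (fderiv ℝ F) (φ x)))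
  have hQ : ∀ u v, Q u v = 2⁻¹ * (part10 (fderiv ℝ (fderiv ℝ F) (φ x) u) v -
      Complex.I * part10 (fderiv ℝ (fderiv ℝ F) (φ x) (Complex.I • u)) v) := fun u v => rfl
  have hQsym : ∀ u v, Q u v = Q v u := by
    intro u v
    rw [hQ, hQ]
    simp only [part10_apply, smul_eq_mul]
    rw [hsym u v, hsym u (Complex.I • v), hsym (Complex.I • u) v,
      hsym (Complex.I • u) (Complex.I • v)]
    ring
  let g : E → ℂ := fun p => F (φ x) + A (p - φ x) + 2⁻¹ * Q (p - φ x) (p - φ x)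
  have hg : ContDiff ℂ ∞ g := by
    have h1 : ContDiff ℂ ∞ (fun p : E => p - φ x) := contDiff_id.sub contDiff_const
    exact (contDiff_const.add (A.contDiff.comp h1)).add
      (contDiff_const.mul ((Q.contDiff.comp h1).clm_apply h1))
  have hg' : ∀ p, fderiv ℂ g p = A + Q (p - φ x) := by
    intro p
    have h1 : HasFDerivAt (fun p : E => p - φ x) (ContinuousLinearMap.id ℂ E) p :=
      (hasFDerivAt_id p).sub_const _
    have h2 := ((A.hasFDerivAt.comp p h1).const_add (F (φ x))).add
      (((Q.hasFDerivAt.comp p h1).clm_apply h1).const_mul (2⁻¹ : ℂ))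
    refine (HasFDerivAt.fderiv h2).trans ?_
    ext u
    simp only [add_apply, smul_apply, ContinuousLinearMap.comp_apply, ContinuousLinearMap.id_apply,
      ContinuousLinearMap.flip_apply, Function.comp_apply, smul_eq_mul]
    rw [hQsym u]
    ring
  have hgφ : ∀ y ∈ dom E L x, ContMDiffAt 𝓘(ℂ, E) 𝓘(ℂ) ∞ (fun z => g (φ z)) y := fun y hy =>
    hg.contMDiff.contMDiffAt.comp y (contMDiffAt_chartAt hy.1)
  let t : HolSec E L (dom E L x) := mkSec _ (fun z => g (φ z) • frame L x z) fun y hy =>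
    HolAt.smul (hgφ y hy) (holAt_frame hy.2)
  have hct : ∀ y ∈ dom E L x, coord (extS t.1) x y = g (φ y) := fun y hy => by
    rw [coord_congr (extS_mkSec _ hy), coord_smul_frame hy.2]
  have hcomp : ∀ (f : E → ℂ) (y : X), y ∈ dom E L x →
      (fun z => f (φ z)) ∘ φ.symm =ᶠ[nhds (φ y)] f := fun f y hy => by
    filter_upwards [φ.open_target.mem_nhds (φ.map_source hy.1)] with p hp
    simp [φ.right_inv hp]
  have hdt : ∀ y ∈ dom E L x, del x (coord (extS t.1) x) y = A + Q (φ y - φ x) := fun y hy => by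
    have e : coord (extS t.1) x =ᶠ[nhds y] fun z => g (φ z) := by
      filter_upwards [(dom E L x).isOpen.mem_nhds hy] with z hz
      exact hct z hz
    rw [del_congr hy.1 e, ← hg' (φ y)]
    unfold del
    rw [(hcomp g y hy).fderiv_eq, part10_fderiv (hg.differentiable (by simp)).differentiableAt]
  have hjet : JetEq E x (extS t.1) s.1 x := by
    refine ⟨?_, ?_⟩
    · rw [hct x hx]
      simp [g, F, φ.left_inv hx.1]
    · rw [hdt x hx, sub_self, map_zero, add_zero]
      rfl
  have hts : SmoothAt E (extS t.1) x := (extS_holAt t hx).smoothAt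
  have hsome : ∀ i, (del x (coeff E x (extS t.1) (some i)) x : E →L[ℂ] ℂ) =
      del x (coeff E x s.1 (some i)) x := by
    intro i
    have e1 : coeff E x (extS t.1) (some i) ∘ φ.symm =ᶠ[nhds (φ x)]
        fun p => A (Module.finBasis ℂ E i) + Q (p - φ x) (Module.finBasis ℂ E i) := by
      have h1 : coeff E x (extS t.1) (some i) =ᶠ[nhds x] fun z => A (Module.finBasis ℂ E i) +
          Q (φ z - φ x) (Module.finBasis ℂ E i) := by
        filter_upwards [(dom E L x).isOpen.mem_nhds hx] with z hz
        change del x (coord (extS t.1) x) z (Module.finBasis ℂ E i) = _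
        rw [hdt z hz]
        rfl
      exact (comp_chart_congr hx.1 h1).trans (hcomp (fun p => A (Module.finBasis ℂ E i) +
        Q (p - φ x) (Module.finBasis ℂ E i)) x hx)
    have e2 : coeff E x s.1 (some i) ∘ φ.symm =ᶠ[nhds (φ x)]
        fun p => part10 (fderiv ℝ F p) (Module.finBasis ℂ E i) := by
      filter_upwards [φ.open_target.mem_nhds (φ.map_source hx.1)] with p hp
      change part10 (fderiv ℝ F (φ (φ.symm p))) (Module.finBasis ℂ E i) = _
      rw [φ.right_inv hp]
    have h3 : HasFDerivAt (fun p => A (Module.finBasis ℂ E i) + Q (p - φ x)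
        (Module.finBasis ℂ E i)) (Q.flip (Module.finBasis ℂ E i)) (φ x) := by
      have := (((Q.flip (Module.finBasis ℂ E i)).hasFDerivAt.comp (φ x)
        ((hasFDerivAt_id (φ x)).sub_const (φ x)))).const_add (A (Module.finBasis ℂ E i))
      simpa using this
    unfold del
    rw [e1.fderiv_eq, e2.fderiv_eq, part10_fderiv h3.differentiableAt, h3.fderiv]
    ext u
    rw [ContinuousLinearMap.flip_apply, hQ, part10_apply (fderiv ℝ _ _),
      hasFDerivAt_part10_apply hD2, hasFDerivAt_part10_apply hD2]
    rfl
  refine ⟨t, hjet, fun k => ?_⟩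
  cases k with
  | some i => exact hsome i
  | none =>
    have h1 := (isPtDer_del (E := E) hx.1).coord hx hts
    have h2 := (isPtDer_del (E := E) hx.1).coord hx (smoothAt_sec s x)
    simp only [hsome, coeff_congr hjet] at h1
    have h3 : (del x (coord (extS t.1) x) x : E →L[ℂ] ℂ) = del x (coord s.1 x) x := hjet.2
    rw [h1, h2] at h3
    exact add_right_cancel h3

/-- Applying $\partial$ to $\sum c_k(s)c_l(t)B_{kl}$ involves the sections only through $c_k$ and
$\partial c_k$ at $x$, which is their $(2,0)$-jet. -/
theorem jetEq_smoothBracket (S : JacobiSheaf E L) {s t : SmoothSec E L} {x : X}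
    {s' t' : HolSec E L (dom E L x)} (hs : JetEq E x (extS s'.1) s.1 x)
    (ht : JetEq E x (extS t'.1) t.1 x)
    (hs' : ∀ k, (del x (coeff E x (extS s'.1) k) x : E →L[ℂ] ℂ) = del x (coeff E x s.1 k) x)
    (ht' : ∀ k, (del x (coeff E x (extS t'.1) k) x : E →L[ℂ] ℂ) = del x (coeff E x t.1 k) x) :
    JetEq E x (extS ((S.on (dom E L x)).bracket s' t').1) (smoothBracket S s t).1 x := by
  have hx := mem_dom_self (E := E) (L := L) x
  have hB : ∀ k l, ContMDiffAt 𝓘(ℝ, E) 𝓘(ℝ, ℂ) ∞ (structFun S x k l) x := fun k l =>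
    contMDiffAt_real (contMDiffAt_structFun S hx k l)
  have e1 : coord (smoothBracket S s t).1 x =ᶠ[nhds x] fun z => ∑ k, ∑ l,
      coeff E x s.1 k z * coeff E x t.1 l z * structFun S x k l z := by
    filter_upwards [(dom E L x).isOpen.mem_nhds hx] with y hy
    rw [← coord_jetBracket S hy]
    exact coord_congr (smoothBracket_apply S s t hy)
  have e2 : coord (extS ((S.on (dom E L x)).bracket s' t').1) x =ᶠ[nhds x] fun z => ∑ k, ∑ l,
      coeff E x (extS s'.1) k z * coeff E x (extS t'.1) l z * structFun S x k l z := by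
    filter_upwards [(dom E L x).isOpen.mem_nhds hx] with y hy
    rw [← coord_jetBracket S hy]
    exact coord_congr (jetBracket_eq S hy hy ⟨rfl, rfl⟩ ⟨rfl, rfl⟩).symm
  refine ⟨?_, ?_⟩
  · rw [e1.eq_of_nhds, e2.eq_of_nhds]
    simp only [coeff_congr hs, coeff_congr ht]
  · rw [del_congr hx.1 e1, del_congr hx.1 e2,
      (isPtDer_del (E := E) hx.1).sum_mul_mul
        (contMDiffAt_coeff hx (extS_holAt s' hx).smoothAt)
        (contMDiffAt_coeff hx (extS_holAt t' hx).smoothAt) hB,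
      (isPtDer_del (E := E) hx.1).sum_mul_mul (contMDiffAt_coeff hx (smoothAt_sec s x))
        (contMDiffAt_coeff hx (smoothAt_sec t x)) hB]
    simp only [hs', ht', coeff_congr hs, coeff_congr ht]

/-- Once the three sections are replaced by holomorphic ones with the same $(2,0)$-jets at `x`, the
identity becomes that of `S`. -/
theorem smoothBracket_jacobi (S : JacobiSheaf E L) (s t u : SmoothSec E L) :
    smoothBracket S (smoothBracket S s t) u - smoothBracket S (smoothBracket S s u) t +
      smoothBracket S (smoothBracket S t u) s = 0 := by
  refine Subtype.ext (funext fun x => ?_)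
  have hx := mem_dom_self (E := E) (L := L) x
  obtain ⟨s', hs, hs'⟩ := exists_holomorphic_two_jet s x
  obtain ⟨t', ht, ht'⟩ := exists_holomorphic_two_jet t x
  obtain ⟨u', hu, hu'⟩ := exists_holomorphic_two_jet u x
  change (smoothBracket S (smoothBracket S s t) u).1 x -
    (smoothBracket S (smoothBracket S s u) t).1 x + (smoothBracket S (smoothBracket S t u) s).1 x = 0
  rw [smoothBracket_eq_bracket S _ _ hx hx (jetEq_smoothBracket S hs ht hs' ht') hu,
    smoothBracket_eq_bracket S _ _ hx hx (jetEq_smoothBracket S hs hu hs' hu') ht,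
    smoothBracket_eq_bracket S _ _ hx hx (jetEq_smoothBracket S ht hu ht' hu') hs]
  rw [sub_eq_add_neg, ← extS_neg, ← extS_add, ← extS_add,
    (S.on (dom E L x)).jacobi_cyclic s' t' u', extS_apply _ hx]
  rfl

/-- The holomorphic Jacobi bi-derivation induced by a Jacobi module structure. -/
noncomputable def sheafHolomorphicJacobi (S : JacobiSheaf E L) : HolomorphicJacobi E L where
  J := sheafJ S
  isMultiderivation := sheafJ_isMultiderivation10 S
  isDbarClosed := sheafJ_isDbarClosed S
  isJacobi l := by
    rw [schoutenJacobi_one_one]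
    have h := smoothBracket_jacobi S (l 0) (l 1) (l 2)
    change (-2 : ℤ) • (smoothBracket S (smoothBracket S (l 0) (l 1)) (l 2) -
      smoothBracket S (smoothBracket S (l 0) (l 2)) (l 1) +
      smoothBracket S (smoothBracket S (l 1) (l 2)) (l 0)) = 0
    rw [h, smul_zero]

end SheafJacobi

/-! ### Algebra of alternating bilinear maps -/

section BiderivationAlgebra

variable {V : Type*} [AddCommGroup V] [Module ℂ V] (J : V [⋀^Fin 2]→ₗ[ℂ] V)

theorem alt_skew (s t : V) : J ![s, t] = -J ![t, s] := by
  have h := J.map_swap ![t, s] (i := 0) (j := 1) (by decide)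
  rw [← h]
  congr 1
  ext i; fin_cases i <;> rfl

theorem alt_add_right (s t t' : V) : J ![s, t + t'] = J ![s, t] + J ![s, t'] := by
  have h := J.map_update_add ![s, 0] 1 t t'
  have e : ∀ w, Function.update ![s, 0] 1 w = ![s, w] := fun w => by
    ext i; fin_cases i <;> rfl
  rwa [e, e, e] at h

theorem alt_smul_right (c : ℂ) (s t : V) : J ![s, c • t] = c • J ![s, t] := by
  have h := J.map_update_smul ![s, 0] 1 c t
  have e : ∀ w, Function.update ![s, 0] 1 w = ![s, w] := fun w => by
    ext i; fin_cases i <;> rfl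
  rwa [e, e] at h

theorem alt_smul_left (c : ℂ) (s t : V) : J ![c • s, t] = c • J ![s, t] := by
  rw [alt_skew, alt_smul_right, alt_skew J s, smul_neg]

theorem alt_self (s : V) : J ![s, s] = 0 :=
  J.map_eq_zero_of_eq _ (i := 0) (j := 1) rfl (by decide)

theorem alt_neg_right (s t : V) : J ![s, -t] = -J ![s, t] := by
  rw [← neg_one_smul ℂ, alt_smul_right, neg_one_smul]

theorem alt_sub_right (s t t' : V) : J ![s, t - t'] = J ![s, t] - J ![s, t'] := by
  rw [sub_eq_add_neg, alt_add_right, alt_neg_right, ← sub_eq_add_neg]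

end BiderivationAlgebra

/-! ### Bi-derivations depend only on $(1,0)$-jets and preserve holomorphy -/

section Locality

variable {E : Type*} [NormedAddCommGroup E] [NormedSpace ℂ E] [FiniteDimensional ℂ E]
  {X : Type*} [TopologicalSpace X] [T2Space X] [ChartedSpace E X] [IsManifold 𝓘(ℂ, E) ∞ X]
  {L : X → Type*} [∀ x, AddCommGroup (L x)] [∀ x, Module ℂ (L x)] [∀ x, TopologicalSpace (L x)]
  [TopologicalSpace (TotalSpace ℂ L)] [FiberBundle ℂ L] [VectorBundle ℂ ℂ L]

theorem exists_symbol {J : SmoothSec E L [⋀^Fin 2]→ₗ[ℂ] SmoothSec E L}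
    (hJ : IsMultiderivation10 J) (s : SmoothSec E L) :
    ∃ ξ : ComplexVectorField E X, ξ.IsType10 ∧ HasSymbol (fun t => J ![s, t]) ξ := by
  obtain ⟨ξ, h1, h2⟩ := hJ 1 ![s, 0]
  refine ⟨ξ, h1, ?_⟩
  convert h2 using 3 with t
  ext i; fin_cases i <;> rfl

/-- For a bump function $\varphi$ at $x$ that vanishes wherever $t$ may be nonzero,
$t=(1-\varphi)t$; the Leibniz rule at $x$ then contains only the factors $t(x)=0$ and
$1-\varphi(x)=0$. -/
theorem HasSymbol.eq_zero_of_eventually {Δ : SmoothSec E L → SmoothSec E L}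
    {ξ : ComplexVectorField E X} (h : HasSymbol Δ ξ) {t : SmoothSec E L} {x : X}
    (ht : ∀ᶠ y in nhds x, t.1 y = 0) : (Δ t).1 x = 0 := by
  obtain ⟨φ, h1, h2, h3⟩ := exists_cutoff (E := E) ht
  let f : SmoothFun E X := ⟨fun y => 1 - (φ y : ℂ), fun y => by
    have : ContMDiffAt 𝓘(ℝ, E) 𝓘(ℝ, ℂ) ∞ (fun z => (φ z : ℂ)) y :=
      Complex.ofRealCLM.contDiff.contMDiff.contMDiffAt.comp y (h1 y)
    exact contMDiffAt_const.sub this⟩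
  have e : f • t = t := by
    refine Subtype.ext (funext fun y => ?_)
    change (1 - (φ y : ℂ)) • t.1 y = t.1 y
    rcases h3 y with h | h
    · have h' : t.1 y = 0 := h
      rw [h', smul_zero]
    · simp [h.self_of_nhds]
  have h4 := h f t x
  have h5 : f.1 x = 0 := by
    change 1 - (φ x : ℂ) = 0
    simp [h2.self_of_nhds]
  rw [e, ht.self_of_nhds, h5, smul_zero, zero_smul, add_zero] at h4
  exact h4

variable [ContMDiffVectorBundle ∞ ℂ L 𝓘(ℂ, E)] {J : SmoothSec E L [⋀^Fin 2]→ₗ[ℂ] SmoothSec E L}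

theorem alt_congr_eventually_right (hJ : IsMultiderivation10 J) (s : SmoothSec E L)
    {t t' : SmoothSec E L} {x : X} (h : ∀ᶠ y in nhds x, t.1 y = t'.1 y) :
    (J ![s, t]).1 x = (J ![s, t']).1 x := by
  obtain ⟨ξ, -, hξ⟩ := exists_symbol hJ s
  have h1 := hξ.eq_zero_of_eventually (t := t - t') (x := x) (by
    filter_upwards [h] with y hy
    exact sub_eq_zero.2 hy)
  rw [alt_sub_right] at h1
  exact sub_eq_zero.1 h1

/-- Near `x` the section is $fe$ with $f(x)=0$ and $\partial f(x)=0$. The symbol is of type $(1,0)$,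
so it sees only $\partial f$ and both Leibniz terms vanish. -/
theorem alt_eq_zero_of_jetZero (hJ : IsMultiderivation10 J) (s : SmoothSec E L)
    {t : SmoothSec E L} {x : X} (h : JetZero E x t.1 x) : (J ![s, t]).1 x = 0 := by
  obtain ⟨ξ, h10, hξ⟩ := exists_symbol hJ s
  have hx := mem_dom_self (E := E) (L := L) x
  have hdom : ∀ᶠ y in nhds x, y ∈ dom E L x := (dom E L x).isOpen.mem_nhds hx
  obtain ⟨f, hf⟩ := exists_smoothFun (E := E) (x := x) (f := coord t.1 x) (by
    filter_upwards [hdom] with y hy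
    exact (smoothAt_iff hy.2).1 (smoothAt_sec t y))
  obtain ⟨e, he⟩ := exists_smoothSec (E := E) (x := x) (s := frame L x) (by
    filter_upwards [hdom] with y hy
    exact (holAt_frame hy.2).smoothAt)
  have h1 : ∀ᶠ y in nhds x, t.1 y = (f • e).1 y := by
    filter_upwards [hf, he, hdom] with y h1 h2 h3
    change t.1 y = f.1 y • e.1 y
    rw [h1, h2, ← eq_coord_smul_frame _ h3.2]
  have h2 := hξ f e x
  rw [alt_congr_eventually_right hJ s h1, h2,
    ComplexVectorField.deriv_of_isType10 h10 (f.2 x) hx.1, del_congr hx.1 hf, h.2, hf.eq_of_nhds,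
    h.1]
  simp

theorem alt_congr_jet_right (hJ : IsMultiderivation10 J) (s : SmoothSec E L)
    {t t' : SmoothSec E L} {x : X} (h : JetEq E x t.1 t'.1 x) :
    (J ![s, t]).1 x = (J ![s, t']).1 x := by
  have h1 := alt_eq_zero_of_jetZero hJ s (t := t + (-1 : ℂ) • t') (x := x)
    ((JetZero.sub_iff (mem_dom_self x) (smoothAt_sec t x) (smoothAt_sec t' x)).2 h)
  rw [alt_add_right, alt_smul_right] at h1
  have h2 : (J ![s, t]).1 x + (-1 : ℂ) • (J ![s, t']).1 x = 0 := h1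
  rwa [neg_one_smul, ← sub_eq_add_neg, sub_eq_zero] at h2

theorem alt_congr_jet (hJ : IsMultiderivation10 J) {s s' t t' : SmoothSec E L} {x : X}
    (hs : JetEq E x s.1 s'.1 x) (ht : JetEq E x t.1 t'.1 x) :
    (J ![s, t]).1 x = (J ![s', t']).1 x := by
  rw [alt_congr_jet_right hJ s ht, alt_skew, alt_skew J s']
  exact congrArg Neg.neg (alt_congr_jet_right hJ t' hs)

theorem alt_congr (hJ : IsMultiderivation10 J) {s s' t t' : SmoothSec E L} {x : X}
    (hs : ∀ᶠ y in nhds x, s.1 y = s'.1 y) (ht : ∀ᶠ y in nhds x, t.1 y = t'.1 y) :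
    (J ![s, t]).1 x = (J ![s', t']).1 x :=
  alt_congr_jet hJ (JetEq.of_eventuallyEq (mem_dom_self x) hs)
    (JetEq.of_eventuallyEq (mem_dom_self x) ht)

/-- A vector constant in the chart at `x`, cut off by a bump function. Such fields suffice to test
the Cauchy-Riemann equations at a point. -/
theorem exists_type01 (x : X) (v : TangentSpace 𝓘(ℝ, E) x) :
    ∃ ξ : ComplexVectorField E X, ξ.IsType01 ∧ ξ.re x = v := by
  have hW := (chartAt E x).open_source.mem_nhds (mem_chart_source E x)
  obtain ⟨φ, h1, h2, h3⟩ := exists_cutoff (E := E) hW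
  let w : ∀ y : X, TangentSpace 𝓘(ℝ, E) y := fun y =>
    ofE y ((φ y : ℂ) • chartDeriv x y y (tanE v))
  -- The scalar `c` treats the real part (`c = 1`) and the imaginary part (`c = Complex.I`)
  -- together.
  have hw : ∀ (y : X) (c : ℂ), ContMDiffAt 𝓘(ℝ, E) 𝓘(ℝ, E).tangent ∞
      (fun y => (⟨y, ofE y (c • tanE (w y))⟩ : TangentBundle 𝓘(ℝ, E) X)) y := by
    intro y c
    rcases h3 y with h | h
    · refine (contMDiffAt_tangent_iff h).2 ?_
      have hφ : ContMDiffAt 𝓘(ℝ, E) 𝓘(ℝ, ℂ) ∞ (fun z => (φ z : ℂ)) y :=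
        Complex.ofRealCLM.contDiff.contMDiff.contMDiffAt.comp y (h1 y)
      have h4 : ContMDiffAt 𝓘(ℝ, E) 𝓘(ℝ, E) ∞ (fun z => (φ z : ℂ) • c • tanE v) y :=
        ((ContinuousLinearMap.id ℝ ℂ).smulRight (c • tanE v)).contDiff.contMDiff.contMDiffAt.comp
          y hφ
      refine h4.congr_of_eventuallyEq ?_
      filter_upwards [(chartAt E x).open_source.mem_nhds h] with z hz
      rw [tanE_ofE, map_smul, tanE_ofE, map_smul, chartDeriv_chartDeriv hz (mem_chart_source E z),
        smul_comm]
    · refine (contMDiffAt_tangent_iff (mem_chart_source E y)).2 ?_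
      refine (contMDiffAt_const (c := (0 : E))).congr_of_eventuallyEq ?_
      filter_upwards [h] with z hz
      simp [w, tanE_ofE, hz]
  refine ⟨⟨w, fun y => tangentJ y (w y), fun y => ?_, fun y => hw y Complex.I⟩, fun y => rfl, ?_⟩
  · convert hw y 1 using 3 with z
    rw [one_smul]
    rfl
  · change ofE x ((φ x : ℂ) • chartDeriv x x x (tanE v)) = v
    rw [h2.self_of_nhds, chartDeriv_self (mem_chart_source E x)]
    simp
    rfl

theorem isHolJet_of_holAt {s : SmoothSec E L} {x : X} (h : HolAt E s.1 x) : IsHolJet s x :=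
  fun v => (dbar_eq_zero_iff s x v).2 (realDiff_tangentJ h v)

theorem dbarOp_eq_zero_of_holAt {ξ : ComplexVectorField E X} (hξ : ξ.IsType01) {s : SmoothSec E L}
    {x : X} (h : HolAt E s.1 x) : (dbarOp ξ hξ s).1 x = 0 := by
  have hx := mem_dom_self (E := E) (L := L) x
  refine eq_of_coord_eq (t := fun z => 0) hx.2 ?_
  rw [coord_dbarOp hξ s hx, coord_zero hx.2, ComplexVectorField.deriv_holomorphic hξ h]

/-- The bracket of holomorphic sections is holomorphic, for a `∂̄`-closed bi-derivation. -/
theorem holAt_alt (hJ : IsMultiderivation10 J) (hc : IsDbarClosed (k := 1) J)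
    {s t : SmoothSec E L} {x : X} (hs : ∀ᶠ y in nhds x, HolAt E s.1 y)
    (ht : ∀ᶠ y in nhds x, HolAt E t.1 y) : HolAt E (J ![s, t]).1 x := by
  have hx := mem_dom_self (E := E) (L := L) x
  refine contMDiffAt_complex_of_eventually hx.1 ?_
  filter_upwards [hs.eventually_nhds, ht.eventually_nhds, (dom E L x).isOpen.mem_nhds hx]
    with y hys hyt hy
  refine ⟨(smoothAt_iff hy.2).1 (smoothAt_sec _ y), fun v => ?_⟩
  obtain ⟨ξ, hξ, hv⟩ := exists_type01 y v
  have h1 := hc ξ hξ y ![s, t] (fun i => by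
    fin_cases i
    · exact isHolJet_of_holAt hys.self_of_nhds
    · exact isHolJet_of_holAt hyt.self_of_nhds)
  rw [schoutenJacobi_zero_one (dbarOp ξ hξ)] at h1
  -- Not only the value but the whole germ of $\overline\partial_\xi s$ vanishes, which locality of
  -- `J` requires; the same holds for `t`.
  have h2 : (J ![dbarOp ξ hξ s, t]).1 y = 0 := by
    rw [alt_congr hJ (s' := 0) (t' := t) (hys.mono fun z hz => dbarOp_eq_zero_of_holAt hξ hz)
      (Filter.Eventually.of_forall fun _ => rfl), ← zero_smul ℂ (0 : SmoothSec E L),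
      alt_smul_left, zero_smul]
    rfl
  have h3 : (J ![dbarOp ξ hξ t, s]).1 y = 0 := by
    rw [alt_congr hJ (s' := 0) (t' := s) (hyt.mono fun z hz => dbarOp_eq_zero_of_holAt hξ hz)
      (Filter.Eventually.of_forall fun _ => rfl), ← zero_smul ℂ (0 : SmoothSec E L),
      alt_smul_left, zero_smul]
    rfl
  have h4 : (dbarOp ξ hξ (J ![s, t])).1 y - ((J ![dbarOp ξ hξ s, t]).1 y -
    (J ![dbarOp ξ hξ t, s]).1 y) = 0 := h1
  rw [h2, h3, sub_zero, sub_zero] at h4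
  have h5 := coord_congr (t := fun z => 0) (x₀ := x) h4
  rw [coord_dbarOp hξ _ hy, coord_zero hy.2] at h5
  unfold ComplexVectorField.deriv at h5
  rw [hξ y, hv] at h5
  linear_combination (-Complex.I) * h5 + realDiff (coord (J ![s, t]).1 x) y (tangentJ y v) *
    Complex.I_mul_I

end Locality

/-! ### What the Leibniz rule forces on $R$ -/

section LeibnizAlgebra

variable {A M : Type*} [CommRing A] [Algebra ℂ A] [AddCommGroup M] [Module ℂ M] [Module A M]
  [IsScalarTower ℂ A M] {br : M →ₗ[ℂ] M →ₗ[ℂ] M} {R : M → A → A}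

/-- Here `R` is an arbitrary map. Its properties come from those of the bracket, but only after
acting on an element `e`, which a local frame will later cancel. -/
theorem leibniz_add (h : ∀ s a t, br s (a • t) = R s a • t + a • br s t) (s : M) (a b : A) (e : M) :
    R s (a + b) • e = (R s a + R s b) • e := by
  have h1 := h s (a + b) e
  rw [add_smul, map_add, h, h, add_smul] at h1
  rw [add_smul, ← sub_eq_zero]
  rw [← sub_eq_zero] at h1
  rw [← neg_eq_zero, ← h1]
  abel

theorem leibniz_mul (h : ∀ s a t, br s (a • t) = R s a • t + a • br s t) (s : M) (a b : A) (e : M) :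
    R s (a * b) • e = (a * R s b + b * R s a) • e := by
  have h1 := h s (a * b) e
  rw [mul_smul, h, h, smul_add, mul_smul, ← add_assoc] at h1
  rw [← add_right_cancel h1, add_smul, mul_smul, mul_comm b, mul_smul, add_comm]

theorem leibniz_smul (h : ∀ s a t, br s (a • t) = R s a • t + a • br s t) (s : M) (c : ℂ) (a : A)
    (e : M) : R s (c • a) • e = (c • R s a) • e := by
  have h1 := h s (c • a) e
  rw [smul_assoc, map_smul, h, smul_add, smul_assoc] at h1
  rw [← add_right_cancel h1, smul_assoc]

theorem leibniz_add_left (h : ∀ s a t, br s (a • t) = R s a • t + a • br s t) (s s' : M) (a : A)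
    (e : M) : R (s + s') a • e = (R s a + R s' a) • e := by
  have h1 := h (s + s') a e
  rw [map_add, LinearMap.add_apply, LinearMap.add_apply, h, h, smul_add] at h1
  rw [add_smul, ← sub_eq_zero]
  rw [← sub_eq_zero] at h1
  rw [← neg_eq_zero, ← h1]
  abel

theorem leibniz_smul_left (h : ∀ s a t, br s (a • t) = R s a • t + a • br s t) (c : ℂ) (s : M)
    (a : A) (e : M) : R (c • s) a • e = (c • R s a) • e := by
  have h1 := h (c • s) a e
  have e1 : ∀ w, br (c • s) w = c • br s w := fun w => by rw [map_smul]; rfl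
  have e2 : a • c • br s e = c • a • br s e := by
    rw [← algebraMap_smul A c (br s e), smul_comm, algebraMap_smul]
  rw [e1, e1, h, smul_add, e2] at h1
  rw [← add_right_cancel h1, smul_assoc]

/-- Subtract $a$ times the Jacobi identity for $(s,t,e)$ from the one for $(s,t,ae)$: the mixed
terms $R_s(a)\{t,e\}$ and $R_t(a)\{s,e\}$ cancel. -/
theorem leibniz_bracket (h : ∀ s a t, br s (a • t) = R s a • t + a • br s t)
    (hj : ∀ s t u, br s (br t u) = br (br s t) u + br t (br s u)) (s t : M) (a : A) (e : M) :
    R (br s t) a • e = (R s (R t a) - R t (R s a)) • e := by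
  have h1 := hj s t (a • e)
  have h2 := congrArg (fun w => a • w) (hj s t e)
  simp only [h, map_add, smul_add] at h1 h2
  have h3 := congrArg₂ (fun v w => v - w) h1 h2
  rw [sub_smul, ← sub_eq_zero]
  rw [← sub_eq_zero] at h3
  rw [← neg_eq_zero, ← h3]
  abel

end LeibnizAlgebra

/-! ### Restricting a bi-derivation to holomorphic sections -/

section Restriction

variable {E : Type*} [NormedAddCommGroup E] [NormedSpace ℂ E] [FiniteDimensional ℂ E]
  {X : Type*} [TopologicalSpace X] [T2Space X] [ChartedSpace E X] [IsManifold 𝓘(ℂ, E) ∞ X]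
  {L : X → Type*} [∀ x, AddCommGroup (L x)] [∀ x, Module ℂ (L x)] [∀ x, TopologicalSpace (L x)]
  [TopologicalSpace (TotalSpace ℂ L)] [FiberBundle ℂ L] [VectorBundle ℂ ℂ L]
  [ContMDiffVectorBundle ∞ ℂ L 𝓘(ℂ, E)] {J : SmoothSec E L [⋀^Fin 2]→ₗ[ℂ] SmoothSec E L}

/-- A smooth global section with the germ of `s` at `x`. -/
noncomputable def extAt {U : Opens X} (s : HolSec E L U) (x : U) : SmoothSec E L :=
  (exists_smoothSec_extS s x.2).choose

theorem extAt_germ {U : Opens X} (s : HolSec E L U) (x : U) :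
    ∀ᶠ y in nhds x.1, (extAt s x).1 y = extS s.1 y :=
  (exists_smoothSec_extS s x.2).choose_spec

/-- A smooth global function with the germ of `a` at `x`. -/
noncomputable def extFunAt {U : Opens X} (a : HolFun E U) (x : U) : SmoothFun E X :=
  (exists_smoothFun_extF a x.2).choose

theorem extFunAt_germ {U : Opens X} (a : HolFun E U) (x : U) :
    ∀ᶠ y in nhds x.1, (extFunAt a x).1 y = extF a.1 y :=
  (exists_smoothFun_extF a x.2).choose_spec

theorem holAt_of_germ {U : Opens X} {s : HolSec E L U} {s' : SmoothSec E L} {x : X} (hx : x ∈ U)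
    (h : ∀ᶠ y in nhds x, s'.1 y = extS s.1 y) : ∀ᶠ y in nhds x, HolAt E s'.1 y := by
  filter_upwards [h.eventually_nhds, U.isOpen.mem_nhds hx] with y h1 h2
  exact (extS_holAt s h2).congr h1

open Classical in
/-- The bracket of holomorphic sections over `U`, extended by zero. -/
noncomputable def germBracket (J : SmoothSec E L [⋀^Fin 2]→ₗ[ℂ] SmoothSec E L) {U : Opens X}
    (s t : HolSec E L U) (x : X) : L x :=
  if h : x ∈ U then (J ![extAt s ⟨x, h⟩, extAt t ⟨x, h⟩]).1 x else 0

theorem germBracket_eq (hJ : IsMultiderivation10 J) {U : Opens X} {s t : HolSec E L U}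
    {s' t' : SmoothSec E L} {x : X} (hx : x ∈ U) (hs : ∀ᶠ y in nhds x, s'.1 y = extS s.1 y)
    (ht : ∀ᶠ y in nhds x, t'.1 y = extS t.1 y) : germBracket J s t x = (J ![s', t']).1 x := by
  unfold germBracket
  rw [dif_pos hx]
  exact alt_congr hJ (((extAt_germ s ⟨x, hx⟩).and hs).mono fun y hy => hy.1.trans hy.2.symm)
    (((extAt_germ t ⟨x, hx⟩).and ht).mono fun y hy => hy.1.trans hy.2.symm)

theorem germBracket_eventually (hJ : IsMultiderivation10 J) {U : Opens X} {s t : HolSec E L U}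
    {s' t' : SmoothSec E L} {x : X} (hx : x ∈ U) (hs : ∀ᶠ y in nhds x, s'.1 y = extS s.1 y)
    (ht : ∀ᶠ y in nhds x, t'.1 y = extS t.1 y) :
    ∀ᶠ y in nhds x, germBracket J s t y = (J ![s', t']).1 y := by
  filter_upwards [hs.eventually_nhds, ht.eventually_nhds, U.isOpen.mem_nhds hx] with y h1 h2 h3
  exact germBracket_eq hJ h3 h1 h2

/-- The bracket of holomorphic sections over `U` induced by a bi-derivation. -/
noncomputable def holBracket (hJ : IsMultiderivation10 J) (hc : IsDbarClosed (k := 1) J)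
    {U : Opens X} (s t : HolSec E L U) : HolSec E L U :=
  mkSec U (germBracket J s t) fun x hx =>
    (holAt_alt hJ hc (holAt_of_germ hx (extAt_germ s ⟨x, hx⟩))
      (holAt_of_germ hx (extAt_germ t ⟨x, hx⟩))).congr
      (germBracket_eventually hJ hx (extAt_germ s ⟨x, hx⟩) (extAt_germ t ⟨x, hx⟩))

variable {hJ : IsMultiderivation10 J} {hc : IsDbarClosed (k := 1) J}

theorem holBracket_eq {U : Opens X} {s t : HolSec E L U}
    {s' t' : SmoothSec E L} {x : X} (hx : x ∈ U) (hs : ∀ᶠ y in nhds x, s'.1 y = extS s.1 y)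
    (ht : ∀ᶠ y in nhds x, t'.1 y = extS t.1 y) :
    (holBracket hJ hc s t).1 ⟨x, hx⟩ = (J ![s', t']).1 x :=
  germBracket_eq hJ hx hs ht

theorem holBracket_germ {U : Opens X} {s t : HolSec E L U}
    {s' t' : SmoothSec E L} {x : X} (hx : x ∈ U) (hs : ∀ᶠ y in nhds x, s'.1 y = extS s.1 y)
    (ht : ∀ᶠ y in nhds x, t'.1 y = extS t.1 y) :
    ∀ᶠ y in nhds x, (J ![s', t']).1 y = extS (holBracket hJ hc s t).1 y := by
  filter_upwards [germBracket_eventually hJ hx hs ht, U.isOpen.mem_nhds hx] with y h1 h2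
  rw [← h1]
  exact (extS_mkSec _ h2).symm

theorem germ_add {U : Opens X} {s t : HolSec E L U} {s' t' : SmoothSec E L} {x : X}
    (hs : ∀ᶠ y in nhds x, s'.1 y = extS s.1 y) (ht : ∀ᶠ y in nhds x, t'.1 y = extS t.1 y) :
    ∀ᶠ y in nhds x, (s' + t').1 y = extS (s + t).1 y := by
  filter_upwards [hs, ht] with y h1 h2
  rw [extS_add, ← h1, ← h2]
  rfl

theorem germ_smul {U : Opens X} {s : HolSec E L U} {s' : SmoothSec E L} {x : X} (c : ℂ)
    (hs : ∀ᶠ y in nhds x, s'.1 y = extS s.1 y) :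
    ∀ᶠ y in nhds x, (c • s').1 y = extS (c • s).1 y := by
  filter_upwards [hs] with y h1
  rw [extS_smul, ← h1]
  rfl

theorem germ_fun_smul {U : Opens X} {a : HolFun E U} {s : HolSec E L U} {a' : SmoothFun E X}
    {s' : SmoothSec E L} {x : X} (hx : x ∈ U) (ha : ∀ᶠ y in nhds x, a'.1 y = extF a.1 y)
    (hs : ∀ᶠ y in nhds x, s'.1 y = extS s.1 y) :
    ∀ᶠ y in nhds x, (a' • s').1 y = extS (a • s).1 y := by
  filter_upwards [ha, hs, U.isOpen.mem_nhds hx] with y h1 h2 h3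
  rw [extS_apply _ h3]
  rw [extF_apply _ h3] at h1
  rw [extS_apply _ h3] at h2
  change a'.1 y • s'.1 y = a.1 ⟨y, h3⟩ • s.1 ⟨y, h3⟩
  rw [h1, h2]

theorem holBracket_skew {U : Opens X} (s t : HolSec E L U) :
    holBracket hJ hc s t = -holBracket hJ hc t s := by
  refine Subtype.ext (funext fun x => ?_)
  rw [holBracket_eq x.2 (extAt_germ s x) (extAt_germ t x), alt_skew]
  exact congrArg Neg.neg (holBracket_eq x.2 (extAt_germ t x) (extAt_germ s x)).symm

theorem holBracket_add_right {U : Opens X} (s t t' : HolSec E L U) :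
    holBracket hJ hc s (t + t') = holBracket hJ hc s t + holBracket hJ hc s t' := by
  refine Subtype.ext (funext fun x => ?_)
  have h : (holBracket hJ hc s t + holBracket hJ hc s t').1 x =
    (holBracket hJ hc s t).1 x + (holBracket hJ hc s t').1 x := rfl
  rw [h, holBracket_eq x.2 (extAt_germ s x) (germ_add (extAt_germ t x) (extAt_germ t' x)),
    holBracket_eq x.2 (extAt_germ s x) (extAt_germ t x),
    holBracket_eq x.2 (extAt_germ s x) (extAt_germ t' x), alt_add_right]
  rfl

theorem holBracket_smul_right {U : Opens X} (c : ℂ) (s t : HolSec E L U) :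
    holBracket hJ hc s (c • t) = c • holBracket hJ hc s t := by
  refine Subtype.ext (funext fun x => ?_)
  have h : (c • holBracket hJ hc s t).1 x = c • (holBracket hJ hc s t).1 x := rfl
  rw [h, holBracket_eq x.2 (extAt_germ s x) (germ_smul c (extAt_germ t x)),
    holBracket_eq x.2 (extAt_germ s x) (extAt_germ t x), alt_smul_right]
  rfl

theorem holBracket_self {U : Opens X} (s : HolSec E L U) : holBracket hJ hc s s = 0 := by
  refine Subtype.ext (funext fun x => ?_)
  rw [holBracket_eq x.2 (extAt_germ s x) (extAt_germ s x), alt_self]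
  rfl

theorem holBracket_add_left {U : Opens X} (s s' t : HolSec E L U) :
    holBracket hJ hc (s + s') t = holBracket hJ hc s t + holBracket hJ hc s' t := by
  rw [holBracket_skew, holBracket_add_right, holBracket_skew s t, holBracket_skew s' t, neg_add]

theorem holBracket_smul_left {U : Opens X} (c : ℂ) (s t : HolSec E L U) :
    holBracket hJ hc (c • s) t = c • holBracket hJ hc s t := by
  rw [holBracket_skew, holBracket_smul_right, holBracket_skew s t, smul_neg]

theorem alt_jacobi (hj : ∀ l, schoutenJacobi 1 1 J J l = 0) (s t u : SmoothSec E L) :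
    J ![s, J ![t, u]] = J ![J ![s, t], u] + J ![t, J ![s, u]] := by
  have h := hj ![s, t, u]
  rw [schoutenJacobi_one_one, ← Int.cast_smul_eq_zsmul ℂ, smul_eq_zero] at h
  have h2 := h.resolve_left (by norm_num)
  change J ![J ![s, t], u] - J ![J ![s, u], t] + J ![J ![t, u], s] = 0 at h2
  rw [alt_skew J (J ![s, u]), alt_skew J (J ![t, u])] at h2
  rw [← sub_eq_zero, ← neg_eq_zero, ← h2]
  abel

theorem holBracket_jacobi (hj : ∀ l, schoutenJacobi 1 1 J J l = 0) {U : Opens X}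
    (s t u : HolSec E L U) : holBracket hJ hc s (holBracket hJ hc t u) =
      holBracket hJ hc (holBracket hJ hc s t) u + holBracket hJ hc t (holBracket hJ hc s u) := by
  refine Subtype.ext (funext fun x => ?_)
  have hs := extAt_germ s x
  have ht := extAt_germ t x
  have hu := extAt_germ u x
  have h : (holBracket hJ hc (holBracket hJ hc s t) u + holBracket hJ hc t
    (holBracket hJ hc s u)).1 x = (holBracket hJ hc (holBracket hJ hc s t) u).1 x +
      (holBracket hJ hc t (holBracket hJ hc s u)).1 x := rfl
  rw [h, holBracket_eq x.2 hs (holBracket_germ x.2 ht hu),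
    holBracket_eq x.2 (holBracket_germ x.2 hs ht) hu,
    holBracket_eq x.2 ht (holBracket_germ x.2 hs hu), alt_jacobi hj]
  rfl

variable (hJ) in
/-- The symbol of `t ↦ J(s, t)`. -/
noncomputable def altSymbol (s : SmoothSec E L) : ComplexVectorField E X :=
  (exists_symbol hJ s).choose

theorem altSymbol_hasSymbol (s : SmoothSec E L) :
    HasSymbol (fun t => J ![s, t]) (altSymbol hJ s) := (exists_symbol hJ s).choose_spec.2

variable (E L) in
/-- A smooth global section without zero at `x`. -/
theorem exists_ne_zero (x : X) : ∃ t : SmoothSec E L, t.1 x ≠ 0 := by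
  have hx := mem_dom_self (E := E) (L := L) x
  obtain ⟨e, he⟩ := exists_smoothSec (E := E) (x := x) (s := frame L x) (by
    filter_upwards [(dom E L x).isOpen.mem_nhds hx] with y hy
    exact (holAt_frame hy.2).smoothAt)
  exact ⟨e, by rw [he.self_of_nhds]; exact frame_ne_zero hx.2⟩

/-- Testing the Leibniz rule on a section with nonzero value at `x` recovers the symbol from `J`,
which is local; so neither the choice of symbol nor that of the extensions matters. -/
theorem symbol_congr (hJ : IsMultiderivation10 J) {s s' : SmoothSec E L} {ξ ξ' : ComplexVectorField E X}
    (hξ : HasSymbol (fun t => J ![s, t]) ξ) (hξ' : HasSymbol (fun t => J ![s', t]) ξ')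
    {a a' : SmoothFun E X} {x : X} (hs : ∀ᶠ y in nhds x, s.1 y = s'.1 y)
    (ha : ∀ᶠ y in nhds x, a.1 y = a'.1 y) : ξ.deriv a.1 x = ξ'.deriv a'.1 x := by
  obtain ⟨t, ht⟩ := exists_ne_zero E L x
  have h1 := hξ a t x
  have h2 := hξ' a' t x
  rw [alt_congr hJ (s' := s') (t' := a' • t) hs (by
    filter_upwards [ha] with y hy
    change a.1 y • t.1 y = a'.1 y • t.1 y
    rw [hy]), h2, alt_congr hJ (s := s) (s' := s') (t := t) hs
      (Filter.Eventually.of_forall fun _ => rfl), ha.self_of_nhds] at h1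
  exact (smul_left_injective ℂ ht (add_right_cancel h1)).symm

open Classical in
/-- The derivation `R_s` applied to `a`, extended by zero. -/
noncomputable def germR (hJ : IsMultiderivation10 J) {U : Opens X} (s : HolSec E L U)
    (a : HolFun E U) (x : X) : ℂ :=
  if h : x ∈ U then (altSymbol hJ (extAt s ⟨x, h⟩)).deriv (extFunAt a ⟨x, h⟩).1 x else 0

theorem germR_eq {U : Opens X} {s : HolSec E L U}
    {a : HolFun E U} {s' : SmoothSec E L} {ξ : ComplexVectorField E X}
    (hξ : HasSymbol (fun t => J ![s', t]) ξ) {a' : SmoothFun E X} {x : X} (hx : x ∈ U)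
    (hs : ∀ᶠ y in nhds x, s'.1 y = extS s.1 y) (ha : ∀ᶠ y in nhds x, a'.1 y = extF a.1 y) :
    germR hJ s a x = ξ.deriv a'.1 x := by
  unfold germR
  rw [dif_pos hx]
  exact symbol_congr hJ (altSymbol_hasSymbol _) hξ
    (((extAt_germ s ⟨x, hx⟩).and hs).mono fun y hy => hy.1.trans hy.2.symm)
    (((extFunAt_germ a ⟨x, hx⟩).and ha).mono fun y hy => hy.1.trans hy.2.symm)

theorem germR_leibniz {U : Opens X} (s : HolSec E L U) (a : HolFun E U) (t : HolSec E L U)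
    (x : U) : (holBracket hJ hc s (a • t)).1 x =
      germR hJ s a x • t.1 x + a.1 x • (holBracket hJ hc s t).1 x := by
  have hs := extAt_germ s x
  have ht := extAt_germ t x
  have ha := extFunAt_germ a x
  rw [holBracket_eq x.2 hs (germ_fun_smul x.2 ha ht), holBracket_eq x.2 hs ht,
    germR_eq (altSymbol_hasSymbol _) x.2 hs ha]
  have h1 := ht.self_of_nhds
  have h2 := ha.self_of_nhds
  rw [extS_apply _ x.2] at h1
  rw [extF_apply _ x.2] at h2
  have h3 := altSymbol_hasSymbol (hJ := hJ) (extAt s x) (extFunAt a x) (extAt t x) x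
  rw [h1, h2] at h3
  exact h3

theorem extF_resFun {U V : Opens X} (h : V ≤ U) (a : HolFun E U) {x : X} (hx : x ∈ V) :
    ∀ᶠ y in nhds x, extF a.1 y = extF (resFun h a).1 y := by
  filter_upwards [V.isOpen.mem_nhds hx] with y hy
  rw [extF_apply _ (h hy), extF_apply _ hy]
  rfl

theorem germR_res {U V : Opens X} (h : V ≤ U) (s : HolSec E L U) (a : HolFun E U) {x : X}
    (hx : x ∈ V) : germR hJ s a x = germR hJ (resSec h s) (resFun h a) x := by
  have hs := extAt_germ s ⟨x, h hx⟩
  have ha := extFunAt_germ a ⟨x, h hx⟩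
  rw [germR_eq (altSymbol_hasSymbol (hJ := hJ) _) (h hx) hs ha,
    germR_eq (altSymbol_hasSymbol (hJ := hJ) _) hx ((hs.and (extS_resSec h s hx)).mono fun y hy =>
      hy.1.trans hy.2) ((ha.and (extF_resFun h a hx)).mono fun y hy => hy.1.trans hy.2)]

theorem holBracket_res {U V : Opens X} (h : V ≤ U) (s t : HolSec E L U) :
    resSec h (holBracket hJ hc s t) = holBracket hJ hc (resSec h s) (resSec h t) := by
  refine Subtype.ext (funext fun x => ?_)
  have hs := extAt_germ s ⟨x, h x.2⟩
  have ht := extAt_germ t ⟨x, h x.2⟩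
  refine (holBracket_eq (hJ := hJ) (hc := hc) (h x.2) hs ht).trans
    (holBracket_eq (hJ := hJ) (hc := hc) x.2 ?_ ?_).symm
  · exact (hs.and (extS_resSec h s x.2)).mono fun y hy => hy.1.trans hy.2
  · exact (ht.and (extS_resSec h t x.2)).mono fun y hy => hy.1.trans hy.2

variable (L) in
/-- The frame at `x`, over an open subset of its domain. -/
noncomputable def frameSec {V : Opens X} {x : X} (hV : V ≤ dom E L x) : HolSec E L V :=
  mkSec V (frame L x) fun _ hy => holAt_frame (hV hy).2

/-- With a local frame, $R_s(a)e=\{s,ae\}-a\{s,e\}$, and the right-hand side is already known to be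
holomorphic. -/
theorem germR_contMDiffAt (hc : IsDbarClosed (k := 1) J) {U : Opens X} (s : HolSec E L U)
    (a : HolFun E U) {x : X} (hx : x ∈ U) :
    ContMDiffAt 𝓘(ℂ, E) 𝓘(ℂ) ∞ (germR hJ s a) x := by
  have hxd := mem_dom_self (E := E) (L := L) x
  have hVU : U ⊓ dom E L x ≤ U := inf_le_left
  have hVd : U ⊓ dom E L x ≤ dom E L x := inf_le_right
  have hxV : x ∈ U ⊓ dom E L x := ⟨hx, hxd⟩
  set e : HolSec E L (U ⊓ dom E L x) := frameSec L hVd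
  set p := holBracket hJ hc (resSec hVU s) (resFun hVU a • e)
  set q := holBracket hJ hc (resSec hVU s) e
  have h1 := (holAt_iff hxd.2).1 (extS_holAt p hxV)
  have h2 := (holAt_iff hxd.2).1 (extS_holAt q hxV)
  have h3 := extF_contMDiffAt a hx
  refine (h1.sub (h3.mul h2)).congr_of_eventuallyEq ?_
  filter_upwards [(U ⊓ dom E L x).isOpen.mem_nhds hxV] with y hy
  have h4 := germR_leibniz (hJ := hJ) (hc := hc) (resSec hVU s) (resFun hVU a) e ⟨y, hy⟩
  rw [← germR_res hVU s a hy] at h4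
  have h5 : extS p.1 y = germR hJ s a y • frame L x y + extF a.1 y • extS q.1 y := by
    rw [extS_apply _ hy, extS_apply _ hy, extF_apply _ hy.1]
    exact h4
  have h6 := coord_congr (x₀ := x) (t := fun z => germR hJ s a z • frame L x z +
    extF a.1 z • extS q.1 z) h5
  rw [coord_add hy.2.2, coord_smul_frame hy.2.2, coord_smul hy.2.2] at h6
  rw [h6]
  simp

/-- The derivation `R_s` of a bi-derivation, applied to a holomorphic function. -/
noncomputable def holR (hJ : IsMultiderivation10 J) (hc : IsDbarClosed (k := 1) J) {U : Opens X}
    (s : HolSec E L U) (a : HolFun E U) : HolFun E U :=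
  mkFun U (germR hJ s a) fun _ hx => germR_contMDiffAt hc s a hx

theorem holR_leibniz {U : Opens X} (s : HolSec E L U) (a : HolFun E U) (t : HolSec E L U) :
    holBracket hJ hc s (a • t) = holR hJ hc s a • t + a • holBracket hJ hc s t :=
  Subtype.ext (funext fun x => germR_leibniz s a t x)

theorem holR_res {U V : Opens X} (h : V ≤ U) (s : HolSec E L U) (a : HolFun E U) :
    resFun h (holR hJ hc s a) = holR hJ hc (resSec h s) (resFun h a) :=
  Subtype.ext (funext fun x => germR_res h s a x.2)

-- The test runs over all smaller open sets because $L$ may have no nowhere vanishing holomorphic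
-- section over $U$ itself.
variable (L) in
theorem eq_of_smul_frame {U : Opens X} {a b : HolFun E U}
    (h : ∀ (V : Opens X) (hV : V ≤ U) (e : HolSec E L V), resFun hV a • e = resFun hV b • e) :
    a = b := by
  refine Subtype.ext (funext fun x => ?_)
  have hxd := mem_dom_self (E := E) (L := L) x.1
  have hVU : U ⊓ dom E L x.1 ≤ U := inf_le_left
  have hVd : U ⊓ dom E L x.1 ≤ dom E L x.1 := inf_le_right
  have h1 := congrArg (fun w => w.1 ⟨x.1, x.2, hxd⟩) (h _ hVU (frameSec L hVd))
  exact smul_left_injective ℂ (frame_ne_zero hxd.2) h1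

end Restriction

/-! ### The Jacobi module structure defined by a bi-derivation -/

section HolomorphicModule

variable {E : Type*} [NormedAddCommGroup E] [NormedSpace ℂ E] [FiniteDimensional ℂ E]
  {X : Type*} [TopologicalSpace X] [T2Space X] [ChartedSpace E X] [IsManifold 𝓘(ℂ, E) ∞ X]
  {L : X → Type*} [∀ x, AddCommGroup (L x)] [∀ x, Module ℂ (L x)] [∀ x, TopologicalSpace (L x)]
  [TopologicalSpace (TotalSpace ℂ L)] [FiberBundle ℂ L] [VectorBundle ℂ ℂ L]
  [ContMDiffVectorBundle ∞ ℂ L 𝓘(ℂ, E)] {J : SmoothSec E L [⋀^Fin 2]→ₗ[ℂ] SmoothSec E L}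
  (hJ : IsMultiderivation10 J) (hc : IsDbarClosed (k := 1) J) {U : Opens X}

/-- `holBracket` as a bilinear map. -/
noncomputable def holBracketLin (U : Opens X) :
    HolSec E L U →ₗ[ℂ] HolSec E L U →ₗ[ℂ] HolSec E L U :=
  LinearMap.mk₂ ℂ (holBracket hJ hc) holBracket_add_left holBracket_smul_left holBracket_add_right
    holBracket_smul_right

theorem holBracketLin_leibniz (U : Opens X) (s : HolSec E L U) (a : HolFun E U) (t : HolSec E L U) :
    holBracketLin hJ hc U s (a • t) = holR hJ hc s a • t + a • holBracketLin hJ hc U s t :=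
  holR_leibniz s a t

theorem holR_add (s : HolSec E L U) (a b : HolFun E U) :
    holR hJ hc s (a + b) = holR hJ hc s a + holR hJ hc s b := by
  refine eq_of_smul_frame L fun V hV e => ?_
  have h : resFun hV (holR hJ hc s a + holR hJ hc s b) =
    resFun hV (holR hJ hc s a) + resFun hV (holR hJ hc s b) := rfl
  rw [h, holR_res, holR_res, holR_res]
  exact leibniz_add (holBracketLin_leibniz hJ hc V) (resSec hV s) (resFun hV a) (resFun hV b) e

theorem holR_mul (s : HolSec E L U) (a b : HolFun E U) :
    holR hJ hc s (a * b) = a * holR hJ hc s b + b * holR hJ hc s a := by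
  refine eq_of_smul_frame L fun V hV e => ?_
  have h : resFun hV (a * holR hJ hc s b + b * holR hJ hc s a) =
    resFun hV a * resFun hV (holR hJ hc s b) + resFun hV b * resFun hV (holR hJ hc s a) := rfl
  rw [h, holR_res, holR_res, holR_res]
  exact leibniz_mul (holBracketLin_leibniz hJ hc V) (resSec hV s) (resFun hV a) (resFun hV b) e

theorem holR_smul (s : HolSec E L U) (c : ℂ) (a : HolFun E U) :
    holR hJ hc s (c • a) = c • holR hJ hc s a := by
  refine eq_of_smul_frame L fun V hV e => ?_
  have h : resFun hV (c • holR hJ hc s a) = c • resFun hV (holR hJ hc s a) := rfl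
  rw [h, holR_res, holR_res]
  exact leibniz_smul (holBracketLin_leibniz hJ hc V) (resSec hV s) c (resFun hV a) e

theorem holR_add_left (s s' : HolSec E L U) (a : HolFun E U) :
    holR hJ hc (s + s') a = holR hJ hc s a + holR hJ hc s' a := by
  refine eq_of_smul_frame L fun V hV e => ?_
  have h : resFun hV (holR hJ hc s a + holR hJ hc s' a) =
    resFun hV (holR hJ hc s a) + resFun hV (holR hJ hc s' a) := rfl
  rw [h, holR_res, holR_res, holR_res]
  exact leibniz_add_left (holBracketLin_leibniz hJ hc V) (resSec hV s) (resSec hV s')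
    (resFun hV a) e

theorem holR_smul_left (c : ℂ) (s : HolSec E L U) (a : HolFun E U) :
    holR hJ hc (c • s) a = c • holR hJ hc s a := by
  refine eq_of_smul_frame L fun V hV e => ?_
  have h : resFun hV (c • holR hJ hc s a) = c • resFun hV (holR hJ hc s a) := rfl
  rw [h, holR_res, holR_res]
  exact leibniz_smul_left (holBracketLin_leibniz hJ hc V) c (resSec hV s) (resFun hV a) e

theorem holR_bracket (hj : ∀ l, schoutenJacobi 1 1 J J l = 0) (s t : HolSec E L U)
    (a : HolFun E U) : holR hJ hc (holBracket hJ hc s t) a =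
      holR hJ hc s (holR hJ hc t a) - holR hJ hc t (holR hJ hc s a) := by
  refine eq_of_smul_frame L fun V hV e => ?_
  have h : resFun hV (holR hJ hc s (holR hJ hc t a) - holR hJ hc t (holR hJ hc s a)) =
    resFun hV (holR hJ hc s (holR hJ hc t a)) - resFun hV (holR hJ hc t (holR hJ hc s a)) := rfl
  rw [h, holR_res, holR_res, holR_res, holR_res, holR_res, holBracket_res]
  exact leibniz_bracket (holBracketLin_leibniz hJ hc V)
    (holBracket_jacobi (hJ := hJ) (hc := hc) hj) (resSec hV s) (resSec hV t) (resFun hV a) e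

/-- `holR hJ hc s` as a derivation. -/
noncomputable def holRDer (s : HolSec E L U) : Derivation ℂ (HolFun E U) (HolFun E U) :=
  Derivation.mk' ⟨⟨holR hJ hc s, holR_add hJ hc s⟩, holR_smul hJ hc s⟩ (holR_mul hJ hc s)

/-- The Jacobi module of holomorphic sections over `U` defined by a Jacobi bi-derivation. -/
noncomputable def holModule (J : HolomorphicJacobi E L) (U : Opens X) :
    JacobiModule (HolFun E U) (HolSec E L U) where
  bracket := holBracketLin J.isMultiderivation J.isDbarClosed U
  bracket_self := holBracket_self (hJ := J.isMultiderivation) (hc := J.isDbarClosed)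
  jacobi := holBracket_jacobi (hJ := J.isMultiderivation)
    (hc := J.isDbarClosed) J.isJacobi
  R := ⟨⟨holRDer J.isMultiderivation J.isDbarClosed, fun s s' => Derivation.ext fun a =>
    holR_add_left J.isMultiderivation J.isDbarClosed s s' a⟩, fun c s => Derivation.ext fun a =>
    holR_smul_left J.isMultiderivation J.isDbarClosed c s a⟩
  R_bracket s t := Derivation.ext fun a =>
    holR_bracket J.isMultiderivation J.isDbarClosed J.isJacobi s t a
  leibniz := holR_leibniz (hJ := J.isMultiderivation) (hc := J.isDbarClosed)

/-- The Jacobi module structure on the sheaf of holomorphic sections defined by a Jacobi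
bi-derivation. -/
noncomputable def holSheaf (J : HolomorphicJacobi E L) : JacobiSheaf E L where
  on := holModule J
  bracket_res _ _ h s t := holBracket_res (hJ := J.isMultiderivation) (hc := J.isDbarClosed) h s t
  R_res _ _ h s a := holR_res (hJ := J.isMultiderivation) (hc := J.isDbarClosed) h s a

end HolomorphicModule

/-! ### The two constructions are inverse to each other -/

section Correspondence

variable {E : Type*} [NormedAddCommGroup E] [NormedSpace ℂ E] [FiniteDimensional ℂ E]
  {X : Type*} [TopologicalSpace X] [T2Space X] [ChartedSpace E X] [IsManifold 𝓘(ℂ, E) ∞ X]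
  {L : X → Type*} [∀ x, AddCommGroup (L x)] [∀ x, Module ℂ (L x)] [∀ x, TopologicalSpace (L x)]
  [TopologicalSpace (TotalSpace ℂ L)] [FiberBundle ℂ L] [VectorBundle ℂ ℂ L]
  [ContMDiffVectorBundle ∞ ℂ L 𝓘(ℂ, E)]

/-- The brackets of holomorphic sections determine the derivations `R`. -/
theorem isRestriction_of_bracket {J : SmoothSec E L [⋀^Fin 2]→ₗ[ℂ] SmoothSec E L}
    {S : JacobiSheaf E L}
    (h : ∀ (U : Opens X) (x : X) (hx : x ∈ U) (s t : HolSec E L U) (s' t' : SmoothSec E L),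
      (∀ᶠ y in nhds x, s'.1 y = extS s.1 y) → (∀ᶠ y in nhds x, t'.1 y = extS t.1 y) →
        ((S.on U).bracket s t).1 ⟨x, hx⟩ = (J ![s', t']).1 x) : IsRestriction J S := by
  intro U x s s' hs
  rw [germ_iff] at hs
  refine ⟨fun t t' ht => h U x x.2 s t s' t' hs ((germ_iff _ _).1 ht), fun a ξ hξ a' ha => ?_⟩
  rw [germ_iff_fun] at ha
  have hxd := mem_dom_self (E := E) (L := L) x.1
  have hVU : U ⊓ dom E L x.1 ≤ U := inf_le_left
  have hVd : U ⊓ dom E L x.1 ≤ dom E L x.1 := inf_le_right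
  have hxV : x.1 ∈ U ⊓ dom E L x.1 := ⟨x.2, hxd⟩
  -- On this smaller set, the Leibniz rule of `S` for $ae$ is compared with that of `J` on smooth
  -- extensions, and $e(x)\neq0$ is cancelled.
  set e : HolSec E L (U ⊓ dom E L x.1) := frameSec L hVd
  obtain ⟨e', he⟩ := exists_smoothSec_extS e hxV
  have hs' : ∀ᶠ y in nhds x.1, s'.1 y = extS (resSec hVU s).1 y :=
    (hs.and (extS_resSec hVU s hxV)).mono fun y hy => hy.1.trans hy.2
  have ha' : ∀ᶠ y in nhds x.1, a'.1 y = extF (resFun hVU a).1 y :=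
    (ha.and (extF_resFun hVU a hxV)).mono fun y hy => hy.1.trans hy.2
  have h1 := h _ x.1 hxV (resSec hVU s) (resFun hVU a • e) s' (a' • e') hs'
    (germ_fun_smul hxV ha' he)
  have h2 := h _ x.1 hxV (resSec hVU s) e s' e' hs' he
  rw [(S.on (U ⊓ dom E L x.1)).leibniz, ← S.R_res U _ hVU s a] at h1
  have h3 : ((S.on U).R s a).1 x • frame L x.1 x.1 +
      a.1 x • ((S.on (U ⊓ dom E L x.1)).bracket (resSec hVU s) e).1 ⟨x.1, hxV⟩ =
      (J ![s', a' • e']).1 x.1 := h1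
  have h4 := he.self_of_nhds
  have h5 := ha.self_of_nhds
  rw [extS_apply _ hxV] at h4
  rw [extF_apply _ x.2] at h5
  have h6 : e'.1 x.1 = frame L x.1 x.1 := h4
  rw [h2, hξ a' e' x.1, h5, h6] at h3
  exact smul_left_injective ℂ (frame_ne_zero hxd.2) (add_right_cancel h3)

theorem isRestriction_holSheaf (J : HolomorphicJacobi E L) : IsRestriction J.J (holSheaf J) :=
  isRestriction_of_bracket fun _ _ hx _ _ _ _ hs ht =>
    holBracket_eq (hJ := J.isMultiderivation) (hc := J.isDbarClosed) hx hs ht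

theorem isRestriction_sheafJ (S : JacobiSheaf E L) : IsRestriction (sheafJ S) S :=
  isRestriction_of_bracket fun U x hx s t s' t' hs ht => by
    have hd := mem_dom_self (E := E) (L := L) x
    have h := smoothBracket_eq_bracket S s' t' hd hx (JetEq.of_eventuallyEq hd hs).symm
      (JetEq.of_eventuallyEq hd ht).symm
    rw [extS_apply _ hx] at h
    exact h.symm

theorem JacobiModule.ext_of_apply {A M : Type*} [CommRing A] [Algebra ℂ A] [AddCommGroup M]
    [Module ℂ M] [Module A M] [IsScalarTower ℂ A M] {S T : JacobiModule A M}
    (h : ∀ s t, S.bracket s t = T.bracket s t) (h' : ∀ s a, S.R s a = T.R s a) : S = T := by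
  have e : S.bracket = T.bracket := LinearMap.ext₂ h
  have e' : S.R = T.R := LinearMap.ext fun s => Derivation.ext (h' s)
  cases S
  cases T
  cases e
  cases e'
  rfl

/-- Every germ of a holomorphic section or function has a smooth global extension, and $J(s',-)$ has
a symbol, so the conditions of `IsRestriction` are never vacuous and fix the structure pointwise. -/
theorem IsRestriction.sheaf_unique {J : HolomorphicJacobi E L} {S T : JacobiSheaf E L}
    (hS : IsRestriction J.J S) (hT : IsRestriction J.J T) : S = T := by
  have e : S.on = T.on := by
    refine funext fun U => JacobiModule.ext_of_apply (fun s t => ?_) fun s a => ?_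
    · refine Subtype.ext (funext fun x => ?_)
      have hs := (germ_iff _ _).2 (extAt_germ s x)
      have ht := (germ_iff _ _).2 (extAt_germ t x)
      exact ((hS U x s _ hs).1 t _ ht).trans ((hT U x s _ hs).1 t _ ht).symm
    · refine Subtype.ext (funext fun x => ?_)
      have hs := (germ_iff _ _).2 (extAt_germ s x)
      have ha := (germ_iff_fun _ _).2 (extFunAt_germ a x)
      obtain ⟨ξ, -, hξ⟩ := exists_symbol J.isMultiderivation (extAt s x)
      exact ((hS U x s _ hs).2 a ξ hξ _ ha).trans ((hT U x s _ hs).2 a ξ hξ _ ha).symm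
  cases S
  cases T
  cases e
  rfl

/-- `J` sees only $(1,0)$-jets, and these are attained by affine holomorphic sections, on which `S`
prescribes the value. -/
theorem IsRestriction.eq_bracket {J : SmoothSec E L [⋀^Fin 2]→ₗ[ℂ] SmoothSec E L}
    (hJ : IsMultiderivation10 J) {S : JacobiSheaf E L} (hS : IsRestriction J S)
    (s t : SmoothSec E L) (x : X) : (J ![s, t]).1 x =
      ((S.on (dom E L x)).bracket (affineSec E x s.1 x) (affineSec E x t.1 x)).1
        ⟨x, mem_dom_self x⟩ := by
  have hd := mem_dom_self (E := E) (L := L) x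
  have hs := extAt_germ (affineSec E x s.1 x) ⟨x, hd⟩
  have ht := extAt_germ (affineSec E x t.1 x) ⟨x, hd⟩
  rw [(hS _ ⟨x, hd⟩ _ _ ((germ_iff _ _).2 hs)).1 _ _ ((germ_iff _ _).2 ht)]
  exact alt_congr_jet hJ
    ((JetEq.of_eventuallyEq hd hs).trans (jetEq_affineSec hd s.1)).symm
    ((JetEq.of_eventuallyEq hd ht).trans (jetEq_affineSec hd t.1)).symm

theorem IsRestriction.biderivation_unique {J K : HolomorphicJacobi E L} {S : JacobiSheaf E L}
    (h : IsRestriction J.J S) (h' : IsRestriction K.J S) : J = K := by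
  have e : J.J = K.J := by
    refine AlternatingMap.ext fun v => Subtype.ext (funext fun x => ?_)
    have hv : v = ![v 0, v 1] := by
      ext i; fin_cases i <;> rfl
    rw [hv]
    exact (h.eq_bracket J.isMultiderivation _ _ x).trans
      (h'.eq_bracket K.isMultiderivation _ _ x).symm
  cases J
  cases K
  cases e
  rfl

end Correspondence

end HolJacobi

theorem mainTheorem11
    {E : Type*} [NormedAddCommGroup E] [NormedSpace ℂ E] [FiniteDimensional ℂ E]
    {X : Type*} [TopologicalSpace X] [T2Space X] [ChartedSpace E X] [IsManifold 𝓘(ℂ, E) ∞ X]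
    (L : X → Type*) [∀ x, AddCommGroup (L x)] [∀ x, Module ℂ (L x)] [∀ x, TopologicalSpace (L x)]
    [TopologicalSpace (TotalSpace ℂ L)] [FiberBundle ℂ L] [VectorBundle ℂ ℂ L]
    [ContMDiffVectorBundle ∞ ℂ L 𝓘(ℂ, E)] :
    ∃ Φ : HolJacobi.HolomorphicJacobi E L ≃ HolJacobi.JacobiSheaf E L,
      ∀ (J : HolJacobi.HolomorphicJacobi E L) (S : HolJacobi.JacobiSheaf E L),
        Φ J = S ↔ HolJacobi.IsRestriction J.J S := by
  refine ⟨Equiv.ofBijective HolJacobi.holSheaf ⟨fun J K h => ?_, fun S => ?_⟩, fun J S => ?_⟩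
  · exact (HolJacobi.isRestriction_holSheaf J).biderivation_unique
      (h ▸ HolJacobi.isRestriction_holSheaf K)
  -- `S` and the sheaf built from its induced bi-derivation are restrictions of the same
  -- bi-derivation.
  · exact ⟨HolJacobi.sheafHolomorphicJacobi S, (HolJacobi.isRestriction_holSheaf
      (HolJacobi.sheafHolomorphicJacobi S)).sheaf_unique (HolJacobi.isRestriction_sheafJ S)⟩
  · exact ⟨fun h => h ▸ HolJacobi.isRestriction_holSheaf J,
      fun h => (HolJacobi.isRestriction_holSheaf J).sheaf_unique h⟩
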